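/- **Setting.** Let $V$ be a finite set of species. A network consists of finitely many reactions with positive rates; each reaction has one reactant $\sigma\in V$ and at most two products (counted with multiplicity), none of them equal to the reactant. A reaction with $p$ products and rate $k$ contributes $-k$ to $A_{\sigma,\sigma}$ and $+k$ to $A_{\sigma',\sigma}$ for each occurrence of $\sigma'$ among its products, and $(p-1)k$ to the deficiency rate $\kappa_\sigma$; reactions without products are degradation reactions. Put $k_{\sigma\to\sigma'}=A_{\sigma',\sigma}$ ($\sigma\ne\sigma'$), $k_\sigma=\sum_{\sigma'\neq\sigma}k_{\sigma\to\sigma'}$, $a_\sigma=|A_{\sigma,\sigma}|$, $\varepsilon_\sigma=\kappa_\sigma/a_\sigma$, $$w(\alpha)_{\sigma\to\sigma'}=\frac{k_{\sigma\to\sigma'}}{a_\sigma+\alpha},\qquad \tilde w_{\sigma\to\sigma'}=\frac{k_{\sigma\to\sigma'}}{k_\sigma},$$ and extend $w(\alpha),\tilde w$ multiplicatively to paths. Edges are the pairs with $k_{\sigma\to\sigma'}>0$. The Lyapunov exponent $\lambda^*$ is the largest real part of an eigenvalue of $A$. Fix a base $b>1$; the scale of $x>0$ is $n(x)=\lfloor\log_b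 x\rfloor$; $n_{\sigma\to\sigma'}=n(k_{\sigma\to\sigma'})$ and $n_\sigma=\max_{\sigma'}n_{\sigma\to\sigma'}$ (over edges). An edge is dominant if $n_{\sigma\to\sigma'}=n_\sigma$; a path is dominant if all its edges are. The network is $\sigma^*$-dominant if there is a dominant cycle from $\sigma^*$ to $\sigma^*$ and all dominant cycles pass through $\sigma^*$. An excursion is a path $\gamma:\sigma^*=\sigma_1\to\cdots\to\sigma_\ell=\sigma^*$ with $\sigma_2,\dots,\sigma_{\ell-1}\ne\sigma^*$. Given an integer $N$, $\gamma$ is high if $n_{\sigma_i}>N$ for all $i$, and low otherwise. Let $1+\varepsilon_\gamma=\prod_{i=1}^{\ell-1}(1+\varepsilon_{\sigma_i})$ and $$\delta c_{high}=-1+\sum_{\gamma\ high}(1+\varepsilon_\gamma)\tilde w_\gamma,\qquad c'_{high}=-\frac{d}{d\alpha}\Big(\sum_{\gamma\ high}w(\alpha)_\gamma\Big)\Big|_{\alpha=0},\qquad \alpha_{thr}=\delta c_{high}/c'_{high}.$$ **Orders of magnitude.** For a fixed $K\ge1$ write $x\lesssim y$ for $x\le Ky$ and $x\ll y$ for $bx\le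 Ky$. Say that $\alpha$ lies in the window of $N$ if $\alpha\ll a_\sigma$ for all $\sigma$ with $n_\sigma>N$ and $a_\sigma\ll\alpha$ for all $\sigma$ with $n_\sigma\le N$; in the closed window, if in the first condition $\ll$ is replaced by $\lesssim$. The scales are separated if $k_{\sigma\to\sigma'}\ll k_\sigma$ for every non-dominant edge. We are away from the transition (resonance) regime if $$\sum_{\gamma\ low}\tilde w_\gamma\ll\sum_{\gamma\ high}\varepsilon_\gamma\tilde w_\gamma\qquad\text{or}\qquad \sum_{\gamma\ high}\varepsilon_\gamma\tilde w_\gamma\ll\sum_{\gamma\ low}\tilde w_\gamma .$$ **Theorem.** For every finite $V$ and $K\ge1$ there are $C\ge1$, $b_0>1$ and $p\in\mathbb N$ such that the following holds for every $b\ge b_0$ and every network on $V$ with $A$ irreducible, $\lambda^*>0$, separated scales, that is $\sigma^*$-dominant. Let $N\in\mathbb Z$ be such that we are away from the transition regime, and such that either $\lambda^*$ lies in the closed window of $N$, or $\alpha_{thr}>0$ and $\alpha_{thr}$ lies in the window of $N$ (the solution $\alpha_{thr}$ is accepted). Then: 1. $\sum_\gamma w(0)_\gamma<\infty$ (sum over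 all excursions), $\sum_{\gamma\ high}w(\alpha)_\gamma$ is differentiable at $\alpha=0$, and $c'_{high}>0$. 2. ($\lambda^*\simeq\alpha_{thr}$) $\ \alpha_{thr}\le\lambda^*\le C\alpha_{thr}$; if moreover $\lambda^*$ or $\alpha_{thr}$ lies in the window of $N$, then $\lambda^*\le(1+C/b)\,\alpha_{thr}$. 3. (Only Regime (1)(a) occurs: $\delta c_{high}>0$ is compensated by $\lambda^* c'_{high}$, and low excursions are negligible.) $\ \delta c_{high}>0$ and $b\sum_{\gamma\ low}w(\lambda^*)_\gamma\le C\,\delta c_{high}$. 4. (Integer scaling form $n_\alpha\sim-q_2-n'_{high}$.) Suppose there is no degradation reaction. Let $D_\gamma=\sum_{i=1}^{\ell-1}(n_{\sigma_i}-n_{\sigma_i\to\sigma_{i+1}})$, $n_\gamma=\min_i n_{\sigma_i}$, $d_\sigma=n(\kappa_\sigma)$ ($=-\infty$ if $\kappa_\sigma=0$), $$-n'_{high}=\min_{\gamma\ high}(D_\gamma+n_\gamma),\qquad q_2=\min_{\gamma\ high}\Big(D_\gamma+\min_{i}(n_{\sigma_i}-d_{\sigma_i})\Big).$$ Then $n(\alpha_{thr})$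 and $n(\lambda^*)$ differ from $-q_2-n'_{high}$ by at most $p$. If moreover $k_{\sigma\to\sigma'}\le K b^{n_{\sigma\to\sigma'}}$ for all edges and $\kappa_\sigma\le K b^{d_\sigma}$ whenever $\kappa_\sigma>0$, they differ from it by at most $1$. -/

import Mathlib

noncomputable section

/-- A chemical network linearised around zero: every reaction has one reactant, at most two
products (counted with multiplicity), none of which is the reactant, and a positive rate.
A reaction without products is a degradation reaction. -/
structure ReactionNetwork (V R : Type*) where
  reactant : R → V
  products : R → Multiset V
  rate : R → ℝ
  rate_pos : ∀ r, 0 < rate r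
  card_products_le : ∀ r, (products r).card ≤ 2
  reactant_notMem : ∀ r, reactant r ∉ products r

/-- The scale of a rate `x > 0` in base `b`. -/
def rateScale (b x : ℝ) : ℤ := ⌊Real.logb b x⌋

/-- Weight of a path: the product of the weights of its edges. -/
def pathWeight {V : Type*} (w : V → V → ℝ) : List V → ℝ
  | [] => 1
  | [_] => 1
  | σ :: τ :: γ => w σ τ * pathWeight w (τ :: γ)

namespace ReactionNetwork

section

variable {V R : Type*} [Fintype V] [DecidableEq V] [Fintype R] (net : ReactionNetwork V R)

/-- The adjoint generator `A`: the linearised dynamics is `dX/dt = A X`. The entry in row `σ'` and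
column `σ` collects the contributions of the reactions with reactant `σ`. -/
def generator : Matrix V V ℝ := fun σ' σ =>
  ∑ r, if net.reactant r = σ then
    net.rate r * (((net.products r).count σ' : ℝ) - if σ' = σ then 1 else 0) else 0

/-- The Lyapunov exponent `λ*`: the largest real part of an eigenvalue of `A`. -/
def lyapunovExponent : ℝ :=
  sSup (Complex.re '' spectrum ℂ (net.generator.map (fun x : ℝ => (x : ℂ))))

/-- The transition rate `k_{σ → σ'} = A_{σ', σ}`, for `σ ≠ σ'`. -/
def transitionRate (σ σ' : V) : ℝ := if σ = σ' then 0 else net.generator σ' σ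

/-- The outgoing rate `k_σ`, which is also the absolute value of the diagonal entry of the
probability preserving generator. -/
def outRate (σ : V) : ℝ := ∑ σ', net.transitionRate σ σ'

/-- The diagonal entry `a_σ = |A_{σ, σ}|`. -/
def diagRate (σ : V) : ℝ := |net.generator σ σ|

/-- The deficiency rate `κ_σ`: sum of `(p - 1) k` over the reactions with reactant `σ`, where `p`
is the number of products and `k` the rate. -/
def deficiencyRate (σ : V) : ℝ :=
  ∑ r, if net.reactant r = σ then (((net.products r).card : ℝ) - 1) * net.rate r else 0

/-- The deficiency weight `ε_σ = κ_σ / a_σ`. -/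
def deficiencyWeight (σ : V) : ℝ := net.deficiencyRate σ / net.diagRate σ

/-- Edges of the graph of split reactions. -/
def Edge (σ σ' : V) : Prop := 0 < net.transitionRate σ σ'

/-- Strong connectedness of the graph, i.e. irreducibility of `A`. -/
def Irreducible : Prop := ∀ σ σ', Relation.ReflTransGen net.Edge σ σ'

/-- The scale `n_{σ → σ'}` of an edge. -/
def edgeScale (b : ℝ) (σ σ' : V) : ℤ := rateScale b (net.transitionRate σ σ')

/-- The scale `n_σ` of a vertex: the largest scale of an outgoing edge. -/
def vertexScale (b : ℝ) (σ : V) : ℤ := sSup {n | ∃ σ', net.Edge σ σ' ∧ n = net.edgeScale b σ σ'}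

/-- An edge is dominant if its scale is the scale of its origin. -/
def DominantEdge (b : ℝ) (σ σ' : V) : Prop :=
  net.Edge σ σ' ∧ net.edgeScale b σ σ' = net.vertexScale b σ

/-- The `σ*`-dominant Hypothesis at the vertex `s`: there is a dominant cycle from `s` to `s`, and
all dominant cycles pass through `s`. -/
def SigmaDominant (b : ℝ) (s : V) : Prop :=
  (∃ l : List V, (s :: (l ++ [s])).IsChain (net.DominantEdge b)) ∧
    ∀ (τ : V) (l : List V), (τ :: (l ++ [τ])).IsChain (net.DominantEdge b) → s ∈ τ :: (l ++ [τ])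

/-- Separation of scales: the edges that are not dominant are slower than the outgoing rate of
their origin by a factor of order `b`. -/
def ScaleSeparated (b K : ℝ) : Prop :=
  ∀ σ σ', net.Edge σ σ' → ¬ net.DominantEdge b σ σ' →
    b * net.transitionRate σ σ' ≤ K * net.outRate σ

/-- The transition weight `w(α)_{σ → σ'}`. -/
def weight (α : ℝ) (σ σ' : V) : ℝ := net.transitionRate σ σ' / (net.diagRate σ + α)

/-- The probabilistic transition weight (the case `α = 0` for the probability preserving
generator). -/
def probWeight (σ σ' : V) : ℝ := net.transitionRate σ σ' / net.outRate σ

/-- Excursions from `s` to `s`: paths, given by the list of their vertices, that start and end at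
`s` and do not visit `s` in between. -/
def IsExcursion (s : V) (γ : List V) : Prop :=
  ∃ l : List V, γ = s :: (l ++ [s]) ∧ s ∉ l ∧ γ.IsChain net.Edge

/-- High excursions from `s` to `s`: all vertices have a scale above the integer `N`. -/
def highExcursions (b : ℝ) (N : ℤ) (s : V) : Set (List V) :=
  {γ | net.IsExcursion s γ ∧ ∀ σ ∈ γ, N < net.vertexScale b σ}

/-- Low excursions: all other excursions. -/
def lowExcursions (b : ℝ) (N : ℤ) (s : V) : Set (List V) :=
  {γ | net.IsExcursion s γ ∧ ¬ ∀ σ ∈ γ, N < net.vertexScale b σ}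

/-- Total `α`-weight of the high excursions. -/
def highWeight (b : ℝ) (N : ℤ) (s : V) (α : ℝ) : ℝ :=
  ∑' γ : net.highExcursions b N s, pathWeight (net.weight α) γ

/-- Total `α`-weight of the low excursions. -/
def lowWeight (b : ℝ) (N : ℤ) (s : V) (α : ℝ) : ℝ :=
  ∑' γ : net.lowExcursions b N s, pathWeight (net.weight α) γ

/-- `ε_γ`, where `1 + ε_γ` is the product of `1 + ε_σ` over all vertices of the path but the
last. -/
def pathDeficiency (γ : List V) : ℝ :=
  (γ.dropLast.map (fun σ => 1 + net.deficiencyWeight σ)).prod - 1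

/-- `δc_high`. -/
def deltaCHigh (b : ℝ) (N : ℤ) (s : V) : ℝ :=
  -1 + ∑' γ : net.highExcursions b N s, (1 + net.pathDeficiency γ) * pathWeight net.probWeight γ

/-- `c'_high`. -/
def cPrimeHigh (b : ℝ) (N : ℤ) (s : V) : ℝ :=
  -deriv (fun α => net.highWeight b N s α) 0

/-- The threshold parameter `α_thr = δc_high / c'_high`. -/
def alphaThr (b : ℝ) (N : ℤ) (s : V) : ℝ := net.deltaCHigh b N s / net.cPrimeHigh b N s

/-- The autocatalytic contribution of the high excursions to `δc_high`. -/
def highGain (b : ℝ) (N : ℤ) (s : V) : ℝ :=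
  ∑' γ : net.highExcursions b N s, net.pathDeficiency γ * pathWeight net.probWeight γ

/-- The total probability of the low excursions; `δc_high` is the difference between `highGain`
and `lowLoss`. -/
def lowLoss (b : ℝ) (N : ℤ) (s : V) : ℝ :=
  ∑' γ : net.lowExcursions b N s, pathWeight net.probWeight γ

/-- Away from the transition regime (resonance): the two contributions to `δc_high` are not of the
same order. -/
def AwayFromTransition (b K : ℝ) (N : ℤ) (s : V) : Prop :=
  b * net.lowLoss b N s ≤ K * net.highGain b N s ∨ b * net.highGain b N s ≤ K * net.lowLoss b N s

/-- `α` is in the scale window that lies just above the integer `N`: it is small compared to `a_σ`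
when `n_σ > N`, and large compared to `a_σ` when `n_σ ≤ N`. -/
def InWindow (b K : ℝ) (N : ℤ) (α : ℝ) : Prop :=
  (∀ σ, N < net.vertexScale b σ → b * α ≤ K * net.diagRate σ) ∧
    ∀ σ, net.vertexScale b σ ≤ N → b * net.diagRate σ ≤ K * α

/-- The same window, closed at its upper end: `α` may be of the same order as some of the `a_σ`
with `n_σ > N`. -/
def InClosedWindow (b K : ℝ) (N : ℤ) (α : ℝ) : Prop :=
  (∀ σ, N < net.vertexScale b σ → α ≤ K * net.diagRate σ) ∧
    ∀ σ, net.vertexScale b σ ≤ N → b * net.diagRate σ ≤ K * α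

/-- The depth `D_γ`. -/
def depth (b : ℝ) : List V → ℤ
  | [] => 0
  | [_] => 0
  | σ :: τ :: γ => (net.vertexScale b σ - net.edgeScale b σ τ) + depth b (τ :: γ)

/-- The scale `n_γ` of a path: the smallest scale of its vertices. -/
def pathScale (b : ℝ) (γ : List V) : ℤ := sInf {n | ∃ σ ∈ γ, n = net.vertexScale b σ}

/-- `n'_high`, defined by `-n'_high = min (D_γ + n_γ)` over the high excursions. -/
def nPrimeHigh (b : ℝ) (N : ℤ) (s : V) : ℤ :=
  -sInf {m | ∃ γ ∈ net.highExcursions b N s, m = depth net b γ + net.pathScale b γ}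

/-- `q_2`: the minimum of `D_γ + n_σ - d_σ` over the high excursions `γ` and the vertices `σ` of `γ`,
where `d_σ` is the scale of the deficiency rate `κ_σ`. Vertices with `κ_σ = 0`, for which
`d_σ = -∞`, do not contribute to the minimum. -/
def qTwo (b : ℝ) (N : ℤ) (s : V) : ℤ :=
  sInf {m | ∃ γ ∈ net.highExcursions b N s, ∃ σ ∈ γ, 0 < net.deficiencyRate σ ∧
    m = depth net b γ + (net.vertexScale b σ - rateScale b (net.deficiencyRate σ))}

/-- Transition rates and non-zero deficiency rates are given by their scales up to a factor `K`. -/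
def RatesNearScales (b K : ℝ) : Prop :=
  (∀ σ σ', net.Edge σ σ' → net.transitionRate σ σ' ≤ K * b ^ net.edgeScale b σ σ') ∧
    ∀ σ, 0 < net.deficiencyRate σ →
      net.deficiencyRate σ ≤ K * b ^ rateScale b (net.deficiencyRate σ)

end

end ReactionNetwork

end

/-! Let W(α) be the total w(α)-weight of all excursions from σ*. If W(α) = 1, the first passage
weights towards σ* form a positive left eigenvector of A with eigenvalue α; if W(α) ≤ 1, they still
give a positive supersolution. By Collatz–Wielandt, α then equals, respectively bounds, the largest
real part in the spectrum, so λ* > 0 forces W(0) > 1 and W(λ*) = 1 (`exists_solution`,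
`returnWeight_lyapunovExponent`). Write W = W_high + W_low. Since δc_high = W_high(0) - 1, this
equation reads W_high(0) - W_high(λ*) = δc_high + W_low(λ*). What remains is to show that the left
side is close to λ* c'_high and that W_low(λ*) is negligible.

The quantitative input is that a loop avoiding σ* contains a non-dominant edge and so has weight
O(1/b). By a pigeonhole argument, sums over all paths, even with an extra factor 4^length, are
bounded by a constant times the sums over the finitely many short paths, and this persists when only
paths visiting a prescribed set are counted (`LightLoops.tsum_hit_le`). Hence all series converge,
low excursions have w(0)-weight comparable to their probability, and excursions have bounded mean
length in the measure that defines c'_high.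

For the sign of δc_high, recurrence of the Markov chain gives δc_high = gain - loss, with gain from
high excursions and loss the probability of low ones (`deltaCHigh_eq_sub`). If the loss prevailed,
either α_thr could not be positive, or low excursions, damped by O(1/b), could not restore W(λ*) =
1. So the gain prevails (`threshold_estimates`).

For the linearisation, the tangent of W_high at 0 lies below its graph, which gives α_thr ≤ λ*; the
reverse bound is a Jensen inequality using the bounded mean length (`le_highWeight_sub`,
`alphaThr_estimates`). For the integer form, weights are replaced by powers of b; the resulting
model also has light loops, so each sum is governed by its largest term (`scaling_of_sum`). -/

noncomputable section

set_option linter.unusedSectionVars false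

open Finset Matrix

/-! ### Powers of nonnegative matrices with light loops. -/

section NonnegMatrix

variable {X : Type*} [Fintype X] [DecidableEq X] {Q : Matrix X X ℝ}

theorem Matrix.pow_entry_nonneg (hQ : ∀ x y, 0 ≤ Q x y) (k : ℕ) : ∀ x y, 0 ≤ (Q ^ k) x y := by
  induction k with
  | zero =>
    intro x y
    rw [pow_zero, Matrix.one_apply]
    split_ifs <;> norm_num
  | succ k ih =>
    intro x y
    rw [pow_succ, Matrix.mul_apply]
    exact sum_nonneg fun z _ => mul_nonneg (ih x z) (hQ z y)

theorem Matrix.pow_mulVec_nonneg (hQ : ∀ x y, 0 ≤ Q x y) {r : X → ℝ} (hr : ∀ x, 0 ≤ r x)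
    (k : ℕ) (x : X) : 0 ≤ ((Q ^ k) *ᵥ r) x :=
  sum_nonneg fun y _ => mul_nonneg (Matrix.pow_entry_nonneg hQ k x y) (hr y)

theorem Matrix.pow_succ_mulVec (r : X → ℝ) (k : ℕ) (x : X) :
    ((Q ^ (k + 1)) *ᵥ r) x = ∑ y, Q x y * ((Q ^ k) *ᵥ r) y := by
  rw [pow_succ', ← Matrix.mulVec_mulVec]
  rfl

/-- Pigeonhole principle for the powers of a nonnegative matrix: long paths contain loops. -/
theorem Matrix.pow_mulVec_le_of_loops (hQ : ∀ x y, 0 ≤ Q x y) {r : X → ℝ} (hr : ∀ x, 0 ≤ r x)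
    {η : ℝ} (hη0 : 0 ≤ η)
    (hη : ∀ x l, 1 ≤ l → l ≤ Fintype.card X → (Q ^ l) x x ≤ η) :
    ∀ (k : ℕ) (U : Finset X) (v : X), k ≤ Fintype.card X → Fintype.card X ≤ U.card + k →
      ((Q ^ k) *ᵥ r) v ≤ ∑ j ∈ range (k + 1), ∑ x ∈ U, (Q ^ j) v x * ((Q ^ (k - j)) *ᵥ r) x
        + η * k * ∑ i ∈ range k, ((Q ^ i) *ᵥ r) v := by
  have hS := fun k x => Matrix.pow_mulVec_nonneg hQ hr k x
  have hP := fun k x y => Matrix.pow_entry_nonneg hQ k x y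
  have hin : ∀ (k : ℕ) (U : Finset X) (v : X), v ∈ U →
      ((Q ^ k) *ᵥ r) v ≤ ∑ j ∈ range (k + 1), ∑ x ∈ U, (Q ^ j) v x * ((Q ^ (k - j)) *ᵥ r) x
        + η * k * ∑ i ∈ range k, ((Q ^ i) *ᵥ r) v := by
    intro k U v hv
    have h1 : ((Q ^ k) *ᵥ r) v ≤ ∑ x ∈ U, (Q ^ 0) v x * ((Q ^ (k - 0)) *ᵥ r) x := by
      refine le_trans ?_ (single_le_sum (fun x _ => mul_nonneg (hP 0 v x) (hS _ x)) hv)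
      simp
    have h2 : ∑ x ∈ U, (Q ^ 0) v x * ((Q ^ (k - 0)) *ᵥ r) x ≤
        ∑ j ∈ range (k + 1), ∑ x ∈ U, (Q ^ j) v x * ((Q ^ (k - j)) *ᵥ r) x :=
      single_le_sum (f := fun j => ∑ x ∈ U, (Q ^ j) v x * ((Q ^ (k - j)) *ᵥ r) x)
        (fun j _ => sum_nonneg fun x _ => mul_nonneg (hP j v x) (hS _ x)) (by simp)
    have h3 : 0 ≤ η * k * ∑ i ∈ range k, ((Q ^ i) *ᵥ r) v :=
      mul_nonneg (by positivity) (sum_nonneg fun i _ => hS i v)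
    linarith
  intro k
  induction k with
  | zero =>
    intro U v _ hU
    have : U = univ := (card_eq_iff_eq_univ U).1 (le_antisymm (card_le_univ U) (by simpa using hU))
    exact hin 0 U v (by simp [this])
  | succ k ih =>
    intro U v hk hU
    -- `U` collects the vertices already met. From `v ∉ U`, one step is made with `v` added to `U`:
    -- a later hit of the old `U` has the required form, while a return to `v` closes a loop of
    -- length at most `card X` and costs `η`. The invariant `card X ≤ U.card + k` is the pigeonhole:
    -- once no step is left, `U` is everything.
    by_cases hv : v ∈ U
    · exact hin _ U v hv
    have hc : Fintype.card X ≤ (insert v U).card + k := by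
      rw [card_insert_of_notMem hv]; omega
    rw [Matrix.pow_succ_mulVec]
    calc ∑ y, Q v y * ((Q ^ k) *ᵥ r) y
        ≤ ∑ y, Q v y * (∑ j ∈ range (k + 1), ∑ x ∈ insert v U,
            (Q ^ j) y x * ((Q ^ (k - j)) *ᵥ r) x + η * k * ∑ i ∈ range k, ((Q ^ i) *ᵥ r) y) :=
          sum_le_sum fun y _ => mul_le_mul_of_nonneg_left
            (ih (insert v U) y (by omega) hc) (hQ v y)
      _ = ∑ j ∈ range (k + 1), ∑ x ∈ insert v U, (Q ^ (j + 1)) v x * ((Q ^ (k - j)) *ᵥ r) x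
            + η * k * ∑ i ∈ range k, ((Q ^ (i + 1)) *ᵥ r) v := by
          simp_rw [mul_add, sum_add_distrib]
          congr 1
          · simp_rw [mul_sum]
            rw [sum_comm]
            refine sum_congr rfl fun j _ => ?_
            rw [sum_comm]
            refine sum_congr rfl fun x _ => ?_
            rw [pow_succ', Matrix.mul_apply, sum_mul]
            exact sum_congr rfl fun y _ => by ring
          · simp_rw [Matrix.pow_succ_mulVec, mul_sum]
            rw [sum_comm]
            refine sum_congr rfl fun j _ => ?_
            exact sum_congr rfl fun y _ => by ring
      _ ≤ (∑ j ∈ range (k + 1), ∑ x ∈ U, (Q ^ (j + 1)) v x * ((Q ^ (k - j)) *ᵥ r) x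
            + η * ∑ i ∈ range (k + 1), ((Q ^ i) *ᵥ r) v)
            + η * k * ∑ i ∈ range (k + 1), ((Q ^ i) *ᵥ r) v := by
          refine add_le_add ?_ ?_
          · simp_rw [sum_insert hv, sum_add_distrib]
            rw [add_comm]
            refine add_le_add le_rfl ?_
            rw [← sum_range_reflect (fun i => ((Q ^ i) *ᵥ r) v), mul_sum]
            refine sum_le_sum fun j hj => ?_
            have hj' : k + 1 - 1 - j = k - j := by omega
            rw [hj']
            exact mul_le_mul_of_nonneg_right
              (hη v (j + 1) (by omega) (by have := mem_range.1 hj; omega)) (hS _ v)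
          · refine mul_le_mul_of_nonneg_left ?_ (by positivity)
            rw [sum_range_succ' (fun i => ((Q ^ i) *ᵥ r) v)]
            linarith [hS 0 v]
      _ ≤ _ := by
          rw [sum_range_succ' _ (k + 1)]
          have h0 : 0 ≤ ∑ x ∈ U, (Q ^ 0) v x * ((Q ^ (k + 1 - 0)) *ᵥ r) x :=
            sum_nonneg fun x _ => mul_nonneg (hP 0 v x) (hS _ x)
          simp only [Nat.add_sub_add_right, Nat.sub_zero] at h0 ⊢
          push_cast
          linarith

/-- If all short loops are light, then geometrically weighted sums over all paths are dominated by
the sums over short paths. -/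
theorem Matrix.sum_pow_mulVec_le (hQ : ∀ x y, 0 ≤ Q x y) {r : X → ℝ} (hr : ∀ x, 0 ≤ r x)
    {η θ : ℝ} (hη0 : 0 ≤ η) (hθ : 1 ≤ θ)
    (hη : ∀ x l, 1 ≤ l → l ≤ Fintype.card X → (Q ^ l) x x ≤ η)
    (hsmall : η * Fintype.card X ^ 2 * θ ^ Fintype.card X ≤ 1 / 2) (v : X) (n : ℕ) :
    ∑ m ∈ range n, θ ^ m * ((Q ^ m) *ᵥ r) v ≤
      2 * ∑ m ∈ range (Fintype.card X), θ ^ m * ((Q ^ m) *ᵥ r) v := by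
  set M := Fintype.card X with hM
  have hS := fun k x => Matrix.pow_mulVec_nonneg hQ hr k x
  have hθ0 : 0 ≤ θ := by linarith
  have hT : ∀ m, 0 ≤ θ ^ m * ((Q ^ m) *ᵥ r) v := fun m => mul_nonneg (by positivity) (hS m v)
  have hrec : ∀ m, ((Q ^ (M + m)) *ᵥ r) v ≤ η * M * ∑ i ∈ range M, ((Q ^ (i + m)) *ᵥ r) v := by
    intro m
    have := Matrix.pow_mulVec_le_of_loops hQ (r := (Q ^ m) *ᵥ r) (hS m) hη0 hη M ∅ v le_rfl
      (by simp [hM])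
    simpa [Matrix.mulVec_mulVec, ← pow_add] using this
  have hmono : ∀ {a b : ℕ}, a ≤ b → ∑ m ∈ range a, θ ^ m * ((Q ^ m) *ᵥ r) v ≤
      ∑ m ∈ range b, θ ^ m * ((Q ^ m) *ᵥ r) v := fun hab =>
    sum_le_sum_of_subset_of_nonneg (range_subset_range.2 hab) fun m _ _ => hT m
  have hlong : ∑ m ∈ range n, θ ^ (M + m) * ((Q ^ (M + m)) *ᵥ r) v ≤
      1 / 2 * ∑ m ∈ range (M + n), θ ^ m * ((Q ^ m) *ᵥ r) v := by
    calc ∑ m ∈ range n, θ ^ (M + m) * ((Q ^ (M + m)) *ᵥ r) v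
        ≤ ∑ m ∈ range n, ∑ i ∈ range M, η * M * θ ^ M *
            (θ ^ (i + m) * ((Q ^ (i + m)) *ᵥ r) v) := by
          refine sum_le_sum fun m _ => ?_
          calc θ ^ (M + m) * ((Q ^ (M + m)) *ᵥ r) v
              ≤ θ ^ (M + m) * (η * M * ∑ i ∈ range M, ((Q ^ (i + m)) *ᵥ r) v) :=
                mul_le_mul_of_nonneg_left (hrec m) (by positivity)
            _ = ∑ i ∈ range M, η * M * θ ^ M * (θ ^ m * ((Q ^ (i + m)) *ᵥ r) v) := by
                rw [pow_add, mul_sum, mul_sum]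
                exact sum_congr rfl fun i _ => by ring
            _ ≤ _ := by
                refine sum_le_sum fun i _ => mul_le_mul_of_nonneg_left ?_ (by positivity)
                exact mul_le_mul_of_nonneg_right (pow_le_pow_right₀ hθ (by omega)) (hS _ v)
      _ = η * M * θ ^ M * ∑ i ∈ range M, ∑ m ∈ range n,
            (θ ^ (i + m) * ((Q ^ (i + m)) *ᵥ r) v) := by
          rw [sum_comm, mul_sum]
          exact sum_congr rfl fun i _ => by rw [mul_sum]
      _ ≤ η * M * θ ^ M * ∑ i ∈ range M, ∑ m ∈ range (M + n), θ ^ m * ((Q ^ m) *ᵥ r) v := by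
          refine mul_le_mul_of_nonneg_left (sum_le_sum fun i hi => ?_) (by positivity)
          have hi' := mem_range.1 hi
          refine le_trans ?_ (hmono (show i + n ≤ M + n by omega))
          rw [sum_range_add]
          linarith [sum_nonneg fun m (_ : m ∈ range i) => hT m]
      _ = (η * M ^ 2 * θ ^ M) * ∑ m ∈ range (M + n), θ ^ m * ((Q ^ m) *ᵥ r) v := by
          rw [sum_const, card_range, nsmul_eq_mul]; ring
      _ ≤ _ := mul_le_mul_of_nonneg_right hsmall (sum_nonneg fun m _ => hT m)
  -- The sum up to `M + n` is at most its head plus half of itself; being finite, that half can be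
  -- absorbed. Convergence is therefore a consequence and not an assumption.
  have h1 := hmono (show n ≤ M + n by omega)
  have h2 := sum_range_add (fun m => θ ^ m * ((Q ^ m) *ᵥ r) v) M n
  linarith

/-- Entries of powers of a nonnegative matrix change little when small entries are dropped. -/
theorem Matrix.pow_apply_le_add {D : Matrix X X ℝ} {β τ : ℝ} (hQ : ∀ x y, 0 ≤ Q x y)
    (hβ : 1 ≤ β) (hτ : 0 ≤ τ) (hQβ : ∀ x y, Q x y ≤ β) (hD : ∀ x y, 0 ≤ D x y)
    (hDQ : ∀ x y, D x y ≤ Q x y) (hdiff : ∀ x y, Q x y ≤ D x y + τ) (l : ℕ) :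
    ∀ x y, (Q ^ l) x y ≤ (D ^ l) x y + l * (Fintype.card X * β) ^ l * τ := by
  have hpow : ∀ l x y, (Q ^ l) x y ≤ (Fintype.card X * β) ^ l := by
    intro l
    induction l with
    | zero => intro x y; rw [pow_zero, Matrix.one_apply]; split_ifs <;> norm_num
    | succ l ih =>
      intro x y
      rw [pow_succ', Matrix.mul_apply]
      calc ∑ z, Q x z * (Q ^ l) z y ≤ ∑ _z : X, β * (Fintype.card X * β) ^ l :=
            sum_le_sum fun z _ => mul_le_mul (hQβ x z) (ih z y)
              (Matrix.pow_entry_nonneg hQ l z y) (by linarith)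
        _ = _ := by rw [sum_const, card_univ, nsmul_eq_mul]; ring
  induction l with
  | zero => intro x y; simp
  | succ l ih =>
    intro x y
    set N : ℝ := ((Fintype.card X : ℕ) : ℝ) with hN
    have hN0 : 0 ≤ N := by positivity
    rw [pow_succ', Matrix.mul_apply, pow_succ' D, Matrix.mul_apply]
    -- Telescoping: changing the first factor costs at most `τ`, changing the remaining `l` factors
    -- is the induction hypothesis.
    calc ∑ z, Q x z * (Q ^ l) z y
        ≤ ∑ z, (D x z * (D ^ l) z y + β * (l * (N * β) ^ l * τ) + τ * (N * β) ^ l) := by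
          refine sum_le_sum fun z _ => ?_
          have h1 : Q x z * (Q ^ l) z y ≤ (D x z + τ) * (Q ^ l) z y :=
            mul_le_mul_of_nonneg_right (hdiff x z) (Matrix.pow_entry_nonneg hQ l z y)
          have h2 : D x z * (Q ^ l) z y ≤ D x z * ((D ^ l) z y + l * (N * β) ^ l * τ) :=
            mul_le_mul_of_nonneg_left (ih z y) (hD x z)
          have h3 : D x z * (l * (N * β) ^ l * τ) ≤ β * (l * (N * β) ^ l * τ) :=
            mul_le_mul_of_nonneg_right ((hDQ x z).trans (hQβ x z)) (by positivity)
          have h4 : τ * (Q ^ l) z y ≤ τ * (N * β) ^ l :=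
            mul_le_mul_of_nonneg_left (hpow l z y) hτ
          linarith
      _ = ∑ z, D x z * (D ^ l) z y + (l * (N * β) ^ (l + 1) * τ + N * (N * β) ^ l * τ) := by
          rw [sum_add_distrib, sum_add_distrib, sum_const, sum_const, card_univ, nsmul_eq_mul,
            nsmul_eq_mul, ← hN]
          ring
      _ ≤ _ := by
          have : N * (N * β) ^ l * τ ≤ (N * β) ^ (l + 1) * τ := by
            refine mul_le_mul_of_nonneg_right ?_ hτ
            rw [pow_succ']
            exact mul_le_mul_of_nonneg_right (by nlinarith) (by positivity)
          push_cast
          linarith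

end NonnegMatrix

/-! ### Sums over paths and their reduction to short paths. -/

theorem pathWeight_nonneg {V : Type*} {u : V → V → ℝ} (hu : ∀ x y, 0 ≤ u x y) :
    ∀ γ : List V, 0 ≤ pathWeight u γ
  | [] => zero_le_one
  | [_] => zero_le_one
  | σ :: τ :: γ => mul_nonneg (hu σ τ) (pathWeight_nonneg hu (τ :: γ))

section PathSums

variable {V : Type*} [Fintype V] [DecidableEq V]

/-- The embedding that maps a pair of head and tail to a list. -/
def consEmbedding (V : Type*) : V × List V ↪ List V where
  toFun p := p.1 :: p.2
  inj' p q h := by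
    rw [List.cons.injEq] at h
    exact Prod.ext h.1 h.2

theorem consEmbedding_apply {V : Type*} (x : V) (l : List V) : consEmbedding V (x, l) = x :: l :=
  rfl

/-- The lists of a given length. -/
def listsOfLength (V : Type*) [Fintype V] [DecidableEq V] : ℕ → Finset (List V)
  | 0 => {[]}
  | m + 1 => ((univ : Finset V) ×ˢ listsOfLength V m).map (consEmbedding V)

theorem mem_listsOfLength {m : ℕ} {l : List V} : l ∈ listsOfLength V m ↔ l.length = m := by
  induction m generalizing l with
  | zero => simp [listsOfLength]
  | succ m ih =>
    simp only [listsOfLength, mem_map, mem_product, mem_univ, true_and, Prod.exists, ih,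
      consEmbedding_apply]
    constructor
    · rintro ⟨x, l', h, rfl⟩
      simp [h]
    · intro h
      cases l with
      | nil => simp at h
      | cons x l' => exact ⟨x, l', by simpa using h, rfl⟩

theorem sum_listsOfLength_succ (m : ℕ) (f : List V → ℝ) :
    ∑ l ∈ listsOfLength V (m + 1), f l = ∑ x, ∑ l ∈ listsOfLength V m, f (x :: l) := by
  simp [listsOfLength, sum_map, sum_product, consEmbedding_apply]

/-- The lists that are shorter than a given length. -/
def shortLists (V : Type*) [Fintype V] [DecidableEq V] (M : ℕ) : Finset (List V) :=
  (range M).biUnion (listsOfLength V)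

theorem mem_shortLists {M : ℕ} {l : List V} : l ∈ shortLists V M ↔ l.length < M := by
  simp [shortLists, mem_listsOfLength]

theorem sum_shortLists (M : ℕ) (f : List V → ℝ) :
    ∑ l ∈ shortLists V M, f l = ∑ m ∈ range M, ∑ l ∈ listsOfLength V m, f l := by
  refine sum_biUnion fun i _ j _ hij => disjoint_left.2 fun l hi hj => hij ?_
  rw [← mem_listsOfLength.1 hi, ← mem_listsOfLength.1 hj]

theorem subset_shortLists (F : Finset (List V)) : ∃ M, F ⊆ shortLists V M :=
  ⟨F.sup List.length + 1, fun _ hl =>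
    mem_shortLists.2 (Nat.lt_succ_of_le (Finset.le_sup (f := List.length) hl))⟩

theorem tendsto_shortLists : Filter.Tendsto (shortLists V) Filter.atTop Filter.atTop :=
  Filter.tendsto_atTop_finset_of_monotone
    (fun _ _ h _ hl => mem_shortLists.2 ((mem_shortLists.1 hl).trans_le h))
    fun l => ⟨l.length + 1, mem_shortLists.2 (Nat.lt_succ_self _)⟩

theorem sum_le_of_sum_shortLists_le {f : List V → ℝ} (hf : ∀ l, 0 ≤ f l) {c : ℝ}
    (h : ∀ M, ∑ l ∈ shortLists V M, f l ≤ c) (F : Finset (List V)) : ∑ l ∈ F, f l ≤ c := by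
  obtain ⟨M, hM⟩ := subset_shortLists F
  exact (sum_le_sum_of_subset_of_nonneg hM fun l _ _ => hf l).trans (h M)

/-- The weight of the path from `σ` to `t` with interior vertices `l`, provided that it
does not visit `t` before its end and stays in `A`. -/
def passageWeight (A : Finset V) (u : V → V → ℝ) (t σ : V) (l : List V) : ℝ :=
  if t ∉ l ∧ ∀ x ∈ σ :: l, x ∈ A then pathWeight u (σ :: (l ++ [t])) else 0

theorem passageWeight_nonneg {u : V → V → ℝ} (hu : ∀ x y, 0 ≤ u x y) (A : Finset V) (t σ : V)
    (l : List V) : 0 ≤ passageWeight A u t σ l := by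
  unfold passageWeight
  split_ifs
  exacts [pathWeight_nonneg hu _, le_rfl]

/-- The transfer matrix of paths that avoid `t`, stay in `A`, and record whether they visited `B`. -/
def flagMatrix (A B : Finset V) (u : V → V → ℝ) (t : V) : Matrix (V × Bool) (V × Bool) ℝ :=
  fun p q => if q.1 ≠ t ∧ q.1 ∈ A ∧ q.2 = (p.2 || decide (q.1 ∈ B)) then u p.1 q.1 else 0

/-- The vector closes the path with an edge to `t` and keeps only raised flags. The flag is part of
the state so that a loop of this matrix begins and ends with the same flag: cutting it out cannot
lose the visit to `B`, and the pigeonhole bound stays within the paths that meet `B`. -/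
theorem flagMatrix_pow_mulVec (A B : Finset V) (u : V → V → ℝ) (t : V) (m : ℕ) :
    ∀ p : V × Bool, p.1 ∈ A →
      ((flagMatrix A B u t ^ m) *ᵥ fun q => if q.2 = true then u q.1 t else 0) p =
        ∑ l ∈ listsOfLength V m,
          if p.2 = true ∨ ∃ x ∈ l, x ∈ B then passageWeight A u t p.1 l else 0 := by
  induction m with
  | zero =>
    rintro ⟨σ, f⟩ hσ
    have hσ : σ ∈ A := hσ
    simp [listsOfLength, passageWeight, pathWeight, hσ]
  | succ m ih =>
    rintro ⟨σ, f⟩ hσ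
    have hσ : σ ∈ A := hσ
    rw [Matrix.pow_succ_mulVec, sum_listsOfLength_succ, Fintype.sum_prod_type]
    refine sum_congr rfl fun x _ => ?_
    by_cases hx : x ≠ t ∧ x ∈ A
    · rw [sum_eq_single (f || decide (x ∈ B))]
      · rw [ih _ hx.2, mul_sum]
        refine sum_congr rfl fun l _ => ?_
        have h1 : flagMatrix A B u t (σ, f) (x, f || decide (x ∈ B)) = u σ x := by
          simp [flagMatrix, hx.1, hx.2]
        rw [h1]
        have h2 : passageWeight A u t σ (x :: l) = u σ x * passageWeight A u t x l := by
          simp only [passageWeight, List.mem_cons, forall_eq_or_imp, hσ, hx.2, true_and, not_or,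
            hx.1.symm, not_false_eq_true, mul_ite, mul_zero]
          rfl
        rw [h2]
        simp only [Bool.or_eq_true, decide_eq_true_eq, List.mem_cons, exists_eq_or_imp, or_assoc,
          mul_ite, mul_zero]
      · intro g _ hg
        simp [flagMatrix, hg]
      · simp
    · rw [sum_eq_zero, sum_eq_zero]
      · intro l _
        have : passageWeight A u t σ (x :: l) = 0 := by
          refine if_neg fun h => hx ⟨?_, h.2 x (by simp)⟩
          rintro rfl
          exact h.1 (by simp)
        simp [this]
      · intro g _
        have : flagMatrix A B u t (σ, f) (x, g) = 0 := if_neg fun h => hx ⟨h.1, h.2.1⟩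
        rw [this, zero_mul]

/-- Bounded edge weights, for which all edges outside an acyclic relation are light. -/
structure LightLoops (u : V → V → ℝ) (D : V → V → Prop) (t : V) (τ : ℝ) : Prop where
  nonneg : ∀ x y, 0 ≤ u x y
  le_two : ∀ x y, u x y ≤ 2
  le_of_not : ∀ x y, ¬ D x y → u x y ≤ τ
  acyclic : ∀ (x : V) (l : List V), (x :: (l ++ [x])).IsChain D → t ∈ x :: (l ++ [x])

variable {u : V → V → ℝ} {D : V → V → Prop} {t : V} {τ : ℝ}

theorem flagMatrix_nonneg (hu : ∀ x y, 0 ≤ u x y) (A B : Finset V) (t : V) (p q : V × Bool) :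
    0 ≤ flagMatrix A B u t p q := by
  unfold flagMatrix
  split_ifs
  exacts [hu _ _, le_rfl]

-- A loop that avoids `t` cannot consist of `D`-edges only, so the matrix restricted to `D` has
-- vanishing diagonal powers. Every loop thus uses a light edge, and comparison with the restricted
-- matrix bounds its weight.
open Classical in
theorem LightLoops.flagMatrix_loop (h : LightLoops u D t τ) (hτ : 0 ≤ τ) (A B : Finset V)
    (p : V × Bool) (l : ℕ) (hl : 1 ≤ l) :
    (flagMatrix A B u t ^ l) p p ≤ l * (Fintype.card (V × Bool) * 2) ^ l * τ := by
  set Q := flagMatrix A B u t with hQ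
  have hQ0 : ∀ p q, 0 ≤ Q p q := flagMatrix_nonneg h.nonneg A B t
  set P : Matrix (V × Bool) (V × Bool) ℝ :=
    fun p q => if q.1 ≠ t ∧ D p.1 q.1 then Q p q else 0 with hP
  have hchain : ∀ (k : ℕ) (p q : V × Bool), (P ^ (k + 1)) p q ≠ 0 →
      ∃ c : List V, (p.1 :: (c ++ [q.1])).IsChain D ∧ t ∉ c ∧ q.1 ≠ t := by
    intro k
    induction k with
    | zero =>
      intro p q hpq
      have h2 : q.1 ≠ t ∧ D p.1 q.1 := by
        by_contra hcon
        apply hpq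
        rw [zero_add, pow_one]
        exact if_neg hcon
      exact ⟨[], by simpa using h2.2, by simp, h2.1⟩
    | succ k ih =>
      intro p q hpq
      rw [pow_succ', Matrix.mul_apply] at hpq
      obtain ⟨z, _, hz⟩ := exists_ne_zero_of_sum_ne_zero hpq
      have h2 : z.1 ≠ t ∧ D p.1 z.1 := by
        by_contra hcon
        apply hz
        have : P p z = 0 := if_neg hcon
        rw [this, zero_mul]
      obtain ⟨c, hc, htc, hq⟩ := ih z q (right_ne_zero_of_mul hz)
      refine ⟨z.1 :: c, ?_, ?_, hq⟩
      · rw [List.cons_append, List.isChain_cons_cons]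
        exact ⟨h2.2, hc⟩
      · simpa [h2.1.symm] using htc
  have hzero : (P ^ l) p p = 0 := by
    by_contra hne
    obtain ⟨k, rfl⟩ : ∃ k, l = k + 1 := ⟨l - 1, by omega⟩
    obtain ⟨c, hc, htc, hp⟩ := hchain k p p hne
    have := h.acyclic p.1 c hc
    simp only [List.mem_cons, List.mem_append, List.not_mem_nil, or_false] at this
    rcases this with h1 | h1 | h1
    exacts [hp h1.symm, htc h1, hp h1.symm]
  have := Matrix.pow_apply_le_add (Q := Q) (D := P) (β := 2) (τ := τ) hQ0 (by norm_num) hτ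
    (fun p q => by
      simp only [hQ, flagMatrix]
      split_ifs
      exacts [h.le_two _ _, by norm_num])
    (fun p q => by
      simp only [hP]
      split_ifs
      exacts [hQ0 _ _, le_rfl])
    (fun p q => by
      simp only [hP]
      split_ifs
      exacts [le_rfl, hQ0 _ _])
    (fun p q => by
      simp only [hP]
      split_ifs with h1
      · linarith
      · rw [zero_add]
        simp only [hQ, flagMatrix]
        split_ifs with h2
        · exact h.le_of_not _ _ fun h3 => h1 ⟨h2.1, h3⟩
        · exact hτ) l p p
  rwa [hzero, zero_add] at this

/-- The number of edges from which paths count as long. -/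
abbrev pathBound (V : Type*) [Fintype V] : ℕ := Fintype.card (V × Bool)

/-- How light the light edges have to be. -/
def SmallWeight (V : Type*) [Fintype V] (τ : ℝ) : Prop :=
  0 ≤ τ ∧ τ * ((pathBound V : ℝ) ^ 3 * (pathBound V * 8) ^ pathBound V) ≤ 1 / 2

/-- The factor `4 ^ l.length` is room to spare: it later absorbs the bound `2 ^ (l.length + 1)` for
`1 + ε_γ` and the powers of the length that come from repeated visits. -/
theorem LightLoops.sum_shortLists_le (h : LightLoops u D t τ) (hτ : SmallWeight V τ)
    (A B : Finset V) (σ : V) (n : ℕ) :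
    ∑ l ∈ shortLists V n, (if ∃ x ∈ σ :: l, x ∈ B then 4 ^ l.length * passageWeight A u t σ l else 0)
      ≤ 2 * ∑ l ∈ shortLists V (pathBound V),
        (if ∃ x ∈ σ :: l, x ∈ B then 4 ^ l.length * passageWeight A u t σ l else 0) := by
  by_cases hσ : σ ∈ A
  swap
  · have : ∀ l, passageWeight A u t σ l = 0 := fun l => if_neg fun h => hσ (h.2 σ (by simp))
    simp [this]
  set M := pathBound V with hM
  have hM1 : 1 ≤ M := Fintype.card_pos_iff.2 ⟨(σ, true)⟩
  have hMr : (1 : ℝ) ≤ M := by exact_mod_cast hM1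
  have hsum : ∀ n, ∑ l ∈ shortLists V n,
      (if ∃ x ∈ σ :: l, x ∈ B then 4 ^ l.length * passageWeight A u t σ l else 0) =
      ∑ m ∈ range n, 4 ^ m * ((flagMatrix A B u t ^ m) *ᵥ
        fun q => if q.2 = true then u q.1 t else 0) (σ, decide (σ ∈ B)) := by
    intro n
    rw [sum_shortLists]
    refine sum_congr rfl fun m _ => ?_
    rw [flagMatrix_pow_mulVec A B u t m (σ, decide (σ ∈ B)) hσ, mul_sum]
    refine sum_congr rfl fun l hl => ?_
    rw [mem_listsOfLength.1 hl]
    simp only [List.mem_cons, exists_eq_or_imp, decide_eq_true_eq, mul_ite, mul_zero]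
  rw [hsum, hsum]
  -- `η` is the bound of `flagMatrix_loop` at the largest length `M`; with `θ = 4` the required
  -- smallness is exactly the one in `SmallWeight`.
  refine Matrix.sum_pow_mulVec_le (flagMatrix_nonneg h.nonneg A B t) (fun q => ?_)
    (η := M * (M * 2) ^ M * τ) (by have := hτ.1; positivity) (by norm_num) ?_ ?_ _ _
  · split_ifs
    exacts [h.nonneg _ _, le_rfl]
  · intro p l hl1 hl2
    refine (h.flagMatrix_loop hτ.1 A B p l hl1).trans ?_
    refine mul_le_mul_of_nonneg_right ?_ hτ.1
    refine mul_le_mul (by exact_mod_cast hl2) ?_ (by positivity) (by positivity)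
    exact pow_le_pow_right₀ (by linarith) hl2
  · change M * (M * 2) ^ M * τ * (M : ℝ) ^ 2 * 4 ^ M ≤ 1 / 2
    refine le_of_eq_of_le ?_ hτ.2
    rw [← hM]
    rw [show (M : ℝ) * 8 = (M * 2) * 4 by ring, mul_pow (M * 2 : ℝ) 4]
    ring

theorem LightLoops.summable (h : LightLoops u D t τ) (hτ : SmallWeight V τ)
    (A : Finset V) (σ : V) :
    Summable fun l => 4 ^ l.length * passageWeight A u t σ l := by
  have hnn : ∀ l : List V, 0 ≤ 4 ^ l.length * passageWeight A u t σ l :=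
    fun l => mul_nonneg (by positivity) (passageWeight_nonneg h.nonneg A t σ l)
  refine summable_of_sum_le hnn (sum_le_of_sum_shortLists_le hnn fun M =>
    le_trans (le_of_eq (sum_congr rfl fun l _ => ?_)) (h.sum_shortLists_le hτ A univ σ M))
  exact (if_pos ⟨σ, by simp, mem_univ σ⟩).symm

/-- The ratio between sums over all paths and sums over short paths. -/
def shortRatio (V : Type*) [Fintype V] : ℝ := 2 * 4 ^ pathBound V

theorem LightLoops.summable_hit (h : LightLoops u D t τ) (hτ : SmallWeight V τ)
    (A B : Finset V) (σ : V) :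
    Summable fun l => if ∃ x ∈ σ :: l, x ∈ B then 4 ^ l.length * passageWeight A u t σ l else 0 := by
  refine Summable.of_nonneg_of_le (fun l => ?_) (fun l => ?_) (h.summable hτ A σ)
  · split_ifs
    exacts [mul_nonneg (by positivity) (passageWeight_nonneg h.nonneg A t σ l), le_rfl]
  · split_ifs
    exacts [le_rfl, mul_nonneg (by positivity) (passageWeight_nonneg h.nonneg A t σ l)]

/-- On short paths the factor `4 ^ l.length` is at most `4 ^ pathBound V`, so it can be dropped on
the right at the price of a constant. -/
theorem LightLoops.tsum_hit_le (h : LightLoops u D t τ) (hτ : SmallWeight V τ)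
    (A B : Finset V) (σ : V) :
    ∑' l, (if ∃ x ∈ σ :: l, x ∈ B then 4 ^ l.length * passageWeight A u t σ l else 0)
      ≤ shortRatio V * ∑ l ∈ shortLists V (pathBound V),
        (if ∃ x ∈ σ :: l, x ∈ B then passageWeight A u t σ l else 0) := by
  have hnn := passageWeight_nonneg h.nonneg A t σ
  have hnn' : ∀ l : List V, 0 ≤
      if ∃ x ∈ σ :: l, x ∈ B then 4 ^ l.length * passageWeight A u t σ l else 0 := by
    intro l
    split_ifs
    exacts [mul_nonneg (by positivity) (hnn l), le_rfl]
  refine (Real.tsum_le_of_sum_le hnn'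
    (sum_le_of_sum_shortLists_le hnn' fun M => h.sum_shortLists_le hτ A B σ M)).trans ?_
  rw [shortRatio, mul_assoc]
  refine mul_le_mul_of_nonneg_left ?_ (by norm_num)
  rw [mul_sum]
  refine sum_le_sum fun l hl => ?_
  split_ifs
  · exact mul_le_mul_of_nonneg_right
      (pow_le_pow_right₀ (by norm_num) (mem_shortLists.1 hl).le) (hnn l)
  · simp

theorem summable_passageWeight_of_four_pow (hu : ∀ x y, 0 ≤ u x y) {A : Finset V} {σ : V}
    (h : Summable fun l => 4 ^ l.length * passageWeight A u t σ l) :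
    Summable fun l => passageWeight A u t σ l := by
  refine Summable.of_nonneg_of_le (fun l => passageWeight_nonneg hu A t σ l) (fun l => ?_) h
  exact le_mul_of_one_le_left (passageWeight_nonneg hu A t σ l) (one_le_pow₀ (by norm_num))

/-- First step analysis. -/
theorem tsum_passageWeight_eq (hs : ∀ σ, Summable fun l => passageWeight univ u t σ l) (σ : V) :
    ∑' l, passageWeight univ u t σ l =
      u σ t + ∑ x, if x = t then 0 else u σ x * ∑' l, passageWeight univ u t x l := by
  have hlim : ∀ σ, Filter.Tendsto (fun n => ∑ l ∈ shortLists V n, passageWeight univ u t σ l)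
      Filter.atTop (nhds (∑' l, passageWeight univ u t σ l)) :=
    fun σ => (hs σ).hasSum.comp tendsto_shortLists
  have hrec : ∀ n, ∑ l ∈ shortLists V (n + 1), passageWeight univ u t σ l =
      u σ t + ∑ x, if x = t then 0 else
        u σ x * ∑ l ∈ shortLists V n, passageWeight univ u t x l := by
    intro n
    rw [sum_shortLists, sum_range_succ', add_comm]
    congr 1
    · simp [listsOfLength, passageWeight, pathWeight]
    · simp_rw [sum_listsOfLength_succ]
      rw [sum_comm]
      refine sum_congr rfl fun x _ => ?_
      split_ifs with hx
      · refine sum_eq_zero fun m _ => sum_eq_zero fun l _ => if_neg fun h => h.1 (by simp [hx])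
      · rw [sum_shortLists, mul_sum]
        refine sum_congr rfl fun m _ => ?_
        rw [mul_sum]
        refine sum_congr rfl fun l _ => ?_
        simp only [passageWeight, mem_univ, implies_true, and_true, List.mem_cons, not_or,
          Ne.symm hx, not_false_eq_true, true_and, mul_ite, mul_zero]
        rfl
  refine tendsto_nhds_unique ((hlim σ).comp (Filter.tendsto_add_atTop_nat 1)) ?_
  simp only [Function.comp_def, hrec]
  refine tendsto_const_nhds.add (tendsto_finsetSum _ fun x _ => ?_)
  split_ifs
  · exact tendsto_const_nhds
  · exact (hlim x).const_mul _

end PathSums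

end

noncomputable section

set_option linter.unusedSectionVars false

open Finset

/-! ### Vertex factors, and excursions as lists of interior vertices. -/

section PathWeights

variable {V : Type*}

/-- A vertex factor is attached to the edge that leaves the vertex, so the final `t` contributes
none. This is the convention behind `dropLast` in `pathDeficiency`. -/
theorem pathWeight_mul (g : V → ℝ) (u : V → V → ℝ) (t : V) : ∀ (σ : V) (l : List V),
    pathWeight (fun x y => g x * u x y) (σ :: (l ++ [t])) =
      ((σ :: l).map g).prod * pathWeight u (σ :: (l ++ [t]))
  | σ, [] => by simp [pathWeight]
  | σ, x :: l => by
    have := pathWeight_mul g u t x l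
    simp only [List.cons_append, pathWeight, List.map_cons, List.prod_cons] at this ⊢
    rw [this]
    ring

theorem pathWeight_eq_zero {u : V → V → ℝ} {E : V → V → Prop} (hu : ∀ x y, ¬ E x y → u x y = 0) :
    ∀ γ : List V, ¬ γ.IsChain E → pathWeight u γ = 0
  | [], h => absurd List.IsChain.nil h
  | [x], h => absurd (List.isChain_singleton x) h
  | x :: y :: γ, h => by
    rw [List.isChain_cons_cons, not_and_or] at h
    rcases h with h | h
    · simp [pathWeight, hu x y h]
    · simp [pathWeight, pathWeight_eq_zero hu (y :: γ) h]

variable [Fintype V] [DecidableEq V]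

theorem passageWeight_mul (A : Finset V) (g : V → ℝ) (u : V → V → ℝ) (t σ : V) (l : List V) :
    passageWeight A (fun x y => g x * u x y) t σ l =
      ((σ :: l).map g).prod * passageWeight A u t σ l := by
  unfold passageWeight
  rw [pathWeight_mul, mul_ite, mul_zero]

theorem closePath_injective (s : V) : Function.Injective fun l : List V => s :: (l ++ [s]) := by
  intro l l' h
  simpa using h

/-- An excursion is determined by its interior, so sums over sets of excursions become sums over all
lists, with the constraints moved into a summand that vanishes where they fail. -/
theorem tsum_subtype_eq_tsum_closePath {S : Set (List V)} {s : V} {F G : List V → ℝ}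
    (hS : ∀ γ ∈ S, ∃ l, γ = s :: (l ++ [s]))
    (hG : ∀ l, s :: (l ++ [s]) ∈ S → F (s :: (l ++ [s])) = G l)
    (hG0 : ∀ l, s :: (l ++ [s]) ∉ S → G l = 0) :
    ∑' γ : S, F γ = ∑' l, G l := by
  rw [tsum_subtype S F, ← (closePath_injective s).tsum_eq]
  · refine tsum_congr fun l => ?_
    by_cases h : s :: (l ++ [s]) ∈ S
    · rw [Set.indicator_of_mem h, hG l h]
    · rw [Set.indicator_of_notMem h, hG0 l h]
  · intro γ hγ
    obtain ⟨l, rfl⟩ := hS γ (Set.mem_of_indicator_ne_zero hγ)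
    exact ⟨l, rfl⟩

theorem summable_subtype_iff_closePath {S : Set (List V)} {s : V} {F G : List V → ℝ}
    (hS : ∀ γ ∈ S, ∃ l, γ = s :: (l ++ [s]))
    (hG : ∀ l, s :: (l ++ [s]) ∈ S → F (s :: (l ++ [s])) = G l)
    (hG0 : ∀ l, s :: (l ++ [s]) ∉ S → G l = 0) :
    (Summable fun γ : S => F γ) ↔ Summable G := by
  have h1 : (Summable fun γ : S => F γ) ↔ Summable (S.indicator F) :=
    summable_subtype_iff_indicator
  rw [h1, ← (closePath_injective s).summable_iff]
  · refine summable_congr fun l => ?_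
    by_cases h : s :: (l ++ [s]) ∈ S
    · rw [Function.comp_apply, Set.indicator_of_mem h, hG l h]
    · rw [Function.comp_apply, Set.indicator_of_notMem h, hG0 l h]
  · intro γ hγ
    by_contra h
    obtain ⟨l, rfl⟩ := hS γ (Set.mem_of_indicator_ne_zero h)
    exact hγ ⟨l, rfl⟩

end PathWeights

/-! ### Rates, weights and light loops of a network. -/

namespace ReactionNetwork

variable {V R : Type*} [Fintype V] [DecidableEq V] [Fintype R] {net : ReactionNetwork V R}

/-- No reaction produces its own reactant, so the diagonal of `A` receives only losses. -/
theorem diagRate_eq (σ : V) :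
    net.diagRate σ = ∑ r, if net.reactant r = σ then net.rate r else 0 := by
  have h : net.generator σ σ = -∑ r, if net.reactant r = σ then net.rate r else 0 := by
    rw [generator, ← sum_neg_distrib]
    refine sum_congr rfl fun r _ => ?_
    split_ifs with hr
    · rw [← hr, Multiset.count_eq_zero_of_notMem (net.reactant_notMem r)]
      simp
    · simp at *
    · simp
  rw [diagRate, h, abs_neg, abs_of_nonneg]
  refine sum_nonneg fun r _ => ?_
  split_ifs
  exacts [(net.rate_pos r).le, le_rfl]

theorem generator_diag (σ : V) : net.generator σ σ = -net.diagRate σ := by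
  rw [diagRate_eq, generator, ← sum_neg_distrib]
  refine sum_congr rfl fun r _ => ?_
  by_cases hr : net.reactant r = σ
  · rw [if_pos hr, if_pos hr, ← hr, Multiset.count_eq_zero_of_notMem (net.reactant_notMem r)]
    simp
  · rw [if_neg hr, if_neg hr, neg_zero]

theorem transitionRate_eq (σ σ' : V) : net.transitionRate σ σ' =
    ∑ r, if net.reactant r = σ then net.rate r * ((net.products r).count σ' : ℝ) else 0 := by
  rw [transitionRate, generator]
  by_cases h : σ = σ'
  · subst h
    rw [if_pos rfl]
    refine (sum_eq_zero fun r _ => ?_).symm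
    split_ifs with hr
    · rw [← hr, Multiset.count_eq_zero_of_notMem (net.reactant_notMem r)]
      simp
    · rfl
  · rw [if_neg h]
    refine sum_congr rfl fun r _ => ?_
    rw [if_neg (Ne.symm h), sub_zero]

theorem transitionRate_nonneg (σ σ' : V) : 0 ≤ net.transitionRate σ σ' := by
  rw [transitionRate_eq]
  refine sum_nonneg fun r _ => ?_
  split_ifs
  exacts [mul_nonneg (net.rate_pos r).le (Nat.cast_nonneg _), le_rfl]

/-- Summing multiplicities over all species counts the products of a reaction. Hence κ_σ = k_σ -
a_σ, and the limit of two products becomes k_σ ≤ 2 a_σ. -/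
theorem outRate_eq (σ : V) : net.outRate σ =
    ∑ r, if net.reactant r = σ then net.rate r * ((net.products r).card : ℝ) else 0 := by
  unfold outRate
  simp_rw [transitionRate_eq]
  rw [sum_comm]
  refine sum_congr rfl fun r _ => ?_
  split_ifs
  · rw [← mul_sum, ← Nat.cast_sum, Multiset.sum_count_eq_card fun a _ => mem_univ a]
  · simp

theorem deficiencyRate_eq (σ : V) : net.deficiencyRate σ = net.outRate σ - net.diagRate σ := by
  rw [outRate_eq, diagRate_eq, deficiencyRate, ← sum_sub_distrib]
  refine sum_congr rfl fun r _ => ?_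
  split_ifs <;> ring

theorem outRate_le (σ : V) : net.outRate σ ≤ 2 * net.diagRate σ := by
  rw [outRate_eq, diagRate_eq, mul_sum]
  refine sum_le_sum fun r _ => ?_
  split_ifs
  · rw [mul_comm]
    exact mul_le_mul_of_nonneg_right (by exact_mod_cast net.card_products_le r) (net.rate_pos r).le
  · simp

theorem diagRate_le_outRate (h : ∀ r, net.products r ≠ 0) (σ : V) :
    net.diagRate σ ≤ net.outRate σ := by
  rw [outRate_eq, diagRate_eq]
  refine sum_le_sum fun r _ => ?_
  split_ifs
  · refine le_mul_of_one_le_right (net.rate_pos r).le ?_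
    exact_mod_cast Multiset.card_pos.2 (h r)
  · exact le_rfl

theorem transitionRate_le_outRate (σ σ' : V) : net.transitionRate σ σ' ≤ net.outRate σ :=
  single_le_sum (f := fun x => net.transitionRate σ x)
    (fun x _ => transitionRate_nonneg σ x) (mem_univ σ')

/-- For `s` the first edge of the dominant cycle serves, for any other vertex the first edge of a
path to `s`. All divisions by `k_σ` and `a_σ` rest on this. -/
theorem exists_edge {b : ℝ} {s : V} (hirr : net.Irreducible) (hdom : net.SigmaDominant b s)
    (σ : V) : ∃ σ', net.Edge σ σ' := by
  obtain ⟨⟨l, hl⟩, -⟩ := hdom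
  have hs : ∃ x, net.Edge s x := by
    cases l with
    | nil =>
      rw [List.nil_append, List.isChain_cons_cons] at hl
      exact ⟨s, hl.1.1⟩
    | cons x l =>
      rw [List.cons_append, List.isChain_cons_cons] at hl
      exact ⟨x, hl.1.1⟩
  rcases (hirr σ s).cases_head with rfl | ⟨x, hx, -⟩
  exacts [hs, ⟨x, hx⟩]

theorem outRate_pos (h : ∀ σ, ∃ σ', net.Edge σ σ') (σ : V) : 0 < net.outRate σ := by
  obtain ⟨x, hx⟩ := h σ
  exact lt_of_lt_of_le hx (transitionRate_le_outRate σ x)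

theorem diagRate_pos (h : ∀ σ, ∃ σ', net.Edge σ σ') (σ : V) : 0 < net.diagRate σ := by
  linarith [outRate_pos h σ, outRate_le (net := net) σ]

theorem isGreatest_vertexScale (h : ∀ σ, ∃ σ', net.Edge σ σ') (b : ℝ) (σ : V) :
    IsGreatest {n | ∃ σ', net.Edge σ σ' ∧ n = net.edgeScale b σ σ'} (net.vertexScale b σ) := by
  have hfin : {n | ∃ σ', net.Edge σ σ' ∧ n = net.edgeScale b σ σ'}.Finite := by
    refine (Set.finite_range (net.edgeScale b σ)).subset ?_
    rintro n ⟨x, -, rfl⟩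
    exact ⟨x, rfl⟩
  obtain ⟨x, hx⟩ := h σ
  have hne : {n | ∃ σ', net.Edge σ σ' ∧ n = net.edgeScale b σ σ'}.Nonempty := ⟨_, x, hx, rfl⟩
  exact ⟨Int.csSup_mem hne hfin.bddAbove, fun n hn => le_csSup hfin.bddAbove hn⟩

theorem probWeight_nonneg (σ σ' : V) : 0 ≤ net.probWeight σ σ' :=
  div_nonneg (transitionRate_nonneg _ _) (sum_nonneg fun x _ => transitionRate_nonneg σ x)

theorem weight_nonneg {α : ℝ} (hα : 0 ≤ α) (σ σ' : V) : 0 ≤ net.weight α σ σ' :=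
  div_nonneg (transitionRate_nonneg _ _) (add_nonneg (abs_nonneg _) hα)

theorem one_add_deficiencyWeight (h : ∀ σ, ∃ σ', net.Edge σ σ') (σ : V) :
    1 + net.deficiencyWeight σ = net.outRate σ / net.diagRate σ := by
  have := (diagRate_pos h σ).ne'
  rw [deficiencyWeight, deficiencyRate_eq]
  field_simp
  ring

/-- Since 1 + ε_σ = k_σ / a_σ, the weight of an excursion at `α = 0` is its probability times `1 +
ε_γ`. -/
theorem weight_zero_eq (h : ∀ σ, ∃ σ', net.Edge σ σ') :
    net.weight 0 = fun σ σ' => (1 + net.deficiencyWeight σ) * net.probWeight σ σ' := by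
  funext σ σ'
  have h1 := (diagRate_pos h σ).ne'
  have h2 := (outRate_pos h σ).ne'
  rw [one_add_deficiencyWeight h, weight, probWeight, add_zero]
  field_simp

/-- All dependence on `α` sits in one factor per visited vertex, which for `α ≥ 0` is at most 1. -/
theorem weight_eq (h : ∀ σ, ∃ σ', net.Edge σ σ') (α : ℝ) :
    net.weight α = fun σ σ' => net.diagRate σ / (net.diagRate σ + α) * net.weight 0 σ σ' := by
  funext σ σ'
  have h1 := (diagRate_pos h σ).ne'
  rw [weight, weight, add_zero]
  field_simp

theorem one_add_deficiencyWeight_nonneg (h : ∀ σ, ∃ σ', net.Edge σ σ') (σ : V) :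
    0 ≤ 1 + net.deficiencyWeight σ := by
  rw [one_add_deficiencyWeight h]
  exact div_nonneg (outRate_pos h σ).le (diagRate_pos h σ).le

theorem one_add_deficiencyWeight_le (h : ∀ σ, ∃ σ', net.Edge σ σ') (σ : V) :
    1 + net.deficiencyWeight σ ≤ 2 := by
  rw [one_add_deficiencyWeight h, div_le_iff₀ (diagRate_pos h σ)]
  exact outRate_le σ

theorem weight_eq_zero {α : ℝ} {σ σ' : V} (h : ¬ net.Edge σ σ') : net.weight α σ σ' = 0 := by
  have : net.transitionRate σ σ' = 0 := le_antisymm (not_lt.1 h) (transitionRate_nonneg _ _)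
  rw [weight, this, zero_div]

theorem probWeight_eq_zero {σ σ' : V} (h : ¬ net.Edge σ σ') : net.probWeight σ σ' = 0 := by
  have : net.transitionRate σ σ' = 0 := le_antisymm (not_lt.1 h) (transitionRate_nonneg _ _)
  rw [probWeight, this, zero_div]

section Light

variable {b K : ℝ} {s : V}

/-- Separation of scales alone would give `K / b`. The factor 2 is needed for `net.weight 0`, where
k_σ ≤ 2 a_σ enters; a common threshold allows a single smallness condition. -/
theorem lightLoops_probWeight (h : ∀ σ, ∃ σ', net.Edge σ σ') (hb : 0 < b) (hK : 0 ≤ K)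
    (hdom : net.SigmaDominant b s) (hsep : net.ScaleSeparated b K) :
    LightLoops net.probWeight (net.DominantEdge b) s (2 * K / b) where
  nonneg := probWeight_nonneg
  le_two σ σ' := by
    rw [probWeight, div_le_iff₀ (outRate_pos h σ)]
    linarith [transitionRate_le_outRate (net := net) σ σ', outRate_pos h σ]
  le_of_not σ σ' hD := by
    by_cases he : net.Edge σ σ'
    · have := hsep σ σ' he hD
      rw [probWeight, div_le_div_iff₀ (outRate_pos h σ) hb]
      nlinarith [mul_nonneg hK (outRate_pos h σ).le]
    · rw [probWeight_eq_zero he]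
      positivity
  acyclic := hdom.2

theorem lightLoops_weight (h : ∀ σ, ∃ σ', net.Edge σ σ') (hb : 0 < b) (hK : 0 ≤ K)
    (hdom : net.SigmaDominant b s) (hsep : net.ScaleSeparated b K) :
    LightLoops (net.weight 0) (net.DominantEdge b) s (2 * K / b) where
  nonneg := weight_nonneg le_rfl
  le_two σ σ' := by
    rw [weight, add_zero, div_le_iff₀ (diagRate_pos h σ)]
    linarith [transitionRate_le_outRate (net := net) σ σ', outRate_le (net := net) σ]
  le_of_not σ σ' hD := by
    by_cases he : net.Edge σ σ'
    · have := hsep σ σ' he hD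
      rw [weight, add_zero, div_le_div_iff₀ (diagRate_pos h σ) hb]
      nlinarith [mul_le_mul_of_nonneg_left (outRate_le (net := net) σ) hK]
    · rw [weight_eq_zero he]
      positivity
  acyclic := hdom.2

end Light

/-- The vertices that may occur in high excursions. -/
def highVertices (net : ReactionNetwork V R) (b : ℝ) (N : ℤ) : Finset V :=
  univ.filter fun σ => N < net.vertexScale b σ

theorem mem_highVertices {b : ℝ} {N : ℤ} {σ : V} :
    σ ∈ net.highVertices b N ↔ N < net.vertexScale b σ := by
  simp [highVertices]

/-! ### Sums over high and low excursions in terms of interior lists. -/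

section Bridge

variable {b : ℝ} {N : ℤ} {s : V} {u : V → V → ℝ}

theorem isExcursion_closePath {l : List V} :
    net.IsExcursion s (s :: (l ++ [s])) ↔ s ∉ l ∧ (s :: (l ++ [s])).IsChain net.Edge := by
  constructor
  · rintro ⟨l', h, h1, h2⟩
    rw [closePath_injective s h]
    exact ⟨h1, by rwa [h] at h2⟩
  · rintro ⟨h1, h2⟩
    exact ⟨l, rfl, h1, h2⟩

theorem closePath_mem_highExcursions {l : List V} :
    s :: (l ++ [s]) ∈ net.highExcursions b N s ↔
      (s ∉ l ∧ ∀ x ∈ s :: l, x ∈ net.highVertices b N) ∧ (s :: (l ++ [s])).IsChain net.Edge := by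
  rw [highExcursions, Set.mem_ofPred_eq, isExcursion_closePath]
  simp only [List.mem_cons, List.mem_append, List.not_mem_nil, or_false, mem_highVertices]
  aesop

theorem exists_closePath_of_mem_highExcursions :
    ∀ γ ∈ net.highExcursions b N s, ∃ l, γ = s :: (l ++ [s]) := by
  rintro γ ⟨⟨l, rfl, -⟩, -⟩
  exact ⟨l, rfl⟩

theorem closePath_mem_lowExcursions {l : List V} :
    s :: (l ++ [s]) ∈ net.lowExcursions b N s ↔
      (s ∉ l ∧ ∃ x ∈ s :: l, x ∈ (net.highVertices b N)ᶜ) ∧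
        (s :: (l ++ [s])).IsChain net.Edge := by
  rw [lowExcursions, Set.mem_ofPred_eq, isExcursion_closePath]
  simp only [List.mem_cons, List.mem_append, List.not_mem_nil, or_false, mem_highVertices,
    mem_compl]
  push Not
  aesop

/-- The chain condition can be dropped from the summation because a path using a non-edge has weight
zero. -/
theorem tsum_highExcursions (hu : ∀ x y, ¬ net.Edge x y → u x y = 0) (F : List V → ℝ) :
    ∑' γ : net.highExcursions b N s, F γ * pathWeight u γ =
      ∑' l, F (s :: (l ++ [s])) * passageWeight (net.highVertices b N) u s s l := by
  refine tsum_subtype_eq_tsum_closePath (F := fun γ => F γ * pathWeight u γ)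
    exists_closePath_of_mem_highExcursions (fun l hl => ?_) fun l hl => ?_
  · rw [passageWeight, if_pos (closePath_mem_highExcursions.1 hl).1]
  · rw [closePath_mem_highExcursions, not_and_or] at hl
    rcases hl with hl | hl
    · rw [passageWeight, if_neg hl, mul_zero]
    · rw [passageWeight, pathWeight_eq_zero hu _ hl, ite_self, mul_zero]

theorem tsum_lowExcursions (hu : ∀ x y, ¬ net.Edge x y → u x y = 0) :
    ∑' γ : net.lowExcursions b N s, pathWeight u γ =
      ∑' l, if ∃ x ∈ s :: l, x ∈ (net.highVertices b N)ᶜ then passageWeight univ u s s l else 0 := by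
  refine tsum_subtype_eq_tsum_closePath (s := s) (F := fun γ => pathWeight u γ) ?_
    (fun l hl => ?_) fun l hl => ?_
  · rintro γ ⟨⟨l, rfl, -⟩, -⟩
    exact ⟨l, rfl⟩
  · have := (closePath_mem_lowExcursions.1 hl).1
    rw [if_pos this.2, passageWeight, if_pos ⟨this.1, fun x _ => mem_univ x⟩]
  · rw [closePath_mem_lowExcursions, not_and_or, not_and_or] at hl
    rcases hl with (hl | hl) | hl
    · have : passageWeight univ u s s l = 0 := if_neg fun h => hl h.1
      rw [this, ite_self]
    · rw [if_neg hl]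
    · rw [passageWeight, pathWeight_eq_zero hu _ hl, ite_self, ite_self]

theorem summable_excursions_iff (hu : ∀ x y, ¬ net.Edge x y → u x y = 0) :
    (Summable fun γ : {γ : List V // net.IsExcursion s γ} => pathWeight u γ) ↔
      Summable fun l => passageWeight univ u s s l := by
  refine summable_subtype_iff_closePath (s := s) (S := {γ | net.IsExcursion s γ})
    (F := fun γ => pathWeight u γ) ?_ (fun l hl => ?_) fun l hl => ?_
  · rintro γ ⟨l, rfl, -⟩
    exact ⟨l, rfl⟩
  · rw [passageWeight, if_pos ⟨(isExcursion_closePath.1 hl).1, fun x _ => mem_univ x⟩]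
  · rw [Set.mem_ofPred_eq, isExcursion_closePath, not_and_or] at hl
    rcases hl with hl | hl
    · rw [passageWeight, if_neg fun h => hl h.1]
    · rw [passageWeight, pathWeight_eq_zero hu _ hl, ite_self]

end Bridge

theorem passageWeight_univ_eq (A : Finset V) (u : V → V → ℝ) (t σ : V) (l : List V) :
    passageWeight univ u t σ l = passageWeight A u t σ l +
      if ∃ x ∈ σ :: l, x ∈ Aᶜ then passageWeight univ u t σ l else 0 := by
  by_cases h : ∃ x ∈ σ :: l, x ∈ Aᶜ
  · have h1 : passageWeight A u t σ l = 0 := by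
      obtain ⟨x, hx, hxA⟩ := h
      exact if_neg fun h => (mem_compl.1 hxA) (h.2 x hx)
    rw [if_pos h, h1, zero_add]
  · rw [if_neg h, add_zero, passageWeight, passageWeight]
    refine if_congr (and_congr_right fun _ => ⟨fun _ x hx => ?_, fun _ x _ => mem_univ x⟩) rfl rfl
    by_contra hxA
    exact h ⟨x, hx, mem_compl.2 hxA⟩

end ReactionNetwork

/-! ### Eigenvalues, supersolutions and damping. -/

theorem Matrix.mem_spectrum_iff_exists_vecMul {n : Type*} [Fintype n] [DecidableEq n]
    {M : Matrix n n ℂ} {μ : ℂ} :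
    μ ∈ spectrum ℂ M ↔ ∃ y ≠ 0, Matrix.vecMul y M = μ • y := by
  rw [spectrum.mem_iff, Matrix.isUnit_iff_isUnit_det, isUnit_iff_ne_zero, not_not,
    ← Matrix.exists_vecMul_eq_zero_iff]
  refine exists_congr fun y => and_congr_right fun _ => ?_
  rw [Matrix.vecMul_sub, sub_eq_zero, Algebra.algebraMap_eq_smul_one, Matrix.vecMul_smul,
    Matrix.vecMul_one, eq_comm]

namespace ReactionNetwork

variable {V R : Type*} [Fintype V] [DecidableEq V] [Fintype R] {net : ReactionNetwork V R}

theorem generator_eq (σ σ' : V) : net.generator σ' σ =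
    net.transitionRate σ σ' - if σ' = σ then net.diagRate σ else 0 := by
  rw [transitionRate]
  by_cases h : σ = σ'
  · rw [if_pos h, if_pos h.symm, ← h, generator_diag, zero_sub]
  · rw [if_neg h, if_neg (Ne.symm h), sub_zero]

/-- Left eigenvectors are the right ones here: the equation at σ then involves only the edges
leaving σ, which is the shape of a first step analysis. -/
theorem mem_spectrum_iff {μ : ℂ} :
    μ ∈ spectrum ℂ (net.generator.map (fun x : ℝ => (x : ℂ))) ↔
      ∃ y : V → ℂ, y ≠ 0 ∧
        ∀ σ, ∑ σ', (net.transitionRate σ σ' : ℂ) * y σ' = (net.diagRate σ + μ) * y σ := by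
  rw [Matrix.mem_spectrum_iff_exists_vecMul]
  refine exists_congr fun y => and_congr_right fun _ => ?_
  rw [funext_iff]
  refine forall_congr' fun σ => ?_
  have : Matrix.vecMul y (net.generator.map (fun x : ℝ => (x : ℂ))) σ =
      ∑ σ', (net.transitionRate σ σ' : ℂ) * y σ' - net.diagRate σ * y σ := by
    simp only [Matrix.vecMul, dotProduct, Matrix.map_apply, generator_eq, Complex.ofReal_sub,
      mul_sub, sum_sub_distrib]
    congr 1
    · exact sum_congr rfl fun x _ => mul_comm _ _
    · simp [apply_ite, mul_comm]
  rw [this, Pi.smul_apply, smul_eq_mul, sub_eq_iff_eq_add, add_mul, add_comm]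

/-- Collatz–Wielandt bound: a positive supersolution bounds the real parts of the eigenvalues. -/
theorem re_le_of_supersolution {g : V → ℝ} (hg : ∀ σ, 0 < g σ) {α : ℝ}
    (h : ∀ σ, ∑ σ', net.transitionRate σ σ' * g σ' ≤ (net.diagRate σ + α) * g σ) {μ : ℂ}
    (hμ : μ ∈ spectrum ℂ (net.generator.map (fun x : ℝ => (x : ℂ)))) : μ.re ≤ α := by
  obtain ⟨y, hy0, hy⟩ := mem_spectrum_iff.1 hμ
  obtain ⟨x, hx⟩ : ∃ x, y x ≠ 0 := by
    by_contra! hcon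
    exact hy0 (funext hcon)
  have : Nonempty V := ⟨x⟩
  obtain ⟨σ, hσ⟩ := Finite.exists_max fun σ => ‖y σ‖ / g σ
  set m := ‖y σ‖ / g σ with hm
  have hm0 : 0 < m := lt_of_lt_of_le (div_pos (norm_pos_iff.2 hx) (hg x)) (hσ x)
  have hym : ∀ σ', ‖y σ'‖ ≤ m * g σ' := fun σ' => (div_le_iff₀ (hg σ')).1 (hσ σ')
  have hyσ : ‖y σ‖ = m * g σ := by rw [hm, div_mul_cancel₀ _ (hg σ).ne']
  have h1 : (net.diagRate σ + μ.re) * ‖y σ‖ ≤ ‖(net.diagRate σ + μ) * y σ‖ := by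
    rw [norm_mul]
    refine mul_le_mul_of_nonneg_right ?_ (norm_nonneg _)
    have := Complex.re_le_norm ((net.diagRate σ : ℂ) + μ)
    simpa using this
  have h2 : ‖(net.diagRate σ + μ) * y σ‖ ≤ m * ((net.diagRate σ + α) * g σ) := by
    rw [← hy σ]
    calc ‖∑ σ', (net.transitionRate σ σ' : ℂ) * y σ'‖
        ≤ ∑ σ', ‖(net.transitionRate σ σ' : ℂ) * y σ'‖ := norm_sum_le _ _
      _ ≤ ∑ σ', m * (net.transitionRate σ σ' * g σ') := by
          refine sum_le_sum fun σ' _ => ?_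
          rw [norm_mul, Complex.norm_real, Real.norm_of_nonneg (transitionRate_nonneg σ σ')]
          calc _ ≤ net.transitionRate σ σ' * (m * g σ') :=
                mul_le_mul_of_nonneg_left (hym σ') (transitionRate_nonneg σ σ')
            _ = _ := by ring
      _ = m * ∑ σ', net.transitionRate σ σ' * g σ' := by rw [mul_sum]
      _ ≤ _ := mul_le_mul_of_nonneg_left (h σ) hm0.le
  have h3 := h1.trans h2
  rw [hyσ] at h3
  have h4 : 0 < m * g σ := mul_pos hm0 (hg σ)
  nlinarith

/-- The factor by which `α` damps the weight of a path. -/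
def damping (net : ReactionNetwork V R) (α : ℝ) (l : List V) : ℝ :=
  (l.map fun x => net.diagRate x / (net.diagRate x + α)).prod

theorem damping_cons (α : ℝ) (x : V) (l : List V) :
    net.damping α (x :: l) = net.diagRate x / (net.diagRate x + α) * net.damping α l := by
  simp [damping]

section Damping

variable {α : ℝ} {x : V} {l : List V}

theorem damping_factor_nonneg (hE : ∀ σ, ∃ σ', net.Edge σ σ') (hα : 0 ≤ α) (x : V) :
    0 ≤ net.diagRate x / (net.diagRate x + α) :=
  div_nonneg (diagRate_pos hE x).le (add_nonneg (diagRate_pos hE x).le hα)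

theorem damping_factor_le_one (hE : ∀ σ, ∃ σ', net.Edge σ σ') (hα : 0 ≤ α) (x : V) :
    net.diagRate x / (net.diagRate x + α) ≤ 1 := by
  have := diagRate_pos hE x
  rw [div_le_one (by linarith)]
  linarith

theorem damping_nonneg (hE : ∀ σ, ∃ σ', net.Edge σ σ') (hα : 0 ≤ α) (l : List V) :
    0 ≤ net.damping α l := by
  induction l with
  | nil => simp [damping]
  | cons x l ih =>
    rw [damping_cons]
    exact mul_nonneg (damping_factor_nonneg hE hα x) ih

theorem damping_le_one (hE : ∀ σ, ∃ σ', net.Edge σ σ') (hα : 0 ≤ α) (l : List V) :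
    net.damping α l ≤ 1 := by
  induction l with
  | nil => simp [damping]
  | cons x l ih =>
    rw [damping_cons]
    exact mul_le_one₀ (damping_factor_le_one hE hα x) (damping_nonneg hE hα l) ih

theorem damping_le_of_mem (hE : ∀ σ, ∃ σ', net.Edge σ σ') (hα : 0 ≤ α) (hx : x ∈ l) :
    net.damping α l ≤ net.diagRate x / (net.diagRate x + α) := by
  induction l with
  | nil => simp at hx
  | cons y l ih =>
    rw [damping_cons]
    rcases List.mem_cons.1 hx with rfl | hx
    · exact mul_le_of_le_one_right (damping_factor_nonneg hE hα x) (damping_le_one hE hα l)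
    · exact (mul_le_of_le_one_left (damping_nonneg hE hα l)
        (damping_factor_le_one hE hα y)).trans (ih hx)

theorem passageWeight_weight_eq (hE : ∀ σ, ∃ σ', net.Edge σ σ') (A : Finset V) (t σ : V)
    (α : ℝ) (l : List V) : passageWeight A (net.weight α) t σ l =
      net.damping α (σ :: l) * passageWeight A (net.weight 0) t σ l := by
  rw [weight_eq hE α, passageWeight_mul, damping]

theorem passageWeight_weight_le (hE : ∀ σ, ∃ σ', net.Edge σ σ') (A : Finset V) (t σ : V)
    (hα : 0 ≤ α) (l : List V) : passageWeight A (net.weight α) t σ l ≤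
      passageWeight A (net.weight 0) t σ l := by
  rw [passageWeight_weight_eq hE]
  exact mul_le_of_le_one_left (passageWeight_nonneg (weight_nonneg le_rfl) A t σ l)
    (damping_le_one hE hα _)

end Damping

/-- The total weight of all excursions. -/
def returnWeight (net : ReactionNetwork V R) (s : V) (α : ℝ) : ℝ :=
  ∑' l, passageWeight univ (net.weight α) s s l

/-! ### The return equation for the Lyapunov exponent, and recurrence. -/

section Return

variable {D : V → V → Prop} {s : V} {τ α : ℝ}

theorem summable_passageWeight_weight (hE : ∀ σ, ∃ σ', net.Edge σ σ')
    (hL : LightLoops (net.weight 0) D s τ) (hτ : SmallWeight V τ) (hα : 0 ≤ α) (A : Finset V)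
    (σ : V) : Summable fun l => passageWeight A (net.weight α) s σ l :=
  Summable.of_nonneg_of_le (fun l => passageWeight_nonneg (weight_nonneg hα) A s σ l)
    (fun l => passageWeight_weight_le hE A s σ hα l)
    (summable_passageWeight_of_four_pow hL.nonneg (hL.summable hτ A σ))

/-- Let `h` be the passage weight to `s`, and `g` the same function with its value at `s` reset to
1. First step analysis gives `∑ k g = (a + α) h`, and `h ≤ g` with equality off `s`; at `s` the gap
is `1 - returnWeight`. If `g` vanished somewhere, the inequality would carry the zero along edges to
`s`. -/
theorem exists_solution (hE : ∀ σ, ∃ σ', net.Edge σ σ') (hirr : net.Irreducible)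
    (hL : LightLoops (net.weight 0) D s τ) (hτ : SmallWeight V τ) (hα : 0 ≤ α)
    (h1 : net.returnWeight s α ≤ 1) :
    ∃ g : V → ℝ, (∀ σ, 0 < g σ) ∧
      (∀ σ, ∑ σ', net.transitionRate σ σ' * g σ' ≤ (net.diagRate σ + α) * g σ) ∧
      (net.returnWeight s α = 1 →
        ∀ σ, ∑ σ', net.transitionRate σ σ' * g σ' = (net.diagRate σ + α) * g σ) := by
  set h : V → ℝ := fun σ => ∑' l, passageWeight univ (net.weight α) s σ l with hh
  have hh0 : ∀ σ, 0 ≤ h σ := fun σ => tsum_nonneg fun l =>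
    passageWeight_nonneg (weight_nonneg hα) univ s σ l
  set g : V → ℝ := fun σ => if σ = s then 1 else h σ with hgdef
  have ha : ∀ σ, 0 < net.diagRate σ + α := fun σ => by linarith [diagRate_pos hE σ]
  have hsum : ∀ σ, ∑ σ', net.transitionRate σ σ' * g σ' = (net.diagRate σ + α) * h σ := by
    intro σ
    have hw : ∀ x, net.transitionRate σ x = (net.diagRate σ + α) * net.weight α σ x := fun x => by
      rw [weight, mul_div_cancel₀ _ (ha σ).ne']
    simp_rw [hw, mul_assoc]
    rw [← mul_sum, hh]
    congr 1
    beta_reduce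
    rw [tsum_passageWeight_eq
      (fun σ => summable_passageWeight_weight hE hL hτ hα univ σ) σ,
      ← add_sum_erase univ _ (mem_univ s), ← add_sum_erase univ (fun x => ite _ _ _) (mem_univ s)]
    simp only [hgdef, if_true, mul_one, zero_add]
    congr 1
    refine sum_congr rfl fun x hx => ?_
    rw [if_neg (ne_of_mem_erase hx), if_neg (ne_of_mem_erase hx)]
  have hg0 : ∀ σ, 0 ≤ g σ := fun σ => by
    simp only [hgdef]
    split_ifs
    exacts [zero_le_one, hh0 σ]
  have hhg : ∀ σ, h σ ≤ g σ := fun σ => by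
    simp only [hgdef]
    split_ifs with hσ
    · rw [hσ]; exact h1
    · exact le_rfl
  have hsuper : ∀ σ, ∑ σ', net.transitionRate σ σ' * g σ' ≤ (net.diagRate σ + α) * g σ :=
    fun σ => (hsum σ).trans_le (mul_le_mul_of_nonneg_left (hhg σ) (ha σ).le)
  refine ⟨g, fun σ => lt_of_le_of_ne (hg0 σ) fun h0 => ?_, hsuper, fun h2 σ => ?_⟩
  · have hprop : g s = 0 := by
      refine Relation.ReflTransGen.head_induction_on (motive := fun σ _ => g σ = 0 → g s = 0)
        (hirr σ s) id (fun {σ σ'} hedge _ ih hσ => ih ?_) h0.symm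
      have h3 := hsuper σ
      rw [hσ, mul_zero] at h3
      have h4 : net.transitionRate σ σ' * g σ' ≤ 0 :=
        (single_le_sum (f := fun x => net.transitionRate σ x * g x)
          (fun x _ => mul_nonneg (transitionRate_nonneg σ x) (hg0 x)) (mem_univ σ')).trans h3
      have hedge' : 0 < net.transitionRate σ σ' := hedge
      exact le_antisymm (nonpos_of_mul_nonpos_right h4 hedge') (hg0 σ')
    simp [hgdef] at hprop
  · rw [hsum]
    congr 1
    simp only [hgdef]
    split_ifs with hσ
    · rw [hσ]; exact h2
    · rfl

theorem lyapunovExponent_le (hE : ∀ σ, ∃ σ', net.Edge σ σ') (hirr : net.Irreducible)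
    (hL : LightLoops (net.weight 0) D s τ) (hτ : SmallWeight V τ) (hα : 0 ≤ α)
    (h1 : net.returnWeight s α ≤ 1) : net.lyapunovExponent ≤ α := by
  obtain ⟨g, hg, hsup, -⟩ := exists_solution hE hirr hL hτ hα h1
  refine Real.sSup_le ?_ hα
  rintro _ ⟨μ, hμ, rfl⟩
  exact re_le_of_supersolution hg hsup hμ

/-- The solution `g` makes `α` an eigenvalue, and as a positive supersolution it bounds all other
real parts, which also supplies the boundedness needed by the supremum. -/
theorem lyapunovExponent_eq (hE : ∀ σ, ∃ σ', net.Edge σ σ') (hirr : net.Irreducible)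
    (hL : LightLoops (net.weight 0) D s τ) (hτ : SmallWeight V τ) (hα : 0 ≤ α)
    (h1 : net.returnWeight s α = 1) : net.lyapunovExponent = α := by
  obtain ⟨g, hg, hsup, heq⟩ := exists_solution hE hirr hL hτ hα h1.le
  refine le_antisymm (lyapunovExponent_le hE hirr hL hτ hα h1.le) (le_csSup ⟨α, ?_⟩ ?_)
  · rintro _ ⟨μ, hμ, rfl⟩
    exact re_le_of_supersolution hg hsup hμ
  · refine ⟨(α : ℂ), mem_spectrum_iff.2 ⟨fun σ => (g σ : ℂ), fun h0 => ?_, fun σ => ?_⟩, by simp⟩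
    · have := congr_fun h0 s
      simp only [Pi.zero_apply, Complex.ofReal_eq_zero] at this
      exact (hg s).ne' this
    · have := heq h1 σ
      beta_reduce
      exact_mod_cast this

theorem continuousOn_returnWeight (hE : ∀ σ, ∃ σ', net.Edge σ σ')
    (hL : LightLoops (net.weight 0) D s τ) (hτ : SmallWeight V τ) :
    ContinuousOn (net.returnWeight s) (Set.Ici 0) := by
  refine continuousOn_tsum (fun l => ?_)
    (summable_passageWeight_weight hE hL hτ le_rfl univ s) fun l α hα => ?_
  · refine ContinuousOn.congr ?_ fun α _ => passageWeight_weight_eq hE univ s s α l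
    refine ContinuousOn.mul ?_ continuousOn_const
    induction s :: l with
    | nil =>
      simp only [damping, List.map_nil, List.prod_nil]
      exact continuousOn_const
    | cons x l ih =>
      simp_rw [damping_cons]
      refine ContinuousOn.mul (continuousOn_const.div (by fun_prop) fun α hα => ?_) ih
      have := diagRate_pos hE x
      have hα' : 0 ≤ α := hα
      positivity
  · rw [Real.norm_of_nonneg (passageWeight_nonneg (weight_nonneg hα) univ s s l)]
    exact passageWeight_weight_le hE univ s s hα l

/-- The Lyapunov exponent solves the threshold equation. -/
theorem returnWeight_lyapunovExponent (hE : ∀ σ, ∃ σ', net.Edge σ σ') (hirr : net.Irreducible)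
    (hL : LightLoops (net.weight 0) D s τ) (hτ : SmallWeight V τ)
    (hpos : 0 < net.lyapunovExponent) :
    1 < net.returnWeight s 0 ∧ net.returnWeight s net.lyapunovExponent = 1 := by
  have h0 : 1 < net.returnWeight s 0 := by
    by_contra! hcon
    exact absurd (lyapunovExponent_le hE hirr hL hτ le_rfl hcon) (not_le.2 hpos)
  have ha := diagRate_pos hE s
  -- Every excursion is damped at its starting point `s`, so the return weight at `β` is at most
  -- `a_s / (a_s + β)` times that at 0. For this `β` the product is `β / (a_s + β) ≤ 1`, which gives
  -- the upper end for the intermediate value theorem.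
  set β := net.diagRate s * net.returnWeight s 0 with hβ
  have hβ0 : 0 ≤ β := by positivity
  have h1 : net.returnWeight s β ≤ 1 := by
    have h2 : net.returnWeight s β ≤
        net.diagRate s / (net.diagRate s + β) * net.returnWeight s 0 := by
      rw [returnWeight, returnWeight, ← tsum_mul_left]
      refine (summable_passageWeight_weight hE hL hτ hβ0 univ s).tsum_le_tsum (fun l => ?_)
        ((summable_passageWeight_weight hE hL hτ le_rfl univ s).mul_left _)
      rw [passageWeight_weight_eq hE]
      exact mul_le_mul_of_nonneg_right (damping_le_of_mem hE hβ0 (by simp))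
        (passageWeight_nonneg (weight_nonneg le_rfl) univ s s l)
    refine h2.trans ?_
    rw [div_mul_eq_mul_div, div_le_one (by positivity)]
    linarith
  obtain ⟨α, hα, hα1⟩ := intermediate_value_Icc' hβ0
    ((continuousOn_returnWeight hE hL hτ).mono Set.Icc_subset_Ici_self) ⟨h1, h0.le⟩
  exact ⟨h0, by rw [lyapunovExponent_eq hE hirr hL hτ hα.1 hα1, hα1]⟩

/-- The Markov chain returns with probability one. -/
theorem tsum_probWeight_eq_one (hE : ∀ σ, ∃ σ', net.Edge σ σ') (hirr : net.Irreducible)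
    (hL : LightLoops net.probWeight D s τ) (hτ : SmallWeight V τ) :
    ∑' l, passageWeight univ net.probWeight s s l = 1 := by
  set h : V → ℝ := fun σ => ∑' l, passageWeight univ net.probWeight s σ l with hh
  have hstep : ∀ σ, h σ = net.probWeight σ s +
      ∑ x, if x = s then 0 else net.probWeight σ x * h x :=
    tsum_passageWeight_eq
      (fun σ => summable_passageWeight_of_four_pow hL.nonneg (hL.summable hτ univ σ))
  have hone : ∀ σ, net.probWeight σ s + ∑ x, (if x = s then 0 else net.probWeight σ x) = 1 := by
    intro σ
    have : ∑ x, net.probWeight σ x = 1 := by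
      simp_rw [probWeight]
      rw [← sum_div]
      exact div_self (outRate_pos hE σ).ne'
    rw [← this, ← add_sum_erase univ _ (mem_univ s),
      ← add_sum_erase univ (fun x => net.probWeight σ x) (mem_univ s), if_pos rfl, zero_add]
    congr 1
    exact sum_congr rfl fun x hx => if_neg (ne_of_mem_erase hx)
  have hdiff : ∀ σ, 1 - h σ = ∑ x, if x = s then 0 else net.probWeight σ x * (1 - h x) := by
    intro σ
    rw [hstep σ, ← hone σ, add_sub_add_left_eq_sub, ← sum_sub_distrib, hone σ]
    refine sum_congr rfl fun x _ => ?_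
    split_ifs <;> ring
  have : Nonempty V := ⟨s⟩
  obtain ⟨σ₀, hσ₀⟩ := Finite.exists_max fun σ => |1 - h σ|
  set m := |1 - h σ₀| with hm
  by_cases hm0 : m = 0
  · have := hσ₀ s
    beta_reduce at this
    rw [hm0] at this
    have h2 : 1 - h s = 0 := abs_nonpos_iff.1 this
    linarith
  have hmpos : 0 < m := lt_of_le_of_ne (abs_nonneg _) (Ne.symm hm0)
  -- Maximum principle: `1 - h` is an average over successors in which `s` counts as 0. Where `|1 -
  -- h|` attains its positive maximum, no successor can be `s` and each must attain the maximum too.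
  have hprop : ∀ σ, |1 - h σ| = m → ∀ x, net.Edge σ x → x ≠ s ∧ |1 - h x| = m := by
    intro σ hσ x hx
    have hp : 0 < net.probWeight σ x := div_pos hx (outRate_pos hE σ)
    have hle : m ≤ ∑ y, if y = s then 0 else net.probWeight σ y * |1 - h y| := by
      rw [← hσ, hdiff σ]
      refine (abs_sum_le_sum_abs _ _).trans (sum_le_sum fun y _ => ?_)
      split_ifs
      · simp
      · rw [abs_mul, abs_of_nonneg (probWeight_nonneg σ y)]
    have hge : m * net.probWeight σ s + ∑ y, (if y = s then 0 else
        net.probWeight σ y * (m - |1 - h y|)) ≤ 0 := by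
      have h2 := congr_arg (fun z => m * z) (hone σ)
      beta_reduce at h2
      rw [mul_add, mul_one, mul_sum] at h2
      have h3 : ∑ y, (if y = s then 0 else net.probWeight σ y * (m - |1 - h y|)) =
          ∑ y, m * (if y = s then 0 else net.probWeight σ y) -
            ∑ y, if y = s then 0 else net.probWeight σ y * |1 - h y| := by
        rw [← sum_sub_distrib]
        refine sum_congr rfl fun y _ => ?_
        split_ifs <;> ring
      linarith
    have hnn : ∀ y, 0 ≤ if y = s then 0 else net.probWeight σ y * (m - |1 - h y|) := by
      intro y
      split_ifs
      · exact le_rfl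
      · exact mul_nonneg (probWeight_nonneg σ y) (sub_nonneg.2 (hσ₀ y))
    have h4 : 0 ≤ m * net.probWeight σ s := mul_nonneg hmpos.le (probWeight_nonneg σ s)
    have hxs : x ≠ s := by
      rintro rfl
      have := sum_nonneg fun y (_ : y ∈ univ) => hnn y
      have := mul_pos hmpos hp
      linarith
    refine ⟨hxs, le_antisymm (hσ₀ x) ?_⟩
    have h5 := (single_le_sum (fun y _ => hnn y) (mem_univ x)).trans (by linarith : _ ≤ (0 : ℝ))
    rw [if_neg hxs] at h5
    linarith [nonpos_of_mul_nonpos_right h5 hp]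
  -- A nonempty path to `s` would carry the maximum to a predecessor of `s`, which is impossible;
  -- only the empty path remains.
  have hreach : ∀ σ, |1 - h σ| = m → σ = s := by
    intro σ
    refine Relation.ReflTransGen.head_induction_on (motive := fun σ _ => |1 - h σ| = m → σ = s)
      (hirr σ s) (fun _ => rfl) fun {σ x} hx _ ih hσ => ?_
    obtain ⟨h1, h2⟩ := hprop σ hσ x hx
    exact absurd (ih h2) h1
  obtain ⟨x, hx⟩ := hE σ₀
  obtain ⟨h1, h2⟩ := hprop σ₀ rfl x hx
  exact absurd (hreach x h2) h1

end Return

end ReactionNetwork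

/-! ### Elementary inequalities, and sums over visited vertices. -/

theorem one_div_tangent_le {p q : ℝ} (hp : 0 < p) (hq : 0 < q) :
    1 / p - (q - p) / p ^ 2 ≤ 1 / q := by
  have : 1 / q - (1 / p - (q - p) / p ^ 2) = (q - p) ^ 2 / (p ^ 2 * q) := by
    field_simp
    ring
  have h2 : 0 ≤ (q - p) ^ 2 / (p ^ 2 * q) := by positivity
  linarith

theorem succ_sq_le_four_pow (n : ℕ) : ((n : ℝ) + 1) ^ 2 ≤ 4 ^ n := by
  have h : (n : ℝ) + 1 ≤ 2 ^ n := by exact_mod_cast Nat.lt_two_pow_self (n := n)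
  calc ((n : ℝ) + 1) ^ 2 ≤ (2 ^ n) ^ 2 := pow_le_pow_left₀ (by positivity) h 2
    _ = 4 ^ n := by rw [← pow_mul, mul_comm, pow_mul]; norm_num

/-- With `n` interior vertices, `2 ^ (n + 1)` bounds a product over `n + 1` vertices and `n + 1` the
multiplicity of a visited one; the exponential room pays for both. -/
theorem succ_mul_two_pow_le (n : ℕ) : ((n : ℝ) + 1) * 2 ^ (n + 1) ≤ 2 * 4 ^ n := by
  have h : (n : ℝ) + 1 ≤ 2 ^ n := by exact_mod_cast Nat.lt_two_pow_self (n := n)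
  calc ((n : ℝ) + 1) * 2 ^ (n + 1) ≤ 2 ^ n * 2 ^ (n + 1) :=
        mul_le_mul_of_nonneg_right h (by positivity)
    _ = 2 * 4 ^ n := by
      rw [show (4 : ℝ) = 2 * 2 by norm_num, mul_pow]; ring

section Visits

variable {V : Type*} [Fintype V] [DecidableEq V]

/-- The sum of a function over the vertices of a path, without multiplicity. -/
def visitSum (f : V → ℝ) (l : List V) : ℝ := ∑ v, if v ∈ l then f v else 0

variable {f : V → ℝ} {l : List V}

theorem visitSum_nonneg (hf : ∀ v, 0 ≤ f v) (l : List V) : 0 ≤ visitSum f l :=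
  sum_nonneg fun v _ => by split_ifs; exacts [hf v, le_rfl]

theorem le_visitSum (hf : ∀ v, 0 ≤ f v) {v : V} (hv : v ∈ l) : f v ≤ visitSum f l := by
  have := single_le_sum (f := fun v => if v ∈ l then f v else 0)
    (fun v _ => by split_ifs; exacts [hf v, le_rfl]) (mem_univ v)
  rw [if_pos hv] at this
  exact this

theorem visitSum_le_sum_map (hf : ∀ v, 0 ≤ f v) (l : List V) : visitSum f l ≤ (l.map f).sum := by
  induction l with
  | nil => simp [visitSum]
  | cons x l ih =>
    have : visitSum f (x :: l) ≤ ∑ v, ((if v = x then f v else 0) + if v ∈ l then f v else 0) := by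
      refine sum_le_sum fun v _ => ?_
      have := hf v
      by_cases h1 : v = x <;> by_cases h2 : v ∈ l <;> simp [h1, h2] <;> grind
    rw [sum_add_distrib] at this
    simp only [sum_ite_eq', mem_univ, if_true] at this
    rw [List.map_cons, List.sum_cons]
    exact this.trans (add_le_add le_rfl ih)

theorem sum_map_le_visitSum (hf : ∀ v, 0 ≤ f v) (l : List V) :
    (l.map f).sum ≤ l.length * visitSum f l := by
  have := List.sum_le_card_nsmul (l.map f) (visitSum f l) (by
    intro y hy
    obtain ⟨x, hx, rfl⟩ := List.mem_map.1 hy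
    exact le_visitSum hf hx)
  simpa using this

variable {u : V → V → ℝ} {D : V → V → Prop} {t : V} {τ : ℝ}

/-- Counting each visited vertex once turns the sum into a combination of hitting indicators of
single vertices, to which `tsum_hit_le` applies with `B = {v}`. -/
theorem four_pow_mul_visitSum_eq (A : Finset V) (u : V → V → ℝ) (t σ : V) (f : V → ℝ) (c : ℝ)
    (l : List V) : c * passageWeight A u t σ l * visitSum f (σ :: l) =
      ∑ v, f v * if ∃ x ∈ σ :: l, x ∈ ({v} : Finset V) then
        c * passageWeight A u t σ l else 0 := by
  have h : ∀ v, (∃ x ∈ σ :: l, x ∈ ({v} : Finset V)) ↔ v ∈ σ :: l := fun v => by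
    simp only [Finset.mem_singleton, exists_eq_right]
  simp_rw [h]
  rw [visitSum, mul_sum]
  refine sum_congr rfl fun v _ => ?_
  split_ifs <;> ring

theorem LightLoops.summable_visitSum (h : LightLoops u D t τ) (hτ : SmallWeight V τ)
    (A : Finset V) (σ : V) (f : V → ℝ) :
    Summable fun l => 4 ^ l.length * passageWeight A u t σ l * visitSum f (σ :: l) := by
  simp_rw [four_pow_mul_visitSum_eq]
  exact summable_sum fun v _ => (h.summable_hit hτ A {v} σ).mul_left _

theorem LightLoops.tsum_visitSum_le (h : LightLoops u D t τ) (hτ : SmallWeight V τ)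
    (A : Finset V) (σ : V) (hf : ∀ v, 0 ≤ f v) :
    ∑' l, 4 ^ l.length * passageWeight A u t σ l * visitSum f (σ :: l) ≤
      shortRatio V * ∑ l ∈ shortLists V (pathBound V),
        passageWeight A u t σ l * visitSum f (σ :: l) := by
  have h1 : ∀ l, passageWeight A u t σ l * visitSum f (σ :: l) =
      ∑ v, f v * if ∃ x ∈ σ :: l, x ∈ ({v} : Finset V) then
        passageWeight A u t σ l else 0 := fun l => by
    have := four_pow_mul_visitSum_eq A u t σ f 1 l
    simpa only [one_mul] using this
  simp_rw [four_pow_mul_visitSum_eq, h1]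
  rw [Summable.tsum_finsetSum fun v _ => (h.summable_hit hτ A {v} σ).mul_left _, sum_comm, mul_sum]
  refine sum_le_sum fun v _ => ?_
  rw [tsum_mul_left, ← mul_sum, mul_left_comm]
  exact mul_le_mul_of_nonneg_left (h.tsum_hit_le hτ A {v} σ) (hf v)

theorem shortRatio_nonneg (V : Type*) [Fintype V] : 0 ≤ shortRatio V := by
  unfold shortRatio
  positivity

theorem one_le_shortRatio (V : Type*) [Fintype V] : 1 ≤ shortRatio V := by
  unfold shortRatio
  have : (1 : ℝ) ≤ 4 ^ pathBound V := one_le_pow₀ (by norm_num)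
  linarith

end Visits

/-! ### High and low weights as functions of `α`. -/

namespace ReactionNetwork

variable {V R : Type*} [Fintype V] [DecidableEq V] [Fintype R] {net : ReactionNetwork V R}

/-- The sum of the inverse diagonal rates along a path. -/
def residence (net : ReactionNetwork V R) (l : List V) : ℝ :=
  (l.map fun x => 1 / net.diagRate x).sum

theorem residence_cons (x : V) (l : List V) :
    net.residence (x :: l) = 1 / net.diagRate x + net.residence l := by
  simp [residence]

theorem residence_nonneg (l : List V) : 0 ≤ net.residence l := by
  refine List.sum_nonneg fun y hy => ?_
  obtain ⟨x, -, rfl⟩ := List.mem_map.1 hy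
  exact div_nonneg zero_le_one (abs_nonneg _)

theorem one_sub_le_damping (hE : ∀ σ, ∃ σ', net.Edge σ σ') {α : ℝ} (hα : 0 ≤ α) (l : List V) :
    1 - α * net.residence l ≤ net.damping α l := by
  induction l with
  | nil => simp [damping, residence]
  | cons x l ih =>
    have ha := diagRate_pos hE x
    have h1 : net.diagRate x / (net.diagRate x + α) = 1 - α / (net.diagRate x + α) := by
      field_simp
      ring
    have h2 : α / (net.diagRate x + α) * net.damping α l ≤ α * (1 / net.diagRate x) := by
      calc α / (net.diagRate x + α) * net.damping α l
          ≤ α / (net.diagRate x + α) * 1 :=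
            mul_le_mul_of_nonneg_left (damping_le_one hE hα l) (by positivity)
        _ ≤ α / net.diagRate x := by
            rw [mul_one]
            exact div_le_div_of_nonneg_left hα ha (by linarith)
        _ = _ := by ring
    rw [damping_cons, residence_cons, h1]
    linarith

/-- The inverse of the damping is the product of the factors `1 + α / a_x`, which is at least its
first order expansion. -/
theorem damping_le_one_div (hE : ∀ σ, ∃ σ', net.Edge σ σ') {α : ℝ} (hα : 0 ≤ α) (l : List V) :
    net.damping α l ≤ 1 / (1 + α * net.residence l) := by
  induction l with
  | nil => simp [damping, residence]
  | cons x l ih =>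
    have ha := diagRate_pos hE x
    have hX := residence_nonneg (net := net) l
    have h1 : net.diagRate x / (net.diagRate x + α) = 1 / (1 + α * (1 / net.diagRate x)) := by
      field_simp
    have h0 : 0 ≤ α * (1 / net.diagRate x) := by positivity
    have h2 : 0 ≤ α * net.residence l := by positivity
    rw [damping_cons, residence_cons, h1]
    calc 1 / (1 + α * (1 / net.diagRate x)) * net.damping α l
        ≤ 1 / (1 + α * (1 / net.diagRate x)) * (1 / (1 + α * net.residence l)) :=
          mul_le_mul_of_nonneg_left ih (by positivity)
      _ = 1 / ((1 + α * (1 / net.diagRate x)) * (1 + α * net.residence l)) := by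
          rw [div_mul_div_comm, one_mul]
      _ ≤ _ := one_div_le_one_div_of_le (by positivity) (by nlinarith [mul_nonneg h0 h2])

theorem hasDerivAt_damping {α : ℝ}
    (hα : ∀ x, 0 < net.diagRate x + α) (l : List V) :
    HasDerivAt (fun α => net.damping α l)
      (-(net.damping α l * (l.map fun x => 1 / (net.diagRate x + α)).sum)) α := by
  induction l with
  | nil => simpa [damping] using hasDerivAt_const α (1 : ℝ)
  | cons x l ih =>
    simp_rw [damping_cons]
    have h1 : HasDerivAt (fun α => net.diagRate x / (net.diagRate x + α))
        (-(net.diagRate x / (net.diagRate x + α) ^ 2)) α := by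
      refine ((hasDerivAt_const α (net.diagRate x)).div
        ((hasDerivAt_id' α).const_add (net.diagRate x)) (hα x).ne').congr_deriv ?_
      ring
    refine (h1.mul ih).congr_deriv ?_
    rw [List.map_cons, List.sum_cons]
    have := (hα x).ne'
    field_simp
    ring

theorem exists_diagRate_lower (hE : ∀ σ, ∃ σ', net.Edge σ σ') :
    ∃ a₀ : ℝ, 0 < a₀ ∧ ∀ x, a₀ ≤ net.diagRate x := by
  rcases isEmpty_or_nonempty V with h | h
  · exact ⟨1, one_pos, fun x => h.elim x⟩
  · obtain ⟨x, hx⟩ := Finite.exists_min net.diagRate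
    exact ⟨_, diagRate_pos hE x, hx⟩

theorem damping_zero (hE : ∀ σ, ∃ σ', net.Edge σ σ') (l : List V) : net.damping 0 l = 1 := by
  induction l with
  | nil => simp [damping]
  | cons x l ih => rw [damping_cons, ih, add_zero, div_self (diagRate_pos hE x).ne', mul_one]

section Main

variable {D : V → V → Prop} {s : V} {τ : ℝ} {b : ℝ} {N : ℤ}

theorem highWeight_eq (α : ℝ) : net.highWeight b N s α =
    ∑' l, passageWeight (net.highVertices b N) (net.weight α) s s l := by
  have := tsum_highExcursions (net := net) (b := b) (N := N) (s := s) (u := net.weight α)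
    (fun _ _ h => weight_eq_zero h) (fun _ => 1)
  simp only [one_mul] at this
  exact this

theorem lowWeight_eq (α : ℝ) : net.lowWeight b N s α =
    ∑' l, if ∃ x ∈ s :: l, x ∈ (net.highVertices b N)ᶜ then
      passageWeight univ (net.weight α) s s l else 0 :=
  tsum_lowExcursions fun _ _ h => weight_eq_zero h

theorem lowLoss_eq : net.lowLoss b N s =
    ∑' l, if ∃ x ∈ s :: l, x ∈ (net.highVertices b N)ᶜ then
      passageWeight univ net.probWeight s s l else 0 :=
  tsum_lowExcursions fun _ _ h => probWeight_eq_zero h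

/-- The factor `1 + ε_γ` of the excursion with interior `l`. -/
def gainFactor (net : ReactionNetwork V R) (l : List V) : ℝ :=
  (l.map fun σ => 1 + net.deficiencyWeight σ).prod

theorem pathDeficiency_closePath (l : List V) :
    net.pathDeficiency (s :: (l ++ [s])) = net.gainFactor (s :: l) - 1 := by
  rw [pathDeficiency, gainFactor, show s :: (l ++ [s]) = (s :: l) ++ [s] from rfl,
    List.dropLast_concat]

theorem highGain_eq : net.highGain b N s =
    ∑' l, (net.gainFactor (s :: l) - 1) *
      passageWeight (net.highVertices b N) net.probWeight s s l := by
  have := tsum_highExcursions (net := net) (b := b) (N := N) (s := s) (u := net.probWeight)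
    (fun _ _ h => probWeight_eq_zero h) net.pathDeficiency
  simp only [pathDeficiency_closePath] at this
  exact this

theorem passageWeight_weight_zero_eq (hE : ∀ σ, ∃ σ', net.Edge σ σ') (A : Finset V) (t σ : V)
    (l : List V) : passageWeight A (net.weight 0) t σ l =
      net.gainFactor (σ :: l) * passageWeight A net.probWeight t σ l := by
  rw [weight_zero_eq hE, passageWeight_mul, gainFactor]

theorem deltaCHigh_eq (hE : ∀ σ, ∃ σ', net.Edge σ σ') :
    net.deltaCHigh b N s = net.highWeight b N s 0 - 1 := by
  have := tsum_highExcursions (net := net) (b := b) (N := N) (s := s) (u := net.probWeight)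
    (fun _ _ h => probWeight_eq_zero h) (fun γ => 1 + net.pathDeficiency γ)
  rw [deltaCHigh, this, highWeight_eq]
  simp only [pathDeficiency_closePath, add_sub_cancel, passageWeight_weight_zero_eq hE]
  ring

theorem gainFactor_nonneg (hE : ∀ σ, ∃ σ', net.Edge σ σ') (l : List V) :
    0 ≤ net.gainFactor l := by
  refine List.prod_nonneg fun y hy => ?_
  obtain ⟨x, -, rfl⟩ := List.mem_map.1 hy
  exact one_add_deficiencyWeight_nonneg hE x

theorem gainFactor_le (hE : ∀ σ, ∃ σ', net.Edge σ σ') (l : List V) :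
    net.gainFactor l ≤ 2 ^ l.length := by
  induction l with
  | nil => simp [gainFactor]
  | cons x l ih =>
    have : net.gainFactor (x :: l) = (1 + net.deficiencyWeight x) * net.gainFactor l := by
      simp [gainFactor]
    rw [this, List.length_cons, pow_succ']
    exact mul_le_mul (one_add_deficiencyWeight_le hE x) ih (gainFactor_nonneg hE l) (by norm_num)

theorem summable_gainFactor_mul (hE : ∀ σ, ∃ σ', net.Edge σ σ')
    (hL : LightLoops net.probWeight D s τ) (hτ : SmallWeight V τ) (A : Finset V) :
    Summable fun l => net.gainFactor (s :: l) * passageWeight A net.probWeight s s l := by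
  have hnn := passageWeight_nonneg hL.nonneg A s s
  refine Summable.of_nonneg_of_le (fun l => mul_nonneg (gainFactor_nonneg hE _) (hnn l))
    (fun l => ?_) ((hL.summable hτ A s).mul_left 2)
  rw [← mul_assoc]
  refine mul_le_mul_of_nonneg_right ((gainFactor_le hE _).trans ?_) (hnn l)
  have := succ_mul_two_pow_le l.length
  rw [List.length_cons]
  nlinarith [pow_pos (two_pos (α := ℝ)) (l.length + 1), (Nat.cast_nonneg l.length : (0 : ℝ) ≤ _)]

theorem summable_low {u : V → V → ℝ} (hu : ∀ x y, 0 ≤ u x y)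
    (h : Summable fun l => passageWeight univ u s s l) (A : Finset V) :
    Summable fun l => if ∃ x ∈ s :: l, x ∈ A then passageWeight univ u s s l else 0 := by
  refine Summable.of_nonneg_of_le (fun l => ?_) (fun l => ?_) h
  · split_ifs
    exacts [passageWeight_nonneg hu _ _ _ _, le_rfl]
  · split_ifs
    exacts [le_rfl, passageWeight_nonneg hu _ _ _ _]

theorem returnWeight_eq (hE : ∀ σ, ∃ σ', net.Edge σ σ')
    (hL : LightLoops (net.weight 0) D s τ) (hτ : SmallWeight V τ) {α : ℝ} (hα : 0 ≤ α) :
    net.returnWeight s α = net.highWeight b N s α + net.lowWeight b N s α := by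
  rw [highWeight_eq, lowWeight_eq, returnWeight, ← Summable.tsum_add
    (summable_passageWeight_weight hE hL hτ hα _ s)
    (summable_low (weight_nonneg hα) (summable_passageWeight_weight hE hL hτ hα _ s) _)]
  exact tsum_congr fun l => passageWeight_univ_eq _ _ _ _ _

/-- The probabilities of high and low excursions add up to 1. Substituting this for the 1 in
`δc_high` cancels the probability of the high excursions and leaves their deficiency part minus the
low part. -/
theorem deltaCHigh_eq_sub (hE : ∀ σ, ∃ σ', net.Edge σ σ') (hirr : net.Irreducible)
    (hL : LightLoops net.probWeight D s τ) (hτ : SmallWeight V τ) :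
    net.deltaCHigh b N s = net.highGain b N s - net.lowLoss b N s := by
  have hs : ∀ A : Finset V, Summable fun l => passageWeight A net.probWeight s s l :=
    fun A => summable_passageWeight_of_four_pow hL.nonneg (hL.summable hτ A s)
  have h1 := tsum_probWeight_eq_one hE hirr hL hτ
  rw [tsum_congr (passageWeight_univ_eq (net.highVertices b N) net.probWeight s s), Summable.tsum_add (hs _) (summable_low hL.nonneg (hs univ) _), ← lowLoss_eq] at h1
  rw [deltaCHigh_eq hE, highWeight_eq, highGain_eq]
  simp_rw [sub_mul, one_mul, passageWeight_weight_zero_eq hE]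
  rw [Summable.tsum_sub (summable_gainFactor_mul hE hL hτ _) (hs _)]
  linarith

theorem lowLoss_nonneg : 0 ≤ net.lowLoss b N s :=
  tsum_nonneg fun _ => pathWeight_nonneg probWeight_nonneg _

theorem lowWeight_nonneg {α : ℝ} (hα : 0 ≤ α) : 0 ≤ net.lowWeight b N s α :=
  tsum_nonneg fun _ => pathWeight_nonneg (weight_nonneg hα) _

/-- Low excursions have a weight comparable to their probability. -/
theorem lowWeight_zero_le (hE : ∀ σ, ∃ σ', net.Edge σ σ')
    (hL : LightLoops (net.weight 0) D s τ) (hP : LightLoops net.probWeight D s τ)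
    (hτ : SmallWeight V τ) :
    net.lowWeight b N s 0 ≤ 2 * shortRatio V * net.lowLoss b N s := by
  rw [lowWeight_eq, lowLoss_eq]
  set B := (net.highVertices b N)ᶜ
  have hnn := passageWeight_nonneg hP.nonneg univ s s
  have hs := summable_low hP.nonneg
    (summable_passageWeight_of_four_pow hP.nonneg (hP.summable hτ univ s)) B
  calc ∑' l, (if ∃ x ∈ s :: l, x ∈ B then passageWeight univ (net.weight 0) s s l else 0)
      ≤ ∑' l, 2 * (if ∃ x ∈ s :: l, x ∈ B then
          4 ^ l.length * passageWeight univ net.probWeight s s l else 0) := by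
        refine (summable_low hL.nonneg
          (summable_passageWeight_of_four_pow hL.nonneg (hL.summable hτ univ s)) B).tsum_le_tsum
          (fun l => ?_) ((hP.summable_hit hτ univ B s).mul_left 2)
        split_ifs
        · rw [passageWeight_weight_zero_eq hE, ← mul_assoc]
          refine mul_le_mul_of_nonneg_right ((gainFactor_le hE _).trans ?_) (hnn l)
          have := succ_mul_two_pow_le l.length
          rw [List.length_cons]
          nlinarith [pow_pos (two_pos (α := ℝ)) (l.length + 1),
            (Nat.cast_nonneg l.length : (0 : ℝ) ≤ _)]
        · simp
    _ ≤ 2 * (shortRatio V * ∑ l ∈ shortLists V (pathBound V),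
          (if ∃ x ∈ s :: l, x ∈ B then passageWeight univ net.probWeight s s l else 0)) := by
        rw [tsum_mul_left]
        exact mul_le_mul_of_nonneg_left (hP.tsum_hit_le hτ univ B s) (by norm_num)
    _ ≤ _ := by
        rw [← mul_assoc]
        refine mul_le_mul_of_nonneg_left (hs.sum_le_tsum _ fun l _ => ?_)
          (mul_nonneg (by norm_num) (shortRatio_nonneg V))
        split_ifs
        exacts [hnn l, le_rfl]

/-- Damping by a factor `κ` at the low vertices. -/
theorem lowWeight_le_mul (hE : ∀ σ, ∃ σ', net.Edge σ σ')
    (hL : LightLoops (net.weight 0) D s τ) (hτ : SmallWeight V τ) {α κ : ℝ} (hα : 0 ≤ α)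
    (hκ : ∀ x, net.vertexScale b x ≤ N → net.diagRate x / (net.diagRate x + α) ≤ κ) :
    net.lowWeight b N s α ≤ κ * net.lowWeight b N s 0 := by
  rw [lowWeight_eq, lowWeight_eq, ← tsum_mul_left]
  refine (summable_low (weight_nonneg hα)
    (summable_passageWeight_weight hE hL hτ hα univ s) _).tsum_le_tsum (fun l => ?_)
    ((summable_low hL.nonneg
      (summable_passageWeight_weight hE hL hτ le_rfl univ s) _).mul_left _)
  split_ifs with h
  · obtain ⟨x, hx, hxB⟩ := h
    rw [mem_compl, mem_highVertices, not_lt] at hxB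
    rw [passageWeight_weight_eq hE]
    exact mul_le_mul_of_nonneg_right ((damping_le_of_mem hE hα hx).trans (hκ x hxB))
      (passageWeight_nonneg hL.nonneg _ _ _ _)
  · simp

theorem lowWeight_le (hE : ∀ σ, ∃ σ', net.Edge σ σ')
    (hL : LightLoops (net.weight 0) D s τ) (hτ : SmallWeight V τ) {α : ℝ} (hα : 0 ≤ α) :
    net.lowWeight b N s α ≤ net.lowWeight b N s 0 := by
  have := lowWeight_le_mul (b := b) (N := N) hE hL hτ hα (κ := 1)
    fun x _ => damping_factor_le_one hE hα x
  rwa [one_mul] at this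

/-- One factor `l.length + 1` is the weight in the statement, another bounds the multiplicity of
visits in `residence`; their product is below `4 ^ l.length`. -/
theorem summable_residence (hE : ∀ σ, ∃ σ', net.Edge σ σ') {u : V → V → ℝ}
    (hL : LightLoops u D s τ) (hτ : SmallWeight V τ) (A : Finset V) :
    Summable fun l => ((l.length : ℝ) + 1) *
      (passageWeight A u s s l * net.residence (s :: l)) := by
  have hnn := passageWeight_nonneg hL.nonneg A s s
  have hf : ∀ v, 0 ≤ 1 / net.diagRate v := fun v => by
    have := diagRate_pos hE v
    positivity
  refine Summable.of_nonneg_of_le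
    (fun l => mul_nonneg (by positivity) (mul_nonneg (hnn l) (residence_nonneg _))) (fun l => ?_)
    (hL.summable_visitSum hτ A s fun v => 1 / net.diagRate v)
  have h1 := sum_map_le_visitSum hf (s :: l)
  have h2 := visitSum_nonneg hf (s :: l)
  rw [List.length_cons] at h1
  push_cast at h1
  calc ((l.length : ℝ) + 1) * (passageWeight A u s s l * net.residence (s :: l))
      ≤ ((l.length : ℝ) + 1) * (passageWeight A u s s l *
          (((l.length : ℝ) + 1) * visitSum (fun v => 1 / net.diagRate v) (s :: l))) :=
        mul_le_mul_of_nonneg_left (mul_le_mul_of_nonneg_left h1 (hnn l)) (by positivity)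
    _ = ((l.length : ℝ) + 1) ^ 2 * passageWeight A u s s l *
          visitSum (fun v => 1 / net.diagRate v) (s :: l) := by ring
    _ ≤ _ := mul_le_mul_of_nonneg_right
        (mul_le_mul_of_nonneg_right (succ_sq_le_four_pow _) (hnn l)) h2

theorem summable_residence' (hE : ∀ σ, ∃ σ', net.Edge σ σ') {u : V → V → ℝ}
    (hL : LightLoops u D s τ) (hτ : SmallWeight V τ) (A : Finset V) :
    Summable fun l => passageWeight A u s s l * net.residence (s :: l) := by
  have hnn := passageWeight_nonneg hL.nonneg A s s
  refine Summable.of_nonneg_of_le (fun l => mul_nonneg (hnn l) (residence_nonneg _)) (fun l => ?_)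
    (summable_residence hE hL hτ A)
  exact le_mul_of_one_le_left (mul_nonneg (hnn l) (residence_nonneg _))
    (by linarith [(Nat.cast_nonneg l.length : (0 : ℝ) ≤ _)])

/-- The mean length of excursions is bounded. -/
theorem tsum_length_mul_residence_le (hE : ∀ σ, ∃ σ', net.Edge σ σ') {u : V → V → ℝ}
    (hL : LightLoops u D s τ) (hτ : SmallWeight V τ) (A : Finset V) :
    ∑' l : List V, ((l.length : ℝ) + 1) * (passageWeight A u s s l * net.residence (s :: l)) ≤
      shortRatio V * ∑' l, passageWeight A u s s l * net.residence (s :: l) := by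
  have hnn := passageWeight_nonneg hL.nonneg A s s
  have hf : ∀ v, 0 ≤ 1 / net.diagRate v := fun v => by
    have := diagRate_pos hE v
    positivity
  -- Passing from `residence` to `visitSum` costs a power of the length, hidden in `4 ^ l.length`.
  -- The reduction to short paths removes that weight, and there `visitSum` is again at most
  -- `residence`.
  refine (Summable.tsum_le_tsum (fun l => ?_) (summable_residence hE hL hτ A)
    (hL.summable_visitSum hτ A s fun v => 1 / net.diagRate v)).trans
    ((hL.tsum_visitSum_le hτ A s hf).trans
    (mul_le_mul_of_nonneg_left ((sum_le_sum fun l _ => ?_).trans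
      ((summable_residence' hE hL hτ A).sum_le_tsum _ fun l _ =>
        mul_nonneg (hnn l) (residence_nonneg _))) (shortRatio_nonneg V)))
  · have h1 := sum_map_le_visitSum hf (s :: l)
    have h2 := visitSum_nonneg hf (s :: l)
    rw [List.length_cons] at h1
    push_cast at h1
    calc ((l.length : ℝ) + 1) * (passageWeight A u s s l * net.residence (s :: l))
        ≤ ((l.length : ℝ) + 1) * (passageWeight A u s s l *
            (((l.length : ℝ) + 1) * visitSum (fun v => 1 / net.diagRate v) (s :: l))) :=
          mul_le_mul_of_nonneg_left (mul_le_mul_of_nonneg_left h1 (hnn l)) (by positivity)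
      _ = ((l.length : ℝ) + 1) ^ 2 * passageWeight A u s s l *
            visitSum (fun v => 1 / net.diagRate v) (s :: l) := by ring
      _ ≤ _ := mul_le_mul_of_nonneg_right
          (mul_le_mul_of_nonneg_right (succ_sq_le_four_pow _) (hnn l)) h2
  · exact mul_le_mul_of_nonneg_left (visitSum_le_sum_map hf _) (hnn l)

theorem hasDerivAt_highWeight (hE : ∀ σ, ∃ σ', net.Edge σ σ')
    (hL : LightLoops (net.weight 0) D s τ) (hτ : SmallWeight V τ) :
    HasDerivAt (fun α => net.highWeight b N s α)
      (-∑' l, passageWeight (net.highVertices b N) (net.weight 0) s s l *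
        net.residence (s :: l)) 0 := by
  set A := net.highVertices b N
  have hnn := passageWeight_nonneg hL.nonneg A s s
  obtain ⟨a₀, ha₀, ha⟩ := exists_diagRate_lower hE
  -- The derivative at 0 is two-sided, so negative `α` must be admitted. For `α > -a₀ / 2` each
  -- damping factor is at most 2 and each `1 / (a_x + α)` at most `2 / a₀`, hence the majorant `(4 /
  -- a₀) * 4 ^ l.length`.
  have key := hasDerivAt_tsum_of_isPreconnected (𝕜 := ℝ) (t := Set.Ioi (-(a₀ / 2))) (y₀ := 0)
    (y := 0) (g := fun l α => net.damping α (s :: l) * passageWeight A (net.weight 0) s s l)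
    (g' := fun l α => -(net.damping α (s :: l) *
      ((s :: l).map fun x => 1 / (net.diagRate x + α)).sum) *
      passageWeight A (net.weight 0) s s l)
    ((hL.summable hτ A s).mul_left (4 / a₀)) isOpen_Ioi isPreconnected_Ioi ?_ ?_ ?_ ?_ ?_
  · have heq : (fun α => net.highWeight b N s α) = fun α =>
        ∑' l, net.damping α (s :: l) * passageWeight A (net.weight 0) s s l := by
      funext α
      rw [highWeight_eq]
      exact tsum_congr fun l => passageWeight_weight_eq hE _ _ _ α l
    rw [heq]
    refine key.congr_deriv ?_
    rw [← tsum_neg]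
    refine tsum_congr fun l => ?_
    rw [damping_zero hE, one_mul]
    simp only [add_zero, residence]
    ring
  · intro l α hα
    refine (hasDerivAt_damping (fun x => ?_) _).mul_const _
    have h1 : -(a₀ / 2) < α := hα
    linarith [ha x]
  · intro l α hα
    have h1 : -(a₀ / 2) < α := hα
    have hpos : ∀ x, a₀ / 2 ≤ net.diagRate x + α := fun x => by linarith [ha x]
    have hd : ∀ l, 0 ≤ net.damping α l ∧ net.damping α l ≤ 2 ^ l.length := by
      intro l
      induction l with
      | nil => simp [damping]
      | cons x l ih =>
        have hx := hpos x
        have hx0 : 0 < net.diagRate x + α := by linarith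
        have hq : 0 ≤ net.diagRate x / (net.diagRate x + α) :=
          div_nonneg (diagRate_pos hE x).le hx0.le
        rw [damping_cons, List.length_cons, pow_succ']
        refine ⟨mul_nonneg hq ih.1, mul_le_mul ?_ ih.2 ih.1 (by norm_num)⟩
        rw [div_le_iff₀ hx0]
        linarith [ha x]
    have hS : ∀ l : List V, 0 ≤ (l.map fun x => 1 / (net.diagRate x + α)).sum ∧
        (l.map fun x => 1 / (net.diagRate x + α)).sum ≤ l.length * (2 / a₀) := by
      intro l
      induction l with
      | nil => simp
      | cons x l ih =>
        have hx := hpos x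
        have hx0 : 0 < net.diagRate x + α := by linarith
        have h2 : 1 / (net.diagRate x + α) ≤ 2 / a₀ := by
          rw [div_le_div_iff₀ hx0 ha₀]
          linarith
        have h3 : 0 ≤ 1 / (net.diagRate x + α) := by positivity
        rw [List.map_cons, List.sum_cons, List.length_cons]
        push_cast
        exact ⟨by linarith [ih.1], by linarith [ih.2]⟩
    rw [norm_mul, norm_neg, Real.norm_of_nonneg (mul_nonneg (hd _).1 (hS _).1),
      Real.norm_of_nonneg (hnn l), ← mul_assoc]
    refine mul_le_mul_of_nonneg_right ?_ (hnn l)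
    calc net.damping α (s :: l) * ((s :: l).map fun x => 1 / (net.diagRate x + α)).sum
        ≤ 2 ^ (s :: l).length * ((s :: l).length * (2 / a₀)) :=
          mul_le_mul (hd _).2 (hS _).2 (hS _).1 (by positivity)
      _ = (((l.length : ℝ) + 1) * 2 ^ (l.length + 1)) * (2 / a₀) := by
          rw [List.length_cons]
          push_cast
          ring
      _ ≤ (2 * 4 ^ l.length) * (2 / a₀) :=
          mul_le_mul_of_nonneg_right (succ_mul_two_pow_le _) (by positivity)
      _ = _ := by ring
  · exact Set.mem_Ioi.2 (by linarith)
  · simp_rw [damping_zero hE, one_mul]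
    exact summable_passageWeight_of_four_pow hL.nonneg (hL.summable hτ A s)
  · exact Set.mem_Ioi.2 (by linarith)

theorem cPrimeHigh_eq (hE : ∀ σ, ∃ σ', net.Edge σ σ')
    (hL : LightLoops (net.weight 0) D s τ) (hτ : SmallWeight V τ) :
    net.cPrimeHigh b N s = ∑' l, passageWeight (net.highVertices b N) (net.weight 0) s s l *
      net.residence (s :: l) := by
  rw [cPrimeHigh, (hasDerivAt_highWeight hE hL hτ).deriv, neg_neg]

theorem cPrimeHigh_nonneg (hE : ∀ σ, ∃ σ', net.Edge σ σ')
    (hL : LightLoops (net.weight 0) D s τ) (hτ : SmallWeight V τ) : 0 ≤ net.cPrimeHigh b N s := by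
  rw [cPrimeHigh_eq hE hL hτ]
  exact tsum_nonneg fun l =>
    mul_nonneg (passageWeight_nonneg hL.nonneg _ s s l) (residence_nonneg _)

/-- The tangent at zero lies below the convex function `highWeight`. -/
theorem highWeight_sub_le (hE : ∀ σ, ∃ σ', net.Edge σ σ')
    (hL : LightLoops (net.weight 0) D s τ) (hτ : SmallWeight V τ) {α : ℝ} (hα : 0 ≤ α) :
    net.highWeight b N s 0 - net.highWeight b N s α ≤ α * net.cPrimeHigh b N s := by
  rw [cPrimeHigh_eq hE hL hτ, highWeight_eq, highWeight_eq, ← tsum_mul_left, ← Summable.tsum_sub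
    (summable_passageWeight_weight hE hL hτ le_rfl _ s)
    (summable_passageWeight_weight hE hL hτ hα _ s)]
  refine Summable.tsum_le_tsum (fun l => ?_)
    ((summable_passageWeight_weight hE hL hτ le_rfl _ s).sub
    (summable_passageWeight_weight hE hL hτ hα _ s))
    ((summable_residence' hE hL hτ _).mul_left _)
  rw [passageWeight_weight_eq hE _ _ _ α]
  nlinarith [one_sub_le_damping hE hα (s :: l),
    passageWeight_nonneg hL.nonneg (net.highVertices b N) s s l]

/-- As long as `α` is at most `T` times the diagonal entries of the high vertices, the decrease of
`highWeight` is comparable to the linear approximation. -/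
theorem le_highWeight_sub (hE : ∀ σ, ∃ σ', net.Edge σ σ')
    (hL : LightLoops (net.weight 0) D s τ) (hτ : SmallWeight V τ) {α T : ℝ} (hα : 0 ≤ α)
    (hT : 0 ≤ T) (h : ∀ x, N < net.vertexScale b x → α ≤ T * net.diagRate x) :
    α * net.cPrimeHigh b N s ≤ (1 + shortRatio V * T) *
      (net.highWeight b N s 0 - net.highWeight b N s α) := by
  set A := net.highVertices b N with hA
  set C := shortRatio V with hC
  have hC0 : 0 ≤ C := shortRatio_nonneg V
  set c := fun l => passageWeight A (net.weight 0) s s l with hc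
  have hnn : ∀ l, 0 ≤ c l := passageWeight_nonneg hL.nonneg A s s
  set X := fun l => net.residence (s :: l) with hX
  have hX0 : ∀ l, 0 ≤ X l := fun l => residence_nonneg _
  set p := 1 + C * T with hp
  have hp0 : 0 < p := by positivity
  have hsX : Summable fun l => c l * X l := summable_residence' hE hL hτ A
  have hsXl : Summable fun l => ((l.length : ℝ) + 1) * (c l * X l) := summable_residence hE hL hτ A
  have hmean : ∑' l : List V, ((l.length : ℝ) + 1) * (c l * X l) ≤ C * ∑' l, c l * X l :=
    tsum_length_mul_residence_le hE hL hτ A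
  have hs0 := summable_passageWeight_weight hE hL hτ le_rfl A s
  have hsα := summable_passageWeight_weight hE hL hτ hα A s
  rw [cPrimeHigh_eq hE hL hτ, highWeight_eq, highWeight_eq, ← Summable.tsum_sub hs0 hsα]
  -- With `m` the number of edges and `α X ≤ T m`, the loss `1 - damping` is at least `α X / (1 + T
  -- m)`. Replacing `1 / (1 + T m)` by its tangent at `p = 1 + C T` is Jensen's inequality for the
  -- measure `c X`: the correction is linear in `m - C` and has the right sign after summation,
  -- because the mean of `m` is at most `C`.
  have hterm : ∀ l, (α / p + α * C * T / p ^ 2) * (c l * X l) -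
      α * T / p ^ 2 * (((l.length : ℝ) + 1) * (c l * X l)) ≤
      passageWeight A (net.weight 0) s s l - passageWeight A (net.weight α) s s l := by
    intro l
    by_cases hcl : c l = 0
    · rw [passageWeight_weight_eq hE _ _ _ α]
      have : passageWeight A (net.weight 0) s s l = 0 := hcl
      rw [hcl, this]
      simp
    have hmem : ∀ x ∈ s :: l, x ∈ A := by
      by_contra hcon
      exact hcl (if_neg fun h => hcon h.2)
    have hXT : α * X l ≤ T * ((l.length : ℝ) + 1) := by
      have : ∀ l : List V, (∀ x ∈ l, x ∈ A) → α * net.residence l ≤ T * l.length := by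
        intro l hl
        induction l with
        | nil => simp [residence]
        | cons x l ih =>
          have h1 := ih fun y hy => hl y (by simp [hy])
          have h2 := h x (mem_highVertices.1 (hl x (by simp)))
          have h3 : α * (1 / net.diagRate x) ≤ T := by
            rw [mul_one_div, div_le_iff₀ (diagRate_pos hE x)]
            exact h2
          rw [residence_cons, List.length_cons]
          push_cast
          linarith
      have := this (s :: l) hmem
      rw [List.length_cons] at this
      push_cast at this
      exact this
    set m : ℝ := (l.length : ℝ) + 1 with hm
    have hm0 : 0 ≤ m := by positivity
    have hd := damping_le_one_div hE hα (s :: l)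
    have hαX : 0 ≤ α * X l := mul_nonneg hα (hX0 l)
    have h1 : α * X l * (1 / p - ((1 + T * m) - p) / p ^ 2) ≤ 1 - net.damping α (s :: l) := by
      calc α * X l * (1 / p - ((1 + T * m) - p) / p ^ 2)
          ≤ α * X l * (1 / (1 + T * m)) :=
            mul_le_mul_of_nonneg_left (one_div_tangent_le hp0 (by positivity)) hαX
        _ ≤ α * X l * (1 / (1 + α * X l)) :=
            mul_le_mul_of_nonneg_left
              (one_div_le_one_div_of_le (by positivity) (by linarith)) hαX
        _ = 1 - 1 / (1 + α * X l) := by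
            field_simp
            ring
        _ ≤ _ := by linarith
    have h2 := mul_le_mul_of_nonneg_right h1 (hnn l)
    rw [passageWeight_weight_eq hE _ _ _ α]
    have h3 : passageWeight A (net.weight 0) s s l -
        net.damping α (s :: l) * passageWeight A (net.weight 0) s s l =
        (1 - net.damping α (s :: l)) * c l := by
      simp only [hc]
      ring
    rw [h3]
    refine le_of_eq_of_le ?_ h2
    rw [hp]
    field_simp
    ring
  have hsum := Summable.tsum_le_tsum hterm ((hsX.mul_left _).sub (hsXl.mul_left _)) (hs0.sub hsα)
  rw [Summable.tsum_sub (hsX.mul_left _) (hsXl.mul_left _), tsum_mul_left, tsum_mul_left] at hsum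
  have h4 : α * T / p ^ 2 * ∑' l : List V, ((l.length : ℝ) + 1) * (c l * X l) ≤
      α * T / p ^ 2 * (C * ∑' l, c l * X l) :=
    mul_le_mul_of_nonneg_left hmean (by positivity)
  have h5 : α / p * ∑' l, c l * X l ≤
      ∑' l, (passageWeight A (net.weight 0) s s l - passageWeight A (net.weight α) s s l) := by
    refine le_trans ?_ hsum
    have : (α / p + α * C * T / p ^ 2) * ∑' l, c l * X l -
        α * T / p ^ 2 * (C * ∑' l, c l * X l) = α / p * ∑' l, c l * X l := by ring
    linarith
  rw [div_mul_eq_mul_div, div_le_iff₀ hp0] at h5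
  linarith

theorem highWeight_anti (hE : ∀ σ, ∃ σ', net.Edge σ σ')
    (hL : LightLoops (net.weight 0) D s τ) (hτ : SmallWeight V τ) {α β : ℝ} (hα : 0 ≤ α)
    (hαβ : α ≤ β) : net.highWeight b N s β ≤ net.highWeight b N s α := by
  rw [highWeight_eq, highWeight_eq]
  refine Summable.tsum_le_tsum (fun l => ?_)
    (summable_passageWeight_weight hE hL hτ (hα.trans hαβ) _ s)
    (summable_passageWeight_weight hE hL hτ hα _ s)
  rw [passageWeight_weight_eq hE _ _ _ α, passageWeight_weight_eq hE _ _ _ β]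
  refine mul_le_mul_of_nonneg_right ?_ (passageWeight_nonneg hL.nonneg _ s s l)
  induction s :: l with
  | nil => simp [damping]
  | cons x l ih =>
    have := diagRate_pos hE x
    rw [damping_cons, damping_cons]
    exact mul_le_mul (div_le_div_of_nonneg_left this.le (by linarith) (by linarith)) ih
      (damping_nonneg hE (hα.trans hαβ) l) (damping_factor_nonneg hE hα x)

end Main

end ReactionNetwork

/-! ### Sign of `δc_high` and comparison of `α_thr` with `λ*`. -/

namespace ReactionNetwork

variable {V R : Type*} [Fintype V] [DecidableEq V] [Fintype R] {net : ReactionNetwork V R}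
variable {D : V → V → Prop} {s : V} {τ b K : ℝ} {N : ℤ}

/-- Away from the transition regime, only the regime of autocatalytic high excursions occurs. -/
theorem threshold_estimates (hE : ∀ σ, ∃ σ', net.Edge σ σ') (hirr : net.Irreducible)
    (hL : LightLoops (net.weight 0) D s τ) (hP : LightLoops net.probWeight D s τ)
    (hτ : SmallWeight V τ) (hK : 1 ≤ K) (hb : 8 * (K * shortRatio V) ≤ b)
    (hpos : 0 < net.lyapunovExponent) (haway : net.AwayFromTransition b K N s)
    (hwin : net.InClosedWindow b K N net.lyapunovExponent ∨
      (0 < net.alphaThr b N s ∧ net.InWindow b K N (net.alphaThr b N s))) :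
    0 < net.deltaCHigh b N s ∧ net.deltaCHigh b N s ≤ net.highGain b N s ∧
      net.highGain b N s ≤ 2 * net.deltaCHigh b N s ∧
      b * net.lowWeight b N s net.lyapunovExponent ≤
        4 * (K * shortRatio V) * net.deltaCHigh b N s := by
  set lam := net.lyapunovExponent with hlam
  set S := shortRatio V with hS
  have hS1 : 1 ≤ S := one_le_shortRatio V
  have hKS : K ≤ K * S := le_mul_of_one_le_right (by linarith) hS1
  have hb0 : 0 < b := by linarith
  obtain ⟨h0, h1⟩ := returnWeight_lyapunovExponent hE hirr hL hτ hpos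
  rw [returnWeight_eq (b := b) (N := N) hE hL hτ le_rfl] at h0
  rw [returnWeight_eq (b := b) (N := N) hE hL hτ hpos.le] at h1
  have hd := deltaCHigh_eq (net := net) (b := b) (N := N) (s := s) hE
  have hd' := deltaCHigh_eq_sub (b := b) (N := N) hE hirr hP hτ
  have hl0 := lowLoss_nonneg (net := net) (b := b) (N := N) (s := s)
  have hLlow := lowWeight_zero_le (b := b) (N := N) hE hL hP hτ
  have hLle := lowWeight_le (b := b) (N := N) hE hL hτ hpos.le
  set δ := net.deltaCHigh b N s with hδ
  set G := net.highGain b N s with hG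
  set ℓ := net.lowLoss b N s with hℓ
  rcases haway with hcase | hcase
  -- The sign of the gain is not known in advance, as degradation can make deficiencies negative;
  -- hence the detour through `|G|`.
  · have hGb : K * G ≤ b / 8 * |G| := by
      calc K * G ≤ K * |G| := mul_le_mul_of_nonneg_left (le_abs_self G) (by linarith)
        _ ≤ b / 8 * |G| := mul_le_mul_of_nonneg_right (by linarith) (abs_nonneg G)
    have hG0 : 0 ≤ G := by
      have : 0 ≤ K * G := le_trans (by positivity) hcase
      exact nonneg_of_mul_nonneg_right this (by linarith)
    rw [abs_of_nonneg hG0] at hGb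
    have hℓG : ℓ ≤ G / 8 := by
      have : b * ℓ ≤ b * (G / 8) := by linarith
      exact le_of_mul_le_mul_left this hb0
    -- If `δ ≤ 0`, then `G ≤ ℓ ≤ G / 8` forces `ℓ = 0`. Without low excursions the return weight at
    -- 0 is `1 + δ ≤ 1`, against `λ* > 0`.
    have hδ0 : 0 < δ := by
      by_contra! hcon
      have hℓ0 : ℓ = 0 := by linarith
      rw [← hS, hℓ0, mul_zero] at hLlow
      linarith
    refine ⟨hδ0, by linarith, by linarith, ?_⟩
    calc b * net.lowWeight b N s lam ≤ b * (2 * S * ℓ) :=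
          mul_le_mul_of_nonneg_left (hLle.trans hLlow) hb0.le
      _ = 2 * S * (b * ℓ) := by ring
      _ ≤ 2 * S * (K * G) := mul_le_mul_of_nonneg_left hcase (by positivity)
      _ ≤ 2 * S * (K * (2 * δ)) :=
          mul_le_mul_of_nonneg_left (mul_le_mul_of_nonneg_left (by linarith) (by linarith))
            (by positivity)
      _ = 4 * (K * S) * δ := by ring
  -- When the loss prevails, `δ = G - ℓ ≤ 0`. Only here is the window hypothesis used; an accepted
  -- positive `α_thr` contradicts this at once.
  · exfalso
    have hGℓ : G ≤ ℓ / 8 := by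
      have h2 : K * ℓ ≤ b / 8 * ℓ := mul_le_mul_of_nonneg_right (by linarith) hl0
      have : b * G ≤ b * (ℓ / 8) := by linarith
      exact le_of_mul_le_mul_left this hb0
    rcases hwin with hw | ⟨ha, -⟩
    -- In the closed window each low vertex damps by `K / b`, so low excursions contribute at most
    -- `ℓ / 4` to the return weight at `λ*`, while the high ones contribute at most `1 + δ ≤ 1 - 7 ℓ
    -- / 8`. A total of 1 leaves only `ℓ = 0`.
    · have h2 := lowWeight_le_mul (b := b) (N := N) hE hL hτ hpos.le (κ := K / b) fun x hx => by
        have h3 := hw.2 x hx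
        have ha := diagRate_pos hE x
        rw [div_le_div_iff₀ (by linarith) hb0]
        nlinarith
      have h3 := highWeight_anti (b := b) (N := N) hE hL hτ le_rfl hpos.le
      have h4 : K / b * net.lowWeight b N s 0 ≤ ℓ / 4 := by
        calc K / b * net.lowWeight b N s 0 ≤ K / b * (2 * S * ℓ) :=
              mul_le_mul_of_nonneg_left hLlow (by positivity)
          _ = 2 * (K * S) * ℓ / b := by ring
          _ ≤ ℓ / 4 := by
              rw [div_le_iff₀ hb0]
              nlinarith
      have hℓ0 : ℓ = 0 := by linarith
      rw [← hS, hℓ0, mul_zero] at hLlow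
      linarith
    · have hc := cPrimeHigh_nonneg (b := b) (N := N) hE hL hτ
      rw [alphaThr] at ha
      have hδ0 : δ ≤ 0 := by linarith
      exact absurd ha (not_lt.2 (div_nonpos_of_nonpos_of_nonneg hδ0 hc))

/-- The threshold parameter approximates the Lyapunov exponent. -/
theorem alphaThr_estimates (hE : ∀ σ, ∃ σ', net.Edge σ σ') (hirr : net.Irreducible)
    (hL : LightLoops (net.weight 0) D s τ) (hτ : SmallWeight V τ) (hK : 1 ≤ K)
    (hb : 8 * (K * shortRatio V) ≤ b)
    (hpos : 0 < net.lyapunovExponent) (hδ0 : 0 < net.deltaCHigh b N s)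
    (hlow : b * net.lowWeight b N s net.lyapunovExponent ≤
        4 * (K * shortRatio V) * net.deltaCHigh b N s) :
    0 < net.cPrimeHigh b N s ∧ net.alphaThr b N s ≤ net.lyapunovExponent ∧
      (net.InClosedWindow b K N net.lyapunovExponent →
        net.lyapunovExponent ≤ (2 + 2 * (K * shortRatio V)) * net.alphaThr b N s) ∧
      (net.InWindow b K N (net.alphaThr b N s) →
        net.lyapunovExponent ≤ 4 * net.alphaThr b N s) ∧
      ((net.InWindow b K N net.lyapunovExponent ∨ net.InWindow b K N (net.alphaThr b N s)) →
        net.lyapunovExponent ≤ (1 + 12 * (K * shortRatio V) / b) * net.alphaThr b N s) := by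
  obtain ⟨h0, h1⟩ := returnWeight_lyapunovExponent hE hirr hL hτ hpos
  rw [returnWeight_eq (b := b) (N := N) hE hL hτ hpos.le] at h1
  have hd := deltaCHigh_eq (net := net) (b := b) (N := N) (s := s) hE
  have hlw := lowWeight_nonneg (net := net) (b := b) (N := N) (s := s) hpos.le
  set lam := net.lyapunovExponent with hlam
  set S := shortRatio V with hS
  have hS1 : 1 ≤ S := one_le_shortRatio V
  have hKS : K ≤ K * S := le_mul_of_one_le_right (by linarith) hS1
  have hb0 : 0 < b := by linarith
  set δ := net.deltaCHigh b N s with hδ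
  set c := net.cPrimeHigh b N s with hc
  have hsub := highWeight_sub_le (b := b) (N := N) hE hL hτ hpos.le
  rw [← hc] at hsub
  have hc0 : 0 < c := by
    -- By the return equation the decrease of `highWeight` up to `λ*` is `δ` plus the low weight,
    -- hence at least `δ > 0`. The same inequality yields `α_thr ≤ λ*`.
    have : 0 < lam * c := by linarith
    exact pos_of_mul_pos_right this hpos.le
  have hα : net.alphaThr b N s = δ / c := rfl
  have hα0 : 0 < net.alphaThr b N s := by rw [hα]; exact div_pos hδ0 hc0
  set ρ := K * S / b with hρ
  have hρ0 : 0 ≤ ρ := by positivity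
  have hρ8 : ρ ≤ 1 / 8 := by
    rw [hρ, div_le_iff₀ hb0]
    linarith
  have hlow' : net.lowWeight b N s lam ≤ 4 * ρ * δ := by
    have : 4 * ρ * δ = 4 * (K * S) * δ / b := by rw [hρ]; ring
    rw [this, le_div_iff₀ hb0, mul_comm]
    exact hlow
  -- By monotonicity the decrease up to any `α ≤ λ*` is at most the decrease up to `λ*`, which is at
  -- most `(1 + 4 ρ) δ`. The bound is stated for such `α` because `λ*` itself need not yet be known
  -- to be small compared with the high rates.
  have hU : ∀ α T : ℝ, 0 ≤ α → α ≤ lam → 0 ≤ T →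
      (∀ x, N < net.vertexScale b x → α ≤ T * net.diagRate x) →
      α ≤ (1 + S * T) * (1 + 4 * ρ) * net.alphaThr b N s := by
    intro α T h2 h3 h4 h5
    have h6 := le_highWeight_sub (b := b) (N := N) hE hL hτ h2 h4 h5
    have h7 := highWeight_anti (b := b) (N := N) hE hL hτ h2 h3
    rw [hα, mul_div_assoc', le_div_iff₀ hc0, mul_assoc (1 + S * T)]
    refine h6.trans (mul_le_mul_of_nonneg_left ?_ (by positivity))
    linarith
  have hwin : net.InWindow b K N (net.alphaThr b N s) → ∀ x, N < net.vertexScale b x →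
      4 * net.alphaThr b N s ≤ 4 * K / b * net.diagRate x := by
    intro hw x hx
    have h2 := hw.1 x hx
    rw [div_mul_eq_mul_div, le_div_iff₀ hb0]
    linarith
  have hST : S * (4 * K / b) = 4 * ρ := by rw [hρ]; ring
  -- Bootstrap: if `λ*` exceeded `4 α_thr`, the bound `hU` at the test value `4 α_thr`, which is
  -- controlled by the window of `α_thr`, would give `4 α_thr ≤ (9 / 4) α_thr`.
  have hfour : net.InWindow b K N (net.alphaThr b N s) → lam ≤ 4 * net.alphaThr b N s := by
    intro hw
    by_contra! hcon
    have h2 := hU (4 * net.alphaThr b N s) (4 * K / b) (by linarith) hcon.le (by positivity)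
      (hwin hw)
    rw [hST] at h2
    have h3 : (1 + 4 * ρ) * (1 + 4 * ρ) ≤ 9 / 4 := by nlinarith
    nlinarith
  refine ⟨hc0, ?_, fun hw => ?_, hfour, ?_⟩
  · rw [hα, div_le_iff₀ hc0]
    linarith
  · refine (hU lam K hpos.le le_rfl (by linarith) hw.1).trans
      (mul_le_mul_of_nonneg_right ?_ hα0.le)
    nlinarith
  · have h12 : 12 * (K * S) / b = 12 * ρ := by rw [hρ]; ring
    rw [h12]
    rintro (hw | hw)
    · have h2 := hU lam (K / b) hpos.le le_rfl (by positivity) fun x hx => by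
        have h2 := hw.1 x hx
        rw [div_mul_eq_mul_div, le_div_iff₀ hb0]
        linarith
      have h3 : S * (K / b) = ρ := by rw [hρ]; ring
      rw [h3] at h2
      refine h2.trans (mul_le_mul_of_nonneg_right ?_ hα0.le)
      nlinarith
    · have h2 := hU lam (4 * K / b) hpos.le le_rfl (by positivity) fun x hx =>
        (hfour hw).trans (hwin hw x hx)
      rw [hST] at h2
      refine h2.trans (mul_le_mul_of_nonneg_right ?_ hα0.le)
      nlinarith

end ReactionNetwork

/-! ### Integer scales and elementary comparisons. -/

theorem zpow_rateScale_le {b x : ℝ} (hb : 1 < b) (hx : 0 < x) : b ^ rateScale b x ≤ x := by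
  rw [← Real.rpow_intCast]
  calc b ^ ((rateScale b x : ℤ) : ℝ) ≤ b ^ Real.logb b x :=
        Real.rpow_le_rpow_of_exponent_le hb.le (Int.floor_le _)
    _ = x := Real.rpow_logb (by linarith) hb.ne' hx

theorem lt_zpow_rateScale {b x : ℝ} (hb : 1 < b) (hx : 0 < x) : x < b ^ (rateScale b x + 1) := by
  rw [← Real.rpow_intCast]
  calc x = b ^ Real.logb b x := (Real.rpow_logb (by linarith) hb.ne' hx).symm
    _ < b ^ ((rateScale b x + 1 : ℤ) : ℝ) :=
        Real.rpow_lt_rpow_of_exponent_lt hb (by push_cast; exact Int.lt_floor_add_one _)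

theorem le_mul_zpow_rateScale {b x : ℝ} (hb : 1 < b) (hx : 0 < x) :
    x ≤ b * b ^ rateScale b x := by
  have := lt_zpow_rateScale hb hx
  rw [zpow_add_one₀ (by linarith), mul_comm] at this
  exact this.le

/-- Strictness of `B < b ^ j` absorbs the unit lost in the floor: the exponents satisfy strict
inequalities between integers. -/
theorem abs_rateScale_sub_le {b x B : ℝ} {m : ℤ} {j : ℕ} (hb : 1 < b) (hB : 0 < B)
    (hBj : B < b ^ j) (h1 : b ^ m ≤ B * x) (h2 : x ≤ B * b ^ m) :
    |rateScale b x - m| ≤ j := by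
  have hb0 : 0 < b := by linarith
  have hx : 0 < x := by
    have := (zpow_pos hb0 m).trans_le h1
    exact pos_of_mul_pos_right this hB.le
  rw [abs_le]
  constructor
  · have h3 : b ^ m < b ^ ((j : ℤ) + (rateScale b x + 1)) := by
      calc b ^ m ≤ B * x := h1
        _ < b ^ j * x := mul_lt_mul_of_pos_right hBj hx
        _ ≤ b ^ j * b ^ (rateScale b x + 1) :=
            mul_le_mul_of_nonneg_left (lt_zpow_rateScale hb hx).le (by positivity)
        _ = _ := by rw [zpow_add₀ hb0.ne' (j : ℤ), zpow_natCast]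
    have := (zpow_lt_zpow_iff_right₀ hb).1 h3
    omega
  · have h3 : b ^ rateScale b x < b ^ ((j : ℤ) + m) := by
      calc b ^ rateScale b x ≤ x := zpow_rateScale_le hb hx
        _ ≤ B * b ^ m := h2
        _ < b ^ j * b ^ m := mul_lt_mul_of_pos_right hBj (zpow_pos hb0 m)
        _ = _ := by rw [zpow_add₀ hb0.ne', zpow_natCast]
    have := (zpow_lt_zpow_iff_right₀ hb).1 h3
    omega

theorem pathWeight_mono {V : Type*} {u u' : V → V → ℝ} (hu : ∀ x y, 0 ≤ u x y)
    (h : ∀ x y, u x y ≤ u' x y) : ∀ γ : List V, pathWeight u γ ≤ pathWeight u' γ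
  | [] => le_rfl
  | [_] => le_rfl
  | σ :: τ :: γ => mul_le_mul (h σ τ) (pathWeight_mono hu h (τ :: γ)) (pathWeight_nonneg hu _)
      ((hu σ τ).trans (h σ τ))

theorem passageWeight_le_pow_mul {V : Type*} [Fintype V] [DecidableEq V] {u u' : V → V → ℝ} {c : ℝ}
    (hu : ∀ x y, 0 ≤ u x y) (h : ∀ x y, u x y ≤ c * u' x y) (A : Finset V) (t σ : V)
    (l : List V) : passageWeight A u t σ l ≤ c ^ (l.length + 1) * passageWeight A u' t σ l := by
  have h1 := passageWeight_mul A (fun _ => c) u' t σ l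
  have h2 : ((σ :: l).map fun _ => c).prod = c ^ (l.length + 1) := by simp [pow_succ']
  rw [← h2, ← h1]
  unfold passageWeight
  split_ifs
  exacts [pathWeight_mono hu h _, le_rfl]

theorem sum_map_le_prod_sub_one {V : Type*} {f : V → ℝ} (hf : ∀ v, 0 ≤ f v) (l : List V) :
    (l.map f).sum ≤ (l.map fun v => 1 + f v).prod - 1 := by
  induction l with
  | nil => simp
  | cons x l ih =>
    have h1 : 0 ≤ (l.map f).sum := List.sum_nonneg fun y hy => by
      obtain ⟨x, -, rfl⟩ := List.mem_map.1 hy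
      exact hf x
    have := mul_nonneg (hf x) (show 0 ≤ (l.map fun v => 1 + f v).prod - 1 by linarith)
    simp only [List.map_cons, List.sum_cons, List.prod_cons]
    linarith

theorem prod_sub_one_le {V : Type*} {f : V → ℝ} (hf : ∀ v, 0 ≤ f v) (hf1 : ∀ v, f v ≤ 1)
    (l : List V) : (l.map fun v => 1 + f v).prod - 1 ≤ 2 ^ l.length * (l.map f).sum := by
  have hprod : ∀ l : List V, (l.map fun v => 1 + f v).prod ≤ 2 ^ l.length := by
    intro l
    induction l with
    | nil => simp
    | cons x l ih =>
      simp only [List.map_cons, List.prod_cons, List.length_cons, pow_succ']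
      refine mul_le_mul (by linarith [hf1 x]) ih (List.prod_nonneg fun y hy => ?_) (by norm_num)
      obtain ⟨x, -, rfl⟩ := List.mem_map.1 hy
      linarith [hf x]
  induction l with
  | nil => simp
  | cons x l ih =>
    have h1 : 0 ≤ (l.map f).sum := List.sum_nonneg fun y hy => by
      obtain ⟨x, -, rfl⟩ := List.mem_map.1 hy
      exact hf x
    have h2 := mul_le_mul_of_nonneg_left (hprod l) (hf x)
    have h3 : 0 ≤ 2 ^ l.length * (l.map f).sum := by positivity
    have h4 : 0 ≤ 2 ^ l.length * f x := mul_nonneg (by positivity) (hf x)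
    simp only [List.map_cons, List.sum_cons, List.prod_cons, List.length_cons, pow_succ']
    nlinarith

/-! ### Excursion sums and their largest terms. -/

namespace ReactionNetwork

variable {V R : Type*} [Fintype V] [DecidableEq V] [Fintype R] {net : ReactionNetwork V R}
variable {s : V} {b K Q : ℝ} {N : ℤ}

open Classical in
/-- The scaling form of the transition weights. -/
def scaleWeight (net : ReactionNetwork V R) (b : ℝ) (x y : V) : ℝ :=
  if net.Edge x y then b ^ (net.edgeScale b x y - net.vertexScale b x) else 0

theorem scaleWeight_nonneg (hb : 1 < b) (x y : V) : 0 ≤ net.scaleWeight b x y := by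
  unfold scaleWeight
  split_ifs
  exacts [zpow_nonneg (by linarith) _, le_rfl]

theorem edgeScale_le (hE : ∀ σ, ∃ σ', net.Edge σ σ') {x y : V} (h : net.Edge x y) :
    net.edgeScale b x y ≤ net.vertexScale b x :=
  (isGreatest_vertexScale hE b x).2 ⟨y, h, rfl⟩

/-- Scales are integers, so a non-dominant edge loses at least one full power of `b`. Thus sums of
scale weights reduce to short paths as well, which matters because an excursion of minimal exponent
may be long. -/
theorem lightLoops_scaleWeight (hE : ∀ σ, ∃ σ', net.Edge σ σ') (hb : 1 < b) (hK : 1 ≤ K)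
    (hdom : net.SigmaDominant b s) :
    LightLoops (net.scaleWeight b) (net.DominantEdge b) s (2 * K / b) where
  nonneg := scaleWeight_nonneg hb
  le_two x y := by
    unfold scaleWeight
    split_ifs with h
    · have := zpow_le_one_of_nonpos₀ hb.le (sub_nonpos.2 (edgeScale_le hE h) :
        net.edgeScale b x y - net.vertexScale b x ≤ 0)
      linarith
    · norm_num
  le_of_not x y hD := by
    unfold scaleWeight
    split_ifs with h
    · have hne : net.edgeScale b x y ≠ net.vertexScale b x := fun h2 => hD ⟨h, h2⟩
      have hle := edgeScale_le (b := b) hE h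
      calc b ^ (net.edgeScale b x y - net.vertexScale b x) ≤ b ^ (-1 : ℤ) :=
            zpow_le_zpow_right₀ hb.le (by omega)
        _ = 1 / b := by rw [zpow_neg_one, one_div]
        _ ≤ 2 * K / b := div_le_div_of_nonneg_right (by linarith) (by linarith)
    · positivity
  acyclic := hdom.2

theorem pathWeight_scaleWeight (hb : 1 < b) : ∀ γ : List V, γ.IsChain net.Edge →
    pathWeight (net.scaleWeight b) γ = b ^ (-net.depth b γ)
  | [], _ => by simp [pathWeight, depth]
  | [_], _ => by simp [pathWeight, depth]
  | x :: y :: γ, h => by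
    rw [List.isChain_cons_cons] at h
    rw [pathWeight, pathWeight_scaleWeight hb _ h.2, depth, scaleWeight, if_pos h.1,
      ← zpow_add₀ (by linarith)]
    congr 1
    ring

theorem depth_nonneg (hE : ∀ σ, ∃ σ', net.Edge σ σ') : ∀ γ : List V, γ.IsChain net.Edge →
    0 ≤ net.depth b γ
  | [], _ => by simp [depth]
  | [_], _ => by simp [depth]
  | x :: y :: γ, h => by
    rw [List.isChain_cons_cons] at h
    have h1 := depth_nonneg hE (y :: γ) h.2
    have h2 := edgeScale_le (b := b) hE h.1
    rw [depth]
    omega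

/-- Transition rates are given by their scales up to a factor `Q`. -/
def EdgesNearScales (net : ReactionNetwork V R) (b Q : ℝ) : Prop :=
  ∀ x y, net.Edge x y → net.transitionRate x y ≤ Q * b ^ net.edgeScale b x y

theorem zpow_vertexScale_le_outRate (hE : ∀ σ, ∃ σ', net.Edge σ σ') (hb : 1 < b) (x : V) :
    b ^ net.vertexScale b x ≤ net.outRate x := by
  obtain ⟨y, hy, heq⟩ := (isGreatest_vertexScale hE b x).1
  rw [heq]
  exact (zpow_rateScale_le hb hy).trans (transitionRate_le_outRate x y)

theorem outRate_le_zpow_vertexScale (hE : ∀ σ, ∃ σ', net.Edge σ σ') (hb : 1 < b) (hQ : 1 ≤ Q)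
    (h : net.EdgesNearScales b Q) (x : V) :
    net.outRate x ≤ Fintype.card V * Q * b ^ net.vertexScale b x := by
  have hb0 : 0 < b := by linarith
  calc net.outRate x ≤ ∑ _y : V, Q * b ^ net.vertexScale b x := by
        refine sum_le_sum fun y _ => ?_
        by_cases hxy : net.Edge x y
        · exact (h x y hxy).trans (mul_le_mul_of_nonneg_left
            (zpow_le_zpow_right₀ hb.le (edgeScale_le hE hxy)) (by linarith))
        · exact (not_lt.1 hxy).trans (mul_nonneg (by linarith) (zpow_nonneg hb0.le _))
    _ = _ := by rw [sum_const, card_univ, nsmul_eq_mul, mul_assoc]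

theorem probWeight_le_scaleWeight (hE : ∀ σ, ∃ σ', net.Edge σ σ') (hb : 1 < b) (hQ : 1 ≤ Q)
    (h : net.EdgesNearScales b Q) (x y : V) :
    net.probWeight x y ≤ Q * net.scaleWeight b x y := by
  have hb0 : 0 < b := by linarith
  by_cases hxy : net.Edge x y
  · rw [scaleWeight, if_pos hxy, probWeight, div_le_iff₀ (outRate_pos hE x)]
    calc net.transitionRate x y ≤ Q * b ^ net.edgeScale b x y := h x y hxy
      _ = Q * b ^ (net.edgeScale b x y - net.vertexScale b x) * b ^ net.vertexScale b x := by
          rw [mul_assoc, ← zpow_add₀ hb0.ne', sub_add_cancel]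
      _ ≤ _ := mul_le_mul_of_nonneg_left (zpow_vertexScale_le_outRate hE hb x)
          (mul_nonneg (by linarith) (zpow_nonneg hb0.le _))
  · rw [probWeight_eq_zero hxy, scaleWeight, if_neg hxy, mul_zero]

theorem scaleWeight_le_probWeight (hE : ∀ σ, ∃ σ', net.Edge σ σ') (hb : 1 < b) (hQ : 1 ≤ Q)
    (h : net.EdgesNearScales b Q) (x y : V) :
    net.scaleWeight b x y ≤ (Fintype.card V * Q) * net.probWeight x y := by
  have hb0 : 0 < b := by linarith
  by_cases hxy : net.Edge x y
  · rw [scaleWeight, if_pos hxy, probWeight, mul_div_assoc', le_div_iff₀ (outRate_pos hE x)]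
    calc b ^ (net.edgeScale b x y - net.vertexScale b x) * net.outRate x
        ≤ b ^ (net.edgeScale b x y - net.vertexScale b x) *
            (Fintype.card V * Q * b ^ net.vertexScale b x) :=
          mul_le_mul_of_nonneg_left (outRate_le_zpow_vertexScale hE hb hQ h x)
            (zpow_nonneg hb0.le _)
      _ = Fintype.card V * Q *
            (b ^ (net.edgeScale b x y - net.vertexScale b x) * b ^ net.vertexScale b x) := by ring
      _ = Fintype.card V * Q * b ^ net.edgeScale b x y := by
          rw [← zpow_add₀ hb0.ne', sub_add_cancel]
      _ ≤ _ := mul_le_mul_of_nonneg_left (zpow_rateScale_le hb hxy)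
          (mul_nonneg (Nat.cast_nonneg _) (by linarith))
  · rw [probWeight_eq_zero hxy, scaleWeight, if_neg hxy, mul_zero]

theorem passageWeight_scaleWeight_of_mem (hb : 1 < b) {l : List V}
    (hl : s :: (l ++ [s]) ∈ net.highExcursions b N s) :
    passageWeight (net.highVertices b N) (net.scaleWeight b) s s l =
      b ^ (-net.depth b (s :: (l ++ [s]))) := by
  have h := closePath_mem_highExcursions.1 hl
  rw [passageWeight, if_pos h.1, pathWeight_scaleWeight hb _ h.2]

theorem passageWeight_eq_zero_of_notMem {u : V → V → ℝ}
    (hu : ∀ x y, ¬ net.Edge x y → u x y = 0) {l : List V}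
    (hl : s :: (l ++ [s]) ∉ net.highExcursions b N s) :
    passageWeight (net.highVertices b N) u s s l = 0 := by
  rw [closePath_mem_highExcursions, not_and_or] at hl
  rcases hl with hl | hl
  · exact if_neg hl
  · rw [passageWeight, pathWeight_eq_zero hu _ hl, ite_self]

/-- The constant in the comparison of sums over excursions with their scaling forms. -/
def scaleRatio (V : Type*) [Fintype V] [DecidableEq V] : ℝ :=
  4 * shortRatio V * (shortLists V (pathBound V)).card * (Fintype.card V : ℝ) ^ (pathBound V + 2)

/-- The exponents of the terms of a sum over the high excursions and their vertices. -/
def exponentSet (net : ReactionNetwork V R) (b : ℝ) (N : ℤ) (s : V) (f : V → ℝ) (z : V → ℤ) :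
    Set ℤ :=
  {m | ∃ γ ∈ net.highExcursions b N s, ∃ σ ∈ γ, 0 < f σ ∧ m = net.depth b γ - z σ}

/-- A sum over the high excursions is determined by its largest term. -/
theorem scaling_of_sum (hE : ∀ σ, ∃ σ', net.Edge σ σ') (hb : 1 < b) (hK : 1 ≤ K) (hQ : 1 ≤ Q)
    (hdom : net.SigmaDominant b s) (hP : LightLoops net.probWeight (net.DominantEdge b) s (2 * K / b))
    (hτ : SmallWeight V (2 * K / b)) (hnear : net.EdgesNearScales b Q)
    {f : V → ℝ} {z : V → ℤ} (hf : ∀ v, 0 ≤ f v)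
    (hfz : ∀ v, 0 < f v → f v ≤ 2 * (Fintype.card V * Q) * b ^ z v)
    (hzf : ∀ v, 0 < f v → b ^ z v ≤ 2 * (Fintype.card V * Q) * f v)
    {Y : List V → ℝ} (hY1 : ∀ l, visitSum f (s :: l) ≤ Y l)
    (hY2 : ∀ l, Y l ≤ 2 * 4 ^ l.length * visitSum f (s :: l))
    (hpos : 0 < ∑' l, passageWeight (net.highVertices b N) net.probWeight s s l * Y l) :
    sInf (net.exponentSet b N s f z) ∈ net.exponentSet b N s f z ∧
    (∀ m ∈ net.exponentSet b N s f z, sInf (net.exponentSet b N s f z) ≤ m) ∧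
    b ^ (-sInf (net.exponentSet b N s f z)) ≤ scaleRatio V * Q ^ (pathBound V + 1) *
      ∑' l, passageWeight (net.highVertices b N) net.probWeight s s l * Y l ∧
    ∑' l, passageWeight (net.highVertices b N) net.probWeight s s l * Y l ≤
      scaleRatio V * Q ^ (pathBound V + 1) * b ^ (-sInf (net.exponentSet b N s f z)) := by
  have hb0 : 0 < b := by linarith
  set A := net.highVertices b N with hA
  set E := net.exponentSet b N s f z with hEdef
  set n : ℝ := ((Fintype.card V : ℕ) : ℝ) with hn
  set M := pathBound V with hM
  have hn1 : 1 ≤ n := by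
    have : 1 ≤ Fintype.card V := Fintype.card_pos_iff.2 ⟨s⟩
    rw [hn]
    exact_mod_cast this
  have hQ0 : 0 ≤ Q := by linarith
  have hS0 := shortRatio_nonneg V
  have hnn := passageWeight_nonneg hP.nonneg A s s
  have hβ := lightLoops_scaleWeight (K := K) hE hb hK hdom
  have hβnn := passageWeight_nonneg hβ.nonneg A s s
  have hvs : ∀ l : List V, 0 ≤ visitSum f l := visitSum_nonneg hf
  have hY0 : ∀ l, 0 ≤ Y l := fun l => (hvs _).trans (hY1 l)
  have hmem : ∀ {x : V} {l : List V}, x ∈ s :: (l ++ [s]) ↔ x ∈ s :: l := by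
    intro x l
    simp only [List.mem_cons, List.mem_append, List.not_mem_nil, or_false]
    tauto
  have hs4 := hP.summable_visitSum hτ A s f
  have hterm : ∀ l, passageWeight A net.probWeight s s l * Y l ≤
      2 * (4 ^ l.length * passageWeight A net.probWeight s s l * visitSum f (s :: l)) := fun l => by
    calc _ ≤ passageWeight A net.probWeight s s l * (2 * 4 ^ l.length * visitSum f (s :: l)) :=
          mul_le_mul_of_nonneg_left (hY2 l) (hnn l)
      _ = _ := by ring
  have hsY : Summable fun l => passageWeight A net.probWeight s s l * Y l :=
    Summable.of_nonneg_of_le (fun l => mul_nonneg (hnn l) (hY0 l)) hterm (hs4.mul_left 2)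
  -- Positivity of the sum guarantees a term; otherwise `sInf` on `ℤ` would be a default value.
  have hne : E.Nonempty := by
    by_contra hcon
    refine hpos.ne' ((tsum_congr fun l => ?_).trans tsum_zero)
    by_cases hl : s :: (l ++ [s]) ∈ net.highExcursions b N s
    · have h0 : visitSum f (s :: l) = 0 := by
        refine sum_eq_zero fun v _ => ?_
        split_ifs with hv
        · by_contra hfv
          exact hcon ⟨_, _, hl, v, hmem.2 hv, lt_of_le_of_ne (hf v) (Ne.symm hfv), rfl⟩
        · rfl
      have h2 := hY2 l
      rw [h0, mul_zero] at h2
      rw [le_antisymm h2 (hY0 l), mul_zero]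
    · rw [passageWeight_eq_zero_of_notMem (fun _ _ h => probWeight_eq_zero h) hl, zero_mul]
  have hbdd : BddBelow E := by
    have : Nonempty V := ⟨s⟩
    obtain ⟨v, hv⟩ := Finite.exists_max z
    refine ⟨-z v, ?_⟩
    rintro m ⟨γ, hγ, σ, -, -, rfl⟩
    obtain ⟨-, -, -, hch⟩ := hγ.1
    have h1 := depth_nonneg (b := b) hE γ hch
    have h2 := hv σ
    omega
  set m := sInf E with hm
  have hmE : m ∈ E := Int.csInf_mem hne hbdd
  have hmin : ∀ k ∈ E, m ≤ k := fun k hk => csInf_le hbdd hk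
  have hcard1 : (1 : ℝ) ≤ (shortLists V M).card := by
    have h1 : 0 < M := Fintype.card_pos_iff.2 ⟨(s, true)⟩
    have : 0 < (shortLists V M).card := card_pos.2 ⟨[], mem_shortLists.2 h1⟩
    exact_mod_cast this
  refine ⟨hmE, hmin, ?_, ?_⟩
  -- Lower bound: the minimiser is first replaced by short paths within the scale model. Only then
  -- are scale weights compared with probabilities, since this costs a factor `n * Q` per edge.
  · obtain ⟨γ, hγ, σ, hσ, hfσ, hmeq⟩ := hmE
    obtain ⟨l₀, rfl⟩ := exists_closePath_of_mem_highExcursions γ hγ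
    have hsβ := hβ.summable_visitSum hτ A s f
    have h1 : b ^ (-m) ≤ 2 * (n * Q) * (passageWeight A (net.scaleWeight b) s s l₀ *
        visitSum f (s :: l₀)) := by
      have hexp : -m = -net.depth b (s :: (l₀ ++ [s])) + z σ := by omega
      rw [hexp, zpow_add₀ hb0.ne', ← passageWeight_scaleWeight_of_mem hb hγ]
      calc _ ≤ passageWeight A (net.scaleWeight b) s s l₀ * (2 * (n * Q) * f σ) :=
            mul_le_mul_of_nonneg_left (hzf σ hfσ) (hβnn l₀)
        _ = 2 * (n * Q) * (passageWeight A (net.scaleWeight b) s s l₀ * f σ) := by ring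
        _ ≤ _ := mul_le_mul_of_nonneg_left (mul_le_mul_of_nonneg_left
            (le_visitSum hf (hmem.1 hσ)) (hβnn l₀)) (by positivity)
    have h2 : passageWeight A (net.scaleWeight b) s s l₀ * visitSum f (s :: l₀) ≤
        shortRatio V * ∑ l ∈ shortLists V M,
          passageWeight A (net.scaleWeight b) s s l * visitSum f (s :: l) := by
      refine le_trans ?_ (hβ.tsum_visitSum_le hτ A s hf)
      refine le_trans ?_ (hsβ.le_tsum l₀ fun l _ =>
        mul_nonneg (mul_nonneg (by positivity) (hβnn l)) (hvs _))
      rw [mul_assoc]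
      exact le_mul_of_one_le_left (mul_nonneg (hβnn l₀) (hvs _)) (one_le_pow₀ (by norm_num))
    have h3 : ∑ l ∈ shortLists V M, passageWeight A (net.scaleWeight b) s s l *
        visitSum f (s :: l) ≤ (n * Q) ^ M *
          ∑' l, passageWeight A net.probWeight s s l * Y l := by
      refine le_trans ?_ (mul_le_mul_of_nonneg_left
        (hsY.sum_le_tsum (shortLists V M) fun l _ => mul_nonneg (hnn l) (hY0 l)) (by positivity))
      rw [mul_sum]
      refine sum_le_sum fun l hl => ?_
      have h4 := passageWeight_le_pow_mul hβ.nonneg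
        (scaleWeight_le_probWeight hE hb hQ hnear) A s s l
      have h5 : (n * Q) ^ (l.length + 1) ≤ (n * Q) ^ M :=
        pow_le_pow_right₀ (one_le_mul_of_one_le_of_one_le hn1 hQ) (mem_shortLists.1 hl)
      rw [← mul_assoc]
      exact mul_le_mul (h4.trans (mul_le_mul_of_nonneg_right h5 (hnn l))) (hY1 l) (hvs _)
        (mul_nonneg (by positivity) (hnn l))
    have h6 : 2 * (n * Q) * (shortRatio V * ((n * Q) ^ M)) ≤ scaleRatio V * Q ^ (M + 1) := by
      have h7 : n ^ (M + 1) ≤ n ^ (M + 2) := pow_le_pow_right₀ hn1 (by omega)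
      have h8 : 2 * shortRatio V ≤ 4 * shortRatio V * (shortLists V M).card := by
        nlinarith [mul_nonneg hS0 (sub_nonneg.2 hcard1)]
      calc 2 * (n * Q) * (shortRatio V * ((n * Q) ^ M))
          = (2 * shortRatio V) * n ^ (M + 1) * Q ^ (M + 1) := by ring
        _ ≤ (4 * shortRatio V * (shortLists V M).card) * n ^ (M + 2) * Q ^ (M + 1) :=
            mul_le_mul_of_nonneg_right (mul_le_mul h8 h7 (by positivity) (by positivity))
              (by positivity)
        _ = _ := rfl
    calc b ^ (-m) ≤ 2 * (n * Q) * (shortRatio V * ((n * Q) ^ M *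
          ∑' l, passageWeight A net.probWeight s s l * Y l)) :=
        h1.trans (mul_le_mul_of_nonneg_left (h2.trans (mul_le_mul_of_nonneg_left h3 hS0))
          (by positivity))
      _ = 2 * (n * Q) * (shortRatio V * ((n * Q) ^ M)) *
          ∑' l, passageWeight A net.probWeight s s l * Y l := by ring
      _ ≤ _ := mul_le_mul_of_nonneg_right h6 hpos.le
  · have hbm : 0 < b ^ (-m) := zpow_pos hb0 _
    -- Each visited vertex contributes at most `2 n Q` times `b ^ (-m)` by minimality of `m`, and
    -- there are at most `n` of them.
    have h1 : ∀ l, passageWeight A (net.scaleWeight b) s s l * visitSum f (s :: l) ≤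
        n * (2 * (n * Q)) * b ^ (-m) := by
      intro l
      by_cases hl : s :: (l ++ [s]) ∈ net.highExcursions b N s
      · rw [passageWeight_scaleWeight_of_mem hb hl, visitSum, mul_sum]
        calc _ ≤ ∑ _v : V, 2 * (n * Q) * b ^ (-m) := by
              refine sum_le_sum fun v _ => ?_
              have h0 : 0 ≤ 2 * (n * Q) * b ^ (-m) := by positivity
              split_ifs with hv
              · rcases (hf v).eq_or_lt with hfv | hfv
                · rwa [← hfv, mul_zero]
                · have h3 := hmin _ ⟨_, hl, v, hmem.2 hv, hfv, rfl⟩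
                  calc _ ≤ b ^ (-net.depth b (s :: (l ++ [s]))) * (2 * (n * Q) * b ^ z v) :=
                        mul_le_mul_of_nonneg_left (hfz v hfv) (zpow_nonneg hb0.le _)
                    _ = 2 * (n * Q) * b ^ (-net.depth b (s :: (l ++ [s])) + z v) := by
                        rw [zpow_add₀ hb0.ne']
                        ring
                    _ ≤ _ := mul_le_mul_of_nonneg_left
                        (zpow_le_zpow_right₀ hb.le (by omega)) (by positivity)
              · rwa [mul_zero]
          _ = _ := by rw [sum_const, card_univ, nsmul_eq_mul, ← hn, mul_assoc]; ring
      · rw [passageWeight_eq_zero_of_notMem (fun _ _ h => by rw [scaleWeight, if_neg h]) hl,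
          zero_mul]
        positivity
    -- For the upper bound too, the reduction to short paths precedes the comparison with scales, so
    -- that only `Q ^ M` is lost.
    calc ∑' l, passageWeight A net.probWeight s s l * Y l
        ≤ ∑' l, 2 * (4 ^ l.length * passageWeight A net.probWeight s s l *
            visitSum f (s :: l)) := hsY.tsum_le_tsum hterm (hs4.mul_left 2)
      _ ≤ 2 * (shortRatio V * ∑ l ∈ shortLists V M,
            passageWeight A net.probWeight s s l * visitSum f (s :: l)) := by
          rw [tsum_mul_left]
          exact mul_le_mul_of_nonneg_left (hP.tsum_visitSum_le hτ A s hf) (by norm_num)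
      _ ≤ 2 * (shortRatio V * ∑ _l ∈ shortLists V M,
            Q ^ M * (n * (2 * (n * Q)) * b ^ (-m))) := by
          refine mul_le_mul_of_nonneg_left (mul_le_mul_of_nonneg_left
            (sum_le_sum fun l hl => ?_) hS0) (by norm_num)
          have h4 := passageWeight_le_pow_mul hP.nonneg
            (probWeight_le_scaleWeight hE hb hQ hnear) A s s l
          have h5 : Q ^ (l.length + 1) ≤ Q ^ M := pow_le_pow_right₀ hQ (mem_shortLists.1 hl)
          calc passageWeight A net.probWeight s s l * visitSum f (s :: l)
              ≤ (Q ^ M * passageWeight A (net.scaleWeight b) s s l) * visitSum f (s :: l) :=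
                mul_le_mul_of_nonneg_right
                  (h4.trans (mul_le_mul_of_nonneg_right h5 (hβnn l))) (hvs _)
            _ = Q ^ M * (passageWeight A (net.scaleWeight b) s s l * visitSum f (s :: l)) := by
                ring
            _ ≤ _ := mul_le_mul_of_nonneg_left (h1 l) (by positivity)
      _ = (4 * shortRatio V * (shortLists V M).card * n ^ 2) * (Q ^ (M + 1) * b ^ (-m)) := by
          rw [sum_const, nsmul_eq_mul]
          ring
      _ ≤ (4 * shortRatio V * (shortLists V M).card * n ^ (M + 2)) *
            (Q ^ (M + 1) * b ^ (-m)) := by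
          refine mul_le_mul_of_nonneg_right (mul_le_mul_of_nonneg_left
            (pow_le_pow_right₀ hn1 (by omega)) (by positivity)) (by positivity)
      _ = _ := by rw [scaleRatio, ← hM, ← hn]; ring

end ReactionNetwork

/-! ### Scaling forms of `c'_high`, of the gain and of the threshold. -/

namespace ReactionNetwork

variable {V R : Type*} [Fintype V] [DecidableEq V] [Fintype R] {net : ReactionNetwork V R}
variable {s : V} {b K Q : ℝ} {N : ℤ}

theorem deficiencyWeight_nonneg (hdeg : ∀ r, net.products r ≠ 0) (x : V) :
    0 ≤ net.deficiencyWeight x := by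
  refine div_nonneg ?_ (abs_nonneg _)
  rw [deficiencyRate_eq]
  exact sub_nonneg.2 (diagRate_le_outRate hdeg x)

theorem one_div_diagRate_le (hE : ∀ σ, ∃ σ', net.Edge σ σ') (hb : 1 < b) (x : V) :
    1 / net.diagRate x ≤ 2 * b ^ (-net.vertexScale b x) := by
  have h1 := zpow_vertexScale_le_outRate hE hb x
  have h2 := outRate_le (net := net) x
  have hb0 : 0 < b ^ net.vertexScale b x := zpow_pos (by linarith) _
  rw [zpow_neg, ← div_eq_mul_inv, div_le_div_iff₀ (diagRate_pos hE x) hb0]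
  linarith

/-- Absence of degradation is essential: it gives a_σ ≤ k_σ. A strong degradation would make a_σ
much larger than the scale read off from the outgoing edges. -/
theorem zpow_neg_vertexScale_le (hE : ∀ σ, ∃ σ', net.Edge σ σ') (hb : 1 < b) (hQ : 1 ≤ Q)
    (hdeg : ∀ r, net.products r ≠ 0) (hnear : net.EdgesNearScales b Q) (x : V) :
    b ^ (-net.vertexScale b x) ≤ (Fintype.card V * Q) * (1 / net.diagRate x) := by
  have h1 := outRate_le_zpow_vertexScale hE hb hQ hnear x
  have h2 := diagRate_le_outRate hdeg x
  have hb0 : 0 < b ^ net.vertexScale b x := zpow_pos (by linarith) _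
  rw [zpow_neg, ← one_div, mul_one_div, div_le_div_iff₀ hb0 (diagRate_pos hE x)]
  linarith

theorem one_le_gainFactor (hdeg : ∀ r, net.products r ≠ 0) (l : List V) :
    1 ≤ net.gainFactor l := by
  have h1 := sum_map_le_prod_sub_one (deficiencyWeight_nonneg hdeg) l
  have h2 : 0 ≤ (l.map net.deficiencyWeight).sum := List.sum_nonneg fun y hy => by
    obtain ⟨x, -, rfl⟩ := List.mem_map.1 hy
    exact deficiencyWeight_nonneg hdeg x
  rw [gainFactor]
  linarith

/-- Minimising over the vertices of each excursion and then over excursions is the same as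
minimising over pairs, once the infimum over pairs is known to be attained and to be a lower bound.
-/
theorem nPrimeHigh_eq (hE : ∀ σ, ∃ σ', net.Edge σ σ')
    (hmem : sInf (net.exponentSet b N s (fun v => 1 / net.diagRate v)
      (fun v => -net.vertexScale b v)) ∈ net.exponentSet b N s (fun v => 1 / net.diagRate v)
      (fun v => -net.vertexScale b v))
    (hmin : ∀ m ∈ net.exponentSet b N s (fun v => 1 / net.diagRate v)
      (fun v => -net.vertexScale b v), sInf (net.exponentSet b N s (fun v => 1 / net.diagRate v)
      (fun v => -net.vertexScale b v)) ≤ m) :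
    net.nPrimeHigh b N s = -sInf (net.exponentSet b N s (fun v => 1 / net.diagRate v)
      (fun v => -net.vertexScale b v)) := by
  set E := net.exponentSet b N s (fun v => 1 / net.diagRate v) (fun v => -net.vertexScale b v)
  have hscale : ∀ γ : List V, γ ≠ [] →
      IsLeast {n | ∃ σ ∈ γ, n = net.vertexScale b σ} (net.pathScale b γ) := by
    intro γ hγ
    have hfin : {n | ∃ σ ∈ γ, n = net.vertexScale b σ}.Finite := by
      refine (Set.finite_range (net.vertexScale b)).subset ?_
      rintro n ⟨x, -, rfl⟩
      exact ⟨x, rfl⟩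
    obtain ⟨x, hx⟩ := List.exists_mem_of_ne_nil γ hγ
    have hne : {n | ∃ σ ∈ γ, n = net.vertexScale b σ}.Nonempty := ⟨_, x, hx, rfl⟩
    exact ⟨Int.csInf_mem hne hfin.bddBelow, fun n hn => csInf_le hfin.bddBelow hn⟩
  have hsub : ∀ γ ∈ net.highExcursions b N s, net.depth b γ + net.pathScale b γ ∈ E := by
    intro γ hγ
    obtain ⟨l, rfl⟩ := exists_closePath_of_mem_highExcursions γ hγ
    obtain ⟨σ, hσ, heq⟩ := (hscale _ (List.cons_ne_nil s (l ++ [s]))).1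
    exact ⟨_, hγ, σ, hσ, one_div_pos.2 (diagRate_pos hE σ), by rw [heq]; ring⟩
  rw [nPrimeHigh]
  congr 1
  refine IsLeast.csInf_eq ⟨?_, ?_⟩
  · obtain ⟨γ, hγ, σ, hσ, -, heq⟩ := hmem
    refine ⟨γ, hγ, le_antisymm (hmin _ (hsub γ hγ)) ?_⟩
    have := (hscale γ (List.ne_nil_of_mem hσ)).2 ⟨σ, hσ, rfl⟩
    rw [heq]
    linarith
  · rintro m ⟨γ, hγ, rfl⟩
    exact hmin _ (hsub γ hγ)

/-- Positive `κ_σ` and positive `ε_σ` are equivalent as a_σ > 0, and ε_σ has scale d_σ - n_σ up to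
the controlled constants. -/
theorem qTwo_eq (hE : ∀ σ, ∃ σ', net.Edge σ σ') :
    net.qTwo b N s = sInf (net.exponentSet b N s net.deficiencyWeight
      (fun v => rateScale b (net.deficiencyRate v) - net.vertexScale b v)) := by
  rw [qTwo, exponentSet]
  congr 1
  ext m
  refine exists_congr fun γ => and_congr_right fun _ => exists_congr fun σ =>
    and_congr_right fun _ => and_congr ?_ ?_
  · rw [deficiencyWeight, div_pos_iff_of_pos_right (diagRate_pos hE σ)]
  · constructor <;> intro h <;> omega

/-- The scaling form of `c'_high`. -/
theorem cPrimeHigh_scaling (hE : ∀ σ, ∃ σ', net.Edge σ σ') (hb : 1 < b) (hK : 1 ≤ K)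
    (hQ : 1 ≤ Q) (hdom : net.SigmaDominant b s) (hsep : net.ScaleSeparated b K)
    (hτ : SmallWeight V (2 * K / b)) (hnear : net.EdgesNearScales b Q)
    (hdeg : ∀ r, net.products r ≠ 0) (hpos : 0 < net.cPrimeHigh b N s) :
    b ^ net.nPrimeHigh b N s ≤ scaleRatio V * Q ^ (pathBound V + 1) * net.cPrimeHigh b N s ∧
      net.cPrimeHigh b N s ≤
        scaleRatio V * Q ^ (pathBound V + 1) * b ^ net.nPrimeHigh b N s := by
  have hL := lightLoops_weight hE (by linarith) (by linarith) hdom hsep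
  have hP := lightLoops_probWeight hE (by linarith) (by linarith) hdom hsep
  have hc : net.cPrimeHigh b N s = ∑' l, passageWeight (net.highVertices b N) net.probWeight s s l *
      (net.gainFactor (s :: l) * net.residence (s :: l)) := by
    rw [cPrimeHigh_eq hE hL hτ]
    refine tsum_congr fun l => ?_
    rw [passageWeight_weight_zero_eq hE]
    ring
  have hn1 : (1 : ℝ) ≤ Fintype.card V := by
    exact_mod_cast (Fintype.card_pos_iff.2 ⟨s⟩ : 0 < Fintype.card V)
  have hnQ : 1 ≤ (Fintype.card V : ℝ) * Q := one_le_mul_of_one_le_of_one_le hn1 hQ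
  have hf : ∀ v, 0 ≤ 1 / net.diagRate v := fun v => (one_div_pos.2 (diagRate_pos hE v)).le
  have key := scaling_of_sum (N := N) (f := fun v => 1 / net.diagRate v)
    (z := fun v => -net.vertexScale b v)
    (Y := fun l => net.gainFactor (s :: l) * net.residence (s :: l))
    hE hb hK hQ hdom hP hτ hnear hf (fun v _ => ?_) (fun v _ => ?_) (fun l => ?_) (fun l => ?_)
    (by rwa [← hc])
  · rw [← hc] at key
    rw [nPrimeHigh_eq hE key.1 key.2.1]
    exact key.2.2
  · refine (one_div_diagRate_le hE hb v).trans (mul_le_mul_of_nonneg_right (by linarith)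
      (zpow_nonneg (by linarith) _))
  · refine (zpow_neg_vertexScale_le hE hb hQ hdeg hnear v).trans
      (mul_le_mul_of_nonneg_right (by linarith) (hf v))
  · exact (visitSum_le_sum_map hf _).trans
      (le_mul_of_one_le_left (residence_nonneg _) (one_le_gainFactor hdeg _))
  · have h1 := sum_map_le_visitSum hf (s :: l)
    have h2 := gainFactor_le hE (s :: l)
    rw [List.length_cons] at h1 h2
    push_cast at h1
    calc net.gainFactor (s :: l) * net.residence (s :: l)
        ≤ 2 ^ (l.length + 1) * (((l.length : ℝ) + 1) *
            visitSum (fun v => 1 / net.diagRate v) (s :: l)) :=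
          mul_le_mul h2 h1 (residence_nonneg _) (by positivity)
      _ = (((l.length : ℝ) + 1) * 2 ^ (l.length + 1)) *
            visitSum (fun v => 1 / net.diagRate v) (s :: l) := by ring
      _ ≤ _ := mul_le_mul_of_nonneg_right (succ_mul_two_pow_le _) (visitSum_nonneg hf _)

/-- The scaling form of the gain of the high excursions. -/
theorem highGain_scaling (hE : ∀ σ, ∃ σ', net.Edge σ σ') (hb : 1 < b) (hK : 1 ≤ K)
    (hQ : 1 ≤ Q) (hdom : net.SigmaDominant b s) (hsep : net.ScaleSeparated b K)
    (hτ : SmallWeight V (2 * K / b)) (hnear : net.EdgesNearScales b Q)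
    (hnear' : ∀ σ, 0 < net.deficiencyRate σ →
      net.deficiencyRate σ ≤ Q * b ^ rateScale b (net.deficiencyRate σ))
    (hdeg : ∀ r, net.products r ≠ 0) (hpos : 0 < net.highGain b N s) :
    b ^ (-net.qTwo b N s) ≤ scaleRatio V * Q ^ (pathBound V + 1) * net.highGain b N s ∧
      net.highGain b N s ≤
        scaleRatio V * Q ^ (pathBound V + 1) * b ^ (-net.qTwo b N s) := by
  have hb0 : 0 < b := by linarith
  have hP := lightLoops_probWeight hE hb0 (by linarith) hdom hsep
  have hc : net.highGain b N s = ∑' l, passageWeight (net.highVertices b N) net.probWeight s s l *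
      (net.gainFactor (s :: l) - 1) := by
    rw [highGain_eq]
    exact tsum_congr fun l => mul_comm _ _
  have hn1 : (1 : ℝ) ≤ Fintype.card V := by
    exact_mod_cast (Fintype.card_pos_iff.2 ⟨s⟩ : 0 < Fintype.card V)
  have hf := deficiencyWeight_nonneg hdeg
  have hf1 : ∀ v, net.deficiencyWeight v ≤ 1 := fun v => by
    linarith [one_add_deficiencyWeight_le hE v]
  have key := scaling_of_sum (N := N) (f := net.deficiencyWeight)
    (z := fun v => rateScale b (net.deficiencyRate v) - net.vertexScale b v)
    (Y := fun l => net.gainFactor (s :: l) - 1)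
    hE hb hK hQ hdom hP hτ hnear hf (fun v hv => ?_) (fun v hv => ?_) (fun l => ?_) (fun l => ?_)
    (by rwa [← hc])
  · rw [← hc, ← qTwo_eq hE] at key
    exact key.2.2
  · have hκ : 0 < net.deficiencyRate v := (div_pos_iff_of_pos_right (diagRate_pos hE v)).1 hv
    calc net.deficiencyWeight v = net.deficiencyRate v * (1 / net.diagRate v) := by
          rw [deficiencyWeight, mul_one_div]
      _ ≤ (Q * b ^ rateScale b (net.deficiencyRate v)) * (2 * b ^ (-net.vertexScale b v)) :=
          mul_le_mul (hnear' v hκ) (one_div_diagRate_le hE hb v)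
            (one_div_pos.2 (diagRate_pos hE v)).le (by positivity)
      _ = 1 * (2 * Q * b ^ (rateScale b (net.deficiencyRate v) - net.vertexScale b v)) := by
          rw [sub_eq_add_neg, zpow_add₀ hb0.ne']
          ring
      _ ≤ Fintype.card V *
            (2 * Q * b ^ (rateScale b (net.deficiencyRate v) - net.vertexScale b v)) :=
          mul_le_mul_of_nonneg_right hn1 (by positivity)
      _ = _ := by ring
  · have hκ : 0 < net.deficiencyRate v := (div_pos_iff_of_pos_right (diagRate_pos hE v)).1 hv
    have h0 : 0 ≤ (Fintype.card V * Q) * net.deficiencyWeight v := by positivity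
    calc b ^ (rateScale b (net.deficiencyRate v) - net.vertexScale b v)
        = b ^ rateScale b (net.deficiencyRate v) * b ^ (-net.vertexScale b v) := by
          rw [sub_eq_add_neg, zpow_add₀ hb0.ne']
      _ ≤ net.deficiencyRate v * ((Fintype.card V * Q) * (1 / net.diagRate v)) :=
          mul_le_mul (zpow_rateScale_le hb hκ) (zpow_neg_vertexScale_le hE hb hQ hdeg hnear v)
            (zpow_nonneg hb0.le _) hκ.le
      _ = (Fintype.card V * Q) * net.deficiencyWeight v := by
          rw [deficiencyWeight]
          ring
      _ ≤ _ := by linarith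
  · exact (visitSum_le_sum_map hf _).trans (sum_map_le_prod_sub_one hf _)
  · have h1 := sum_map_le_visitSum hf (s :: l)
    have h2 := prod_sub_one_le hf hf1 (s :: l)
    rw [List.length_cons] at h1 h2
    push_cast at h1
    calc net.gainFactor (s :: l) - 1
        ≤ 2 ^ (l.length + 1) * (((l.length : ℝ) + 1) *
            visitSum net.deficiencyWeight (s :: l)) :=
          h2.trans (mul_le_mul_of_nonneg_left h1 (by positivity))
      _ = (((l.length : ℝ) + 1) * 2 ^ (l.length + 1)) *
            visitSum net.deficiencyWeight (s :: l) := by ring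
      _ ≤ _ := mul_le_mul_of_nonneg_right (succ_mul_two_pow_le _) (visitSum_nonneg hf _)

/-- The scaling form of the threshold equation. -/
theorem abs_rateScale_alphaThr_le (hE : ∀ σ, ∃ σ', net.Edge σ σ') (hb : 1 < b) (hK : 1 ≤ K)
    (hQ : 1 ≤ Q) (hdom : net.SigmaDominant b s) (hsep : net.ScaleSeparated b K)
    (hτ : SmallWeight V (2 * K / b)) (hnear : net.EdgesNearScales b Q)
    (hnear' : ∀ σ, 0 < net.deficiencyRate σ →
      net.deficiencyRate σ ≤ Q * b ^ rateScale b (net.deficiencyRate σ))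
    (hdeg : ∀ r, net.products r ≠ 0) (hc : 0 < net.cPrimeHigh b N s)
    (hδ : 0 < net.deltaCHigh b N s) (hδG : net.deltaCHigh b N s ≤ net.highGain b N s)
    (hGδ : net.highGain b N s ≤ 2 * net.deltaCHigh b N s) {x C : ℝ} {j : ℕ} (hC : 1 ≤ C)
    (hx1 : net.alphaThr b N s ≤ x) (hx2 : x ≤ C * net.alphaThr b N s)
    (hj : 2 * C * (ReactionNetwork.scaleRatio V * Q ^ (pathBound V + 1)) ^ 2 < b ^ j) :
    |rateScale b x - (-net.qTwo b N s - net.nPrimeHigh b N s)| ≤ j := by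
  have hb0 : 0 < b := by linarith
  obtain ⟨hc1, hc2⟩ := cPrimeHigh_scaling hE hb hK hQ hdom hsep hτ hnear hdeg hc
  obtain ⟨hG1, hG2⟩ := highGain_scaling hE hb hK hQ hdom hsep hτ hnear hnear' hdeg
    (hδ.trans_le hδG)
  set A := scaleRatio V * Q ^ (pathBound V + 1) with hA
  set c := net.cPrimeHigh b N s with hcdef
  set δ := net.deltaCHigh b N s with hδdef
  have hα : net.alphaThr b N s = δ / c := rfl
  have hn : 0 < b ^ net.nPrimeHigh b N s := zpow_pos hb0 _
  have hq : 0 < b ^ (-net.qTwo b N s) := zpow_pos hb0 _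
  have hA0 : 0 < A := pos_of_mul_pos_left (hn.trans_le hc1) hc.le
  have he : b ^ (-net.qTwo b N s - net.nPrimeHigh b N s) =
      b ^ (-net.qTwo b N s) / b ^ net.nPrimeHigh b N s := zpow_sub₀ hb0.ne' _ _
  have hαpos : 0 < δ / c := div_pos hδ hc
  have h1 : b ^ (-net.qTwo b N s) / b ^ net.nPrimeHigh b N s ≤ 2 * A ^ 2 * (δ / c) := by
    rw [mul_div_assoc', div_le_div_iff₀ hn hc]
    calc b ^ (-net.qTwo b N s) * c ≤ (A * (2 * δ)) * (A * b ^ net.nPrimeHigh b N s) :=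
          mul_le_mul (hG1.trans (mul_le_mul_of_nonneg_left hGδ hA0.le)) hc2 hc.le (by positivity)
      _ = _ := by ring
  have h2 : δ / c ≤ A ^ 2 * (b ^ (-net.qTwo b N s) / b ^ net.nPrimeHigh b N s) := by
    rw [mul_div_assoc', div_le_div_iff₀ hc hn]
    calc δ * b ^ net.nPrimeHigh b N s ≤ (A * b ^ (-net.qTwo b N s)) * (A * c) :=
          mul_le_mul (hδG.trans hG2) hc1 hn.le (by positivity)
      _ = _ := by ring
  rw [hα] at hx1 hx2
  -- One factor `A` comes from the gain and one from `c'_high`, the 2 from `highGain ≤ 2 δ`, and `C`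
  -- from the distance between `x` and `α_thr`.
  refine abs_rateScale_sub_le hb (B := 2 * C * A ^ 2) (by positivity) hj ?_ ?_
  · rw [he]
    calc _ ≤ 1 * (2 * A ^ 2 * (δ / c)) := by rw [one_mul]; exact h1
      _ ≤ C * (2 * A ^ 2 * x) :=
          mul_le_mul hC (mul_le_mul_of_nonneg_left hx1 (by positivity)) (by positivity)
            (by linarith)
      _ = _ := by ring
  · rw [he]
    calc x ≤ C * (A ^ 2 * (b ^ (-net.qTwo b N s) / b ^ net.nPrimeHigh b N s)) :=
          hx2.trans (mul_le_mul_of_nonneg_left h2 (by linarith))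
      _ ≤ 2 * (C * (A ^ 2 * (b ^ (-net.qTwo b N s) / b ^ net.nPrimeHigh b N s))) := by
          have : 0 ≤ C * (A ^ 2 * (b ^ (-net.qTwo b N s) / b ^ net.nPrimeHigh b N s)) := by
            positivity
          linarith
      _ = _ := by ring

end ReactionNetwork

end

/-! ### Choice of the constants and conclusion. -/

theorem mainTheorem3 (V : Type*) [Fintype V] [DecidableEq V] (K : ℝ) (hK : 1 ≤ K) :
    ∃ (C b₀ : ℝ) (p : ℕ), 1 ≤ C ∧ 1 < b₀ ∧
      ∀ (R : Type*) [Fintype R] (net : ReactionNetwork V R) (b : ℝ) (s : V) (N : ℤ),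
        b₀ ≤ b →
        net.Irreducible →
        0 < net.lyapunovExponent →
        net.SigmaDominant b s →
        net.ScaleSeparated b K →
        net.AwayFromTransition b K N s →
        (net.InClosedWindow b K N net.lyapunovExponent ∨
          (0 < net.alphaThr b N s ∧ net.InWindow b K N (net.alphaThr b N s))) →
        -- the sums and the derivative that enter the definitions converge
        (Summable fun γ : {γ : List V // net.IsExcursion s γ} => pathWeight (net.weight 0) γ) ∧
        DifferentiableAt ℝ (fun α => net.highWeight b N s α) 0 ∧
        -- the threshold parameter approximates the Lyapunov exponent
        0 < net.cPrimeHigh b N s ∧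
        net.alphaThr b N s ≤ net.lyapunovExponent ∧
        net.lyapunovExponent ≤ C * net.alphaThr b N s ∧
        ((net.InWindow b K N net.lyapunovExponent ∨ net.InWindow b K N (net.alphaThr b N s)) →
          net.lyapunovExponent ≤ (1 + C / b) * net.alphaThr b N s) ∧
        -- only Regime (1) (a) occurs
        0 < net.deltaCHigh b N s ∧
        b * net.lowWeight b N s net.lyapunovExponent ≤ C * net.deltaCHigh b N s ∧
        -- scaling form of the threshold equation, in the absence of degradation
        ((∀ r, net.products r ≠ 0) →
          (|rateScale b (net.alphaThr b N s) - (-net.qTwo b N s - net.nPrimeHigh b N s)| ≤ p ∧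
            |rateScale b net.lyapunovExponent - (-net.qTwo b N s - net.nPrimeHigh b N s)| ≤ p) ∧
          (net.RatesNearScales b K →
            |rateScale b (net.alphaThr b N s) - (-net.qTwo b N s - net.nPrimeHigh b N s)| ≤ 1 ∧
            |rateScale b net.lyapunovExponent - (-net.qTwo b N s - net.nPrimeHigh b N s)| ≤ 1)) := by
  have hS1 : 1 ≤ shortRatio V := one_le_shortRatio V
  have hKS : K ≤ K * shortRatio V := le_mul_of_one_le_right (by linarith) hS1
  -- `C` dominates `4`, `2 + 2 K S`, `12 K S` and `4 K S` with `S = shortRatio V`, the constants in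
  -- the estimates of `λ*` and of the low weight.
  set C : ℝ := 4 + 12 * (K * shortRatio V) with hC
  set M := pathBound V with hM
  set Z : ℝ := (M : ℝ) ^ 3 * (M * 8) ^ M with hZ
  set Γ : ℝ := 2 * C * ReactionNetwork.scaleRatio V ^ 2 with hΓ
  have hC1 : 1 ≤ C := by linarith
  have hZ0 : 0 ≤ 4 * K * Z := by positivity
  have hΓ0 : 0 ≤ Γ := by positivity
  have hΓK : 0 ≤ Γ * K ^ (2 * M + 2) := by positivity
  -- The summands of `b₀` secure in turn `1 < b`, the threshold estimates, `SmallWeight V (2 * K /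
  -- b)`, and an error below one power of `b` in the scaling form.
  refine ⟨C, 2 + 8 * (K * shortRatio V) + 4 * K * Z + Γ * K ^ (2 * M + 2), 2 * M + 3, hC1,
    by linarith, ?_⟩
  intro R _ net b s N hb hirr hpos hdom hsep haway hwin
  have hb1 : 1 < b := by linarith
  have hb0 : 0 < b := by linarith
  have hE := ReactionNetwork.exists_edge hirr hdom
  have hτ : SmallWeight V (2 * K / b) := by
    refine ⟨by positivity, ?_⟩
    rw [← hM, ← hZ, div_mul_eq_mul_div, div_le_iff₀ hb0]
    linarith
  have hL := ReactionNetwork.lightLoops_weight hE hb0 (by linarith) hdom hsep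
  have hP := ReactionNetwork.lightLoops_probWeight hE hb0 (by linarith) hdom hsep
  obtain ⟨hδ, hδG, hGδ, hlow⟩ :=
    ReactionNetwork.threshold_estimates hE hirr hL hP hτ hK (by linarith) hpos haway hwin
  obtain ⟨hc, hαle, hclosed, hopen, hwindow⟩ :=
    ReactionNetwork.alphaThr_estimates hE hirr hL hτ hK (by linarith) hpos hδ hlow
  have hα0 : 0 < net.alphaThr b N s := div_pos hδ hc
  have hle : net.lyapunovExponent ≤ C * net.alphaThr b N s := by
    rcases hwin with hw | hw
    · exact (hclosed hw).trans (mul_le_mul_of_nonneg_right (by linarith) hα0.le)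
    · exact (hopen hw.2).trans (mul_le_mul_of_nonneg_right (by linarith) hα0.le)
  refine ⟨(ReactionNetwork.summable_excursions_iff fun _ _ h => ReactionNetwork.weight_eq_zero h).2
      (summable_passageWeight_of_four_pow hL.nonneg (hL.summable hτ Finset.univ s)),
    (ReactionNetwork.hasDerivAt_highWeight hE hL hτ).differentiableAt, hc, hαle, hle, fun hw => ?_, hδ, ?_,
    fun hdeg => ⟨?_, fun hnear => ?_⟩⟩
  · refine (hwindow hw).trans (mul_le_mul_of_nonneg_right ?_ hα0.le)
    have : 12 * (K * shortRatio V) / b ≤ C / b :=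
      div_le_div_of_nonneg_right (by linarith) hb0.le
    linarith
  · exact hlow.trans (mul_le_mul_of_nonneg_right (by linarith) hδ.le)
  -- Any rate is within a factor `b` of its scale, so `Q = b` is always admissible. The error is
  -- then `Γ b ^ (2 M + 2)`, which explains `p = 2 M + 3`.
  · have hj : 2 * C * (ReactionNetwork.scaleRatio V * b ^ (pathBound V + 1)) ^ 2 < b ^ (2 * M + 3) := by
      have h1 : Γ < b := by
        have : Γ ≤ Γ * K ^ (2 * M + 2) := le_mul_of_one_le_right hΓ0 (one_le_pow₀ hK)
        linarith
      calc 2 * C * (ReactionNetwork.scaleRatio V * b ^ (M + 1)) ^ 2 = Γ * b ^ (2 * M + 2) := by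
            rw [hΓ]
            ring
        _ < b * b ^ (2 * M + 2) := mul_lt_mul_of_pos_right h1 (by positivity)
        _ = b ^ (2 * M + 3) := by ring
    have key := fun (x : ℝ) (hx1 : net.alphaThr b N s ≤ x) (hx2 : x ≤ C * net.alphaThr b N s) =>
      ReactionNetwork.abs_rateScale_alphaThr_le hE hb1 hK hb1.le hdom hsep hτ
        (fun x y h => le_mul_zpow_rateScale hb1 h) (fun σ h => le_mul_zpow_rateScale hb1 h) hdeg
        hc hδ hδG hGδ hC1 hx1 hx2 hj
    exact ⟨key _ le_rfl (le_mul_of_one_le_left hα0.le hC1), key _ hαle hle⟩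
  -- With rates near their scales `Q = K` is admissible, and the whole error `Γ K ^ (2 M + 2)` stays
  -- below `b`.
  · have hj : 2 * C * (ReactionNetwork.scaleRatio V * K ^ (pathBound V + 1)) ^ 2 < b ^ 1 := by
      calc 2 * C * (ReactionNetwork.scaleRatio V * K ^ (M + 1)) ^ 2 = Γ * K ^ (2 * M + 2) := by
            rw [hΓ]
            ring
        _ < b ^ 1 := by linarith
    have key := fun (x : ℝ) (hx1 : net.alphaThr b N s ≤ x) (hx2 : x ≤ C * net.alphaThr b N s) =>
      ReactionNetwork.abs_rateScale_alphaThr_le hE hb1 hK hK hdom hsep hτ hnear.1 hnear.2 hdeg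
        hc hδ hδG hGδ hC1 hx1 hx2 hj
    exact ⟨by exact_mod_cast key _ le_rfl (le_mul_of_one_le_left hα0.le hC1),
      by exact_mod_cast key _ hαle hle⟩
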